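/- **Theorem 2.1.** Let $n\ge 1$ and $\beta_1,\dots,\beta_n\in[-1,\infty)$. Let $A^2_{\beta,n}$ be the weighted Bergman space over the polydisk $\mathbb{D}^n=\{\zeta\in\mathbb{C}^n: |\zeta_i|<1 \text{ for all } i\}$, that is, the Hilbert space of all power series $F=\sum_{\alpha\in\mathbb{Z}_{\ge 0}^n} c_\alpha\zeta^\alpha$ with $$\|F\|^2=\sum_{\alpha}|c_\alpha|^2\omega_\alpha<\infty,\qquad \omega_\alpha=\prod_{i=1}^n\frac{\alpha_i!\,\Gamma(\beta_i+2)}{\Gamma(\alpha_i+\beta_i+2)},$$ each such series being identified with the holomorphic function on $\mathbb{D}^n$ to which it converges. A submodule of $A^2_{\beta,n}$ is a closed linear subspace that is invariant under multiplication by all polynomials in $\zeta_1,\dots,\zeta_n$, and $[\varphi]_n$ denotes the smallest submodule containing $\varphi\in A^2_{\beta,n}$. Suppose that $\varphi$ is holomorphic in some neighborhood of the closed polydisk $\overline{\mathbb{D}}^n$. Then $\varphi\in A^2_{\beta,n}$ and $$[\varphi]_n=\left\{\varphi f\in A^2_{\beta,n} : f \text{ is holomorphic in } \mathbb{D}^n\right\}.$$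 -/

import Mathlib

namespace WeightedBergman

/-- The open unit polydisk `𝔻ⁿ`. -/
def polydisk (n : ℕ) : Set (Fin n → ℂ) := {z | ∀ i, ‖z i‖ < 1}

/-- The closed unit polydisk. -/
def closedPolydisk (n : ℕ) : Set (Fin n → ℂ) := {z | ∀ i, ‖z i‖ ≤ 1}

/-- The weight `ω_α = ∏ᵢ αᵢ! Γ(βᵢ + 2) / Γ(αᵢ + βᵢ + 2)`, the squared norm of the monomial `ζ^α`;
the parameters `βᵢ` lie in `[-1, ∞)`. -/
noncomputable def weight {n : ℕ} (β : Fin n → Set.Ici (-1 : ℝ)) (α : Fin n →₀ ℕ) : ℝ :=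
  ∏ i, (Nat.factorial (α i) : ℝ) * Real.Gamma ((β i : ℝ) + 2) / Real.Gamma ((α i : ℝ) + (β i : ℝ) + 2)

theorem weight_pos {n : ℕ} (β : Fin n → Set.Ici (-1 : ℝ)) (α : Fin n →₀ ℕ) : 0 < weight β α := by
  refine Finset.prod_pos fun i _ => ?_
  have h : (-1 : ℝ) ≤ (β i : ℝ) := (β i).2
  have h1 : (0 : ℝ) < (β i : ℝ) + 2 := by linarith
  have h2 : (0 : ℝ) < (α i : ℝ) + (β i : ℝ) + 2 := by
    have : (0 : ℝ) ≤ (α i : ℝ) := Nat.cast_nonneg _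
    linarith
  have h3 := Real.Gamma_pos_of_pos h1
  have h4 := Real.Gamma_pos_of_pos h2
  positivity

/-- The weighted Bergman space `A²_{β,n}`: the power series `∑ c_α ζ^α` in `n` variables with
`∑ |c_α|² ω_α < ∞`. -/
def space {n : ℕ} (β : Fin n → Set.Ici (-1 : ℝ)) : Submodule ℂ (MvPowerSeries (Fin n) ℂ) where
  carrier := {F | Summable fun α => ‖MvPowerSeries.coeff α F‖ ^ 2 * weight β α}
  zero_mem' := by simp [summable_zero]
  add_mem' := by
    intro F G hF hG
    refine Summable.of_nonneg_of_le (fun α => mul_nonneg (sq_nonneg _) (weight_pos β α).le)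
      (fun α => ?_) ((hF.add hG).mul_left 2)
    have h1 : ‖MvPowerSeries.coeff α (F + G)‖ ≤
        ‖MvPowerSeries.coeff α F‖ + ‖MvPowerSeries.coeff α G‖ := by
      rw [map_add]
      exact norm_add_le _ _
    have h2 : ‖MvPowerSeries.coeff α (F + G)‖ ^ 2 ≤
        2 * (‖MvPowerSeries.coeff α F‖ ^ 2 + ‖MvPowerSeries.coeff α G‖ ^ 2) := by
      have := pow_le_pow_left₀ (norm_nonneg _) h1 2
      nlinarith [sq_nonneg (‖MvPowerSeries.coeff α F‖ - ‖MvPowerSeries.coeff α G‖)]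
    have := mul_le_mul_of_nonneg_right h2 (weight_pos β α).le
    linarith
  smul_mem' := by
    intro a F hF
    refine (hF.mul_left (‖a‖ ^ 2)).congr fun α => ?_
    rw [MvPowerSeries.coeff_smul, norm_mul]
    ring

/-- The linear map `F = ∑ c_α ζ^α ↦ (√ω_α c_α)_α` from `A²_{β,n}` to `ℓ²`. -/
noncomputable def toL2 {n : ℕ} (β : Fin n → Set.Ici (-1 : ℝ)) :
    space β →ₗ[ℂ] lp (fun _ : Fin n →₀ ℕ => ℂ) 2 where
  toFun F := ⟨fun α => (√(weight β α) : ℂ) * MvPowerSeries.coeff α F.1, by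
    have hF : Summable fun α => ‖MvPowerSeries.coeff α F.1‖ ^ 2 * weight β α := F.2
    refine memℓp_gen (hF.congr fun α => ?_)
    simp only [ENNReal.toReal_ofNat, Real.rpow_two, norm_mul, mul_pow, Complex.norm_real,
      Real.norm_eq_abs, sq_abs, Real.sq_sqrt (weight_pos β α).le]
    ring⟩
  map_add' F G := by
    ext α
    change _ * MvPowerSeries.coeff α (F.1 + G.1) = _ * _ + _ * _
    rw [map_add, mul_add]
  map_smul' a F := by
    ext α
    change _ * MvPowerSeries.coeff α (a • F.1) = a * (_ * _)
    rw [MvPowerSeries.coeff_smul]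
    ring

theorem toL2_injective {n : ℕ} (β : Fin n → Set.Ici (-1 : ℝ)) :
    Function.Injective (toL2 β) := by
  intro F G h
  ext α
  have h1 : (√(weight β α) : ℂ) * MvPowerSeries.coeff α F.1
      = (√(weight β α) : ℂ) * MvPowerSeries.coeff α G.1 := congrArg (fun x => x.1 α) h
  have h2 : (√(weight β α) : ℂ) ≠ 0 := by
    exact_mod_cast (Real.sqrt_pos.2 (weight_pos β α)).ne'
  exact mul_left_cancel₀ h2 h1

/-- The norm of `A²_{β,n}`, pulled back from `ℓ²`; see `norm_sq_eq`. -/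
noncomputable instance instNormedAddCommGroup {n : ℕ} (β : Fin n → Set.Ici (-1 : ℝ)) :
    NormedAddCommGroup (space β) :=
  NormedAddCommGroup.induced (space β) (lp (fun _ : Fin n →₀ ℕ => ℂ) 2) (toL2 β) (toL2_injective β)

theorem norm_sq_eq {n : ℕ} (β : Fin n → Set.Ici (-1 : ℝ)) (F : space β) :
    ‖F‖ ^ 2 = ∑' α, ‖MvPowerSeries.coeff α (F : MvPowerSeries (Fin n) ℂ)‖ ^ 2 * weight β α := by
  have h := lp.norm_rpow_eq_tsum (p := 2) (by norm_num) (toL2 β F)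
  simp only [ENNReal.toReal_ofNat, Real.rpow_two] at h
  refine h.trans (tsum_congr fun α => ?_)
  change ‖(√(weight β α) : ℂ) * MvPowerSeries.coeff α F.1‖ ^ 2 = _
  simp only [norm_mul, mul_pow, Complex.norm_real,
    Real.norm_eq_abs, sq_abs, Real.sq_sqrt (weight_pos β α).le]
  ring

/-- The power series `F` converges on `𝔻ⁿ` (absolutely) to the function `g`: this is the
identification of elements of `A²_{β,n}` with functions on `𝔻ⁿ`. -/
def Represents {n : ℕ} (F : MvPowerSeries (Fin n) ℂ) (g : (Fin n → ℂ) → ℂ) : Prop :=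
  ∀ z ∈ polydisk n, HasSum (fun α => MvPowerSeries.coeff α F * ∏ i, z i ^ α i) (g z)

/-- `M` is a submodule of the Hilbert module `A²_{β,n}` over the polynomial ring: a closed linear
subspace such that `p F ∈ M` for all polynomials `p` and all `F ∈ M`. -/
def IsHilbertSubmodule {n : ℕ} (β : Fin n → Set.Ici (-1 : ℝ)) (M : Submodule ℂ (space β)) : Prop :=
  IsClosed (M : Set (space β)) ∧
    ∀ p : MvPolynomial (Fin n) ℂ, ∀ F ∈ M, ∃ G ∈ M,
      (G : MvPowerSeries (Fin n) ℂ) = (p : MvPowerSeries (Fin n) ℂ) * (F : MvPowerSeries (Fin n) ℂ)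

/-- The submodule `[𝓕]_n` generated by a subset `𝓕` of `A²_{β,n}`: the intersection of all
(closed, polynomial-invariant) submodules that contain `𝓕`. -/
noncomputable def generated {n : ℕ} (β : Fin n → Set.Ici (-1 : ℝ)) (𝓕 : Set (space β)) :
    Submodule ℂ (space β) :=
  sInf {M | IsHilbertSubmodule β M ∧ 𝓕 ⊆ M}

end WeightedBergman

namespace WeightedBergman

open Filter Topology Metric MeasureTheory
open scoped ENNReal NNReal

/-! ### Holomorphic limits, and power series measured by weighted `ℓ¹` norms -/

section

/-! The multiples of `φ` form a closed submodule: norm convergence implies locally uniform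
convergence, and division by `φ` respects the latter, by the maximum principle on small discs whose
boundary circles avoid the zeros of `φ`. Hence `[φ]` consists of multiples
(`isHilbertSubmodule_multiples`).

Conversely, let `F = φ f` lie in the space and put `f_r(ζ) = f(rζ)` for `r < 1`. The series of `f_r`
converges absolutely on the closed polydisk, so `φ f_r ∈ [φ]` by polynomial approximation, and its
coefficients tend to those of `F` as `r → 1`. Closed subspaces are weakly closed, so it suffices
that `‖φ f_r‖` stays bounded (`mem_of_represents_mul`).

The bound `‖φ f_r‖² ≤ K ‖φ f‖²` follows from the same inequality for the quadratic means over
polycircles, with `K` independent of `f`, `r` and the radii (`exists_torus_dilation_le`), because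
the weights are moments of a product of probability measures on `[0, 1]` (`tsum_weight_le`). By
rotation invariance the coordinates can be dilated one at a time, which leaves one-variable slices
`g` of `φ`.

Suppose that the supremum of `|g|` over `|w| ≤ R`, where `R > 1`, is at most `C` times its supremum
over a small disc. Then the number of zeros of `g` near the closed unit disc is bounded in terms of
`C`. They are removed by Blaschke factors, at the price of a constant for each; the zero-free
remainder is bounded below by Borel–Carathéodory, and for it the estimate is the monotonicity of
circular means of `|f|²` (`exists_circleSq_mul_dilation_le`).

The doubling constant `C` must be uniform over all slices, although slices of `φ` may degenerate to
`0`. Expand `φ` along the coordinate; the coefficients `φ_k` are holomorphic in the base point. By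
Dickson's lemma finitely many leading exponents suffice for the ideal generated by the `φ_k`, and
division with estimates gives `|φ_k| ≤ B R⁻ᵏ ∑_{j<N} |φ_j|` near each point (`exists_enorm_ev_le`,
`exists_norm_taylor_cons_le`). The first `N` coefficients are controlled on any small disc by
Cauchy's estimates. Doubling follows locally, and then for whole slices by compactness and a chain
of discs (`exists_doubling_slices`). -/

theorem norm_fderiv_le_of_norm_le {E : Type*} [NormedAddCommGroup E] [NormedSpace ℂ E]
    {f : E → ℂ} {x : E} {r M : ℝ} (hr : 0 < r) (hf : DifferentiableOn ℂ f (ball x r))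
    (hM : ∀ y ∈ ball x r, ‖f y‖ ≤ M) : ‖fderiv ℂ f x‖ ≤ 2 * M / r := by
  refine Complex.norm_fderiv_le_div_of_mapsTo_ball hf (fun y hy => ?_) hr
  rw [mem_closedBall, dist_eq_norm]
  have := norm_sub_le (f y) (f x)
  linarith [hM y hy, hM x (mem_ball_self hr)]

/-- A limit of holomorphic functions that is uniform near each point is holomorphic. -/
theorem differentiableOn_of_tendstoUniformlyOn_nhds {E ι : Type*} [NormedAddCommGroup E]
    [NormedSpace ℂ E] {l : Filter ι} [l.NeBot] {f : ι → E → ℂ} {g : E → ℂ} {s : Set E}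
    (hs : IsOpen s) (hf : ∀ n, DifferentiableOn ℂ (f n) s)
    (h : ∀ x ∈ s, ∃ t ∈ 𝓝 x, TendstoUniformlyOn f g l t) : DifferentiableOn ℂ g s := by
  intro x hx
  obtain ⟨t, ht, htu⟩ := h x hx
  obtain ⟨r, hr, hrt⟩ := Metric.mem_nhds_iff.1 (inter_mem ht (hs.mem_nhds hx))
  have hsub : ∀ y ∈ ball x (r / 2), ball y (r / 2) ⊆ t ∩ s := fun y hy =>
    (ball_subset_ball' (by rw [mem_ball] at hy; linarith)).trans hrt
  have hcau : UniformCauchySeqOn (fun n => fderiv ℂ (f n)) l (ball x (r / 2)) := by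
    intro u hu
    obtain ⟨ε, hε, hεu⟩ := Metric.mem_uniformity_dist.1 hu
    have h2 := htu.uniformCauchySeqOn
    -- Cauchy's estimate on balls of radius `r / 2` turns this bound for the functions into `ε / 2`
    -- for the derivatives.
    have h3 : {p : ℂ × ℂ | dist p.1 p.2 < ε * r / 8} ∈ uniformity ℂ :=
      Metric.dist_mem_uniformity (by positivity)
    filter_upwards [h2 _ h3] with m hm y hy
    apply hεu
    have hd1 : DifferentiableAt ℂ (f m.1) y :=
      (hf _).differentiableAt (hs.mem_nhds (hsub y hy (mem_ball_self (by linarith))).2)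
    have hd2 : DifferentiableAt ℂ (f m.2) y :=
      (hf _).differentiableAt (hs.mem_nhds (hsub y hy (mem_ball_self (by linarith))).2)
    rw [dist_eq_norm, ← fderiv_sub hd1 hd2]
    have := norm_fderiv_le_of_norm_le (f := f m.1 - f m.2) (x := y) (r := r / 2) (M := ε * r / 8)
      (by linarith)
      (((hf _).sub (hf _)).mono ((hsub y hy).trans Set.inter_subset_right)) (fun z hz => by
        have := hm z (hsub y hy hz).1
        simp only [dist_eq_norm] at this
        exact this.le)
    refine this.trans_lt ?_
    field_simp
    norm_num
  have hlim : ∀ y ∈ ball x (r / 2), ∃ L, Tendsto (fun n => fderiv ℂ (f n) y) l (𝓝 L) := fun y hy =>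
    cauchy_map_iff_exists_tendsto.1 (hcau.cauchy_map hy)
  choose! g' hg' using hlim
  have hu := hcau.tendstoUniformlyOn_of_tendsto hg'
  exact (hasFDerivAt_of_tendstoUniformlyOn (x := x) isOpen_ball hu (fun n y hy =>
    ((hf n).differentiableAt (hs.mem_nhds
      (hsub y hy (mem_ball_self (by linarith))).2)).hasFDerivAt)
    (fun y hy => htu.tendsto_at (hsub y hy (mem_ball_self (by linarith))).1)
    (mem_ball_self (by linarith))).differentiableAt.differentiableWithinAt

/-- The value `r^α` of a monomial at a tuple of radii, as an extended nonnegative real. -/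
noncomputable def radius {n : ℕ} (r : Fin n → ℝ≥0) (α : Fin n →₀ ℕ) : ℝ≥0∞ :=
  ∏ i, (r i : ℝ≥0∞) ^ α i

/-- The weighted `ℓ¹` norm `∑ |c_α| r^α` of a power series. -/
noncomputable def absNorm {n : ℕ} (r : Fin n → ℝ≥0) (X : MvPowerSeries (Fin n) ℂ) : ℝ≥0∞ :=
  ∑' α, ‖MvPowerSeries.coeff α X‖ₑ * radius r α

/-- The sum of a power series at a point. -/
noncomputable def ev {n : ℕ} (X : MvPowerSeries (Fin n) ℂ) (z : Fin n → ℂ) : ℂ :=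
  ∑' α, MvPowerSeries.coeff α X * ∏ i, z i ^ α i

variable {n : ℕ}

theorem radius_add (r : Fin n → ℝ≥0) (α β : Fin n →₀ ℕ) :
    radius r (α + β) = radius r α * radius r β := by
  simp [radius, pow_add, Finset.prod_mul_distrib]

theorem radius_ne_top (r : Fin n → ℝ≥0) (α : Fin n →₀ ℕ) : radius r α ≠ ∞ :=
  ENNReal.prod_ne_top fun i _ => by simp

theorem radius_ne_zero {r : Fin n → ℝ≥0} (hr : ∀ i, 0 < r i) (α : Fin n →₀ ℕ) :
    radius r α ≠ 0 :=
  Finset.prod_ne_zero_iff.2 fun i _ => pow_ne_zero _ (by simpa using (hr i).ne')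

theorem radius_mono {r s : Fin n → ℝ≥0} (h : ∀ i, r i ≤ s i) (α : Fin n →₀ ℕ) :
    radius r α ≤ radius s α :=
  Finset.prod_le_prod' fun i _ => by gcongr; exact h i

theorem enorm_monomial (z : Fin n → ℂ) (α : Fin n →₀ ℕ) :
    ‖∏ i, z i ^ α i‖ₑ = radius (fun i => ‖z i‖₊) α := by
  simp only [radius, enorm_eq_nnnorm, nnnorm_prod, nnnorm_pow]
  push_cast
  rfl

theorem enorm_term (X : MvPowerSeries (Fin n) ℂ) (z : Fin n → ℂ) (α : Fin n →₀ ℕ) :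
    ‖MvPowerSeries.coeff α X * ∏ i, z i ^ α i‖ₑ =
      ‖MvPowerSeries.coeff α X‖ₑ * radius (fun i => ‖z i‖₊) α := by
  rw [enorm_mul, enorm_monomial]

theorem absNorm_mono {r s : Fin n → ℝ≥0} (h : ∀ i, r i ≤ s i) (X : MvPowerSeries (Fin n) ℂ) :
    absNorm r X ≤ absNorm s X :=
  ENNReal.tsum_le_tsum fun α => by gcongr; exact radius_mono h α

theorem absNorm_add_le (r : Fin n → ℝ≥0) (X Y : MvPowerSeries (Fin n) ℂ) :
    absNorm r (X + Y) ≤ absNorm r X + absNorm r Y := by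
  rw [absNorm, absNorm, absNorm, ← ENNReal.tsum_add]
  refine ENNReal.tsum_le_tsum fun α => ?_
  rw [map_add, ← add_mul]
  gcongr
  exact enorm_add_le _ _

theorem absNorm_neg (r : Fin n → ℝ≥0) (X : MvPowerSeries (Fin n) ℂ) :
    absNorm r (-X) = absNorm r X := by
  simp [absNorm]

theorem absNorm_zero (r : Fin n → ℝ≥0) : absNorm r (0 : MvPowerSeries (Fin n) ℂ) = 0 := by
  simp [absNorm]

theorem absNorm_sum_le {ι : Type*} (r : Fin n → ℝ≥0) (s : Finset ι)
    (X : ι → MvPowerSeries (Fin n) ℂ) :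
    absNorm r (∑ i ∈ s, X i) ≤ ∑ i ∈ s, absNorm r (X i) := by
  classical
  induction s using Finset.induction_on with
  | empty => simp [absNorm_zero]
  | insert a s ha ih =>
    rw [Finset.sum_insert ha, Finset.sum_insert ha]
    exact (absNorm_add_le _ _ _).trans (by gcongr)

/-- `radius` is multiplicative along antidiagonals. Submultiplicativity is what the division by a
Neumann series rests on. -/
theorem absNorm_mul_le (r : Fin n → ℝ≥0) (X Y : MvPowerSeries (Fin n) ℂ) :
    absNorm r (X * Y) ≤ absNorm r X * absNorm r Y := by
  classical
  have h1 : absNorm r X * absNorm r Y =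
      ∑' p : (Fin n →₀ ℕ) × (Fin n →₀ ℕ), (‖MvPowerSeries.coeff p.1 X‖ₑ * radius r p.1) *
        (‖MvPowerSeries.coeff p.2 Y‖ₑ * radius r p.2) := by
    rw [ENNReal.tsum_prod', absNorm, ← ENNReal.tsum_mul_right]
    refine tsum_congr fun α => ?_
    rw [absNorm, ← ENNReal.tsum_mul_left]
  rw [h1, ← Finset.HasAntidiagonal.sigmaAntidiagonalEquivProd.tsum_eq, ENNReal.tsum_sigma']
  refine ENNReal.tsum_le_tsum fun α => ?_
  rw [MvPowerSeries.coeff_mul, tsum_fintype, Finset.univ_eq_attach]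
  refine (mul_le_mul_left (enorm_sum_le _ _) _).trans ?_
  rw [Finset.sum_mul, ← Finset.sum_attach]
  refine Finset.sum_le_sum fun p _ => ?_
  simp only [Finset.HasAntidiagonal.sigmaAntidiagonalEquivProd_apply]
  have h2 : radius r α = radius r p.1.1 * radius r p.1.2 := by
    rw [← radius_add, Finset.HasAntidiagonal.mem_antidiagonal.1 p.2]
  rw [h2, enorm_mul]
  exact le_of_eq (by ring)

theorem summable_of_absNorm_ne_top {X : MvPowerSeries (Fin n) ℂ} {z : Fin n → ℂ}
    (h : absNorm (fun i => ‖z i‖₊) X ≠ ∞) :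
    Summable fun α => ‖MvPowerSeries.coeff α X * ∏ i, z i ^ α i‖ := by
  have h1 : ∑' α, ‖MvPowerSeries.coeff α X * ∏ i, z i ^ α i‖ₑ ≠ ∞ := by
    simpa only [enorm_term, absNorm] using h
  simp only [enorm_eq_nnnorm] at h1
  exact NNReal.summable_coe.2 (ENNReal.tsum_coe_ne_top_iff_summable.1 h1)

theorem absNorm_ne_top_of_summable {X : MvPowerSeries (Fin n) ℂ} {z : Fin n → ℂ}
    (h : Summable fun α => MvPowerSeries.coeff α X * ∏ i, z i ^ α i) :
    absNorm (fun i => ‖z i‖₊) X ≠ ∞ := by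
  have h1 : ∑' α, ‖MvPowerSeries.coeff α X * ∏ i, z i ^ α i‖ₑ ≠ ∞ := by
    simp only [enorm_eq_nnnorm]
    exact ENNReal.tsum_coe_ne_top_iff_summable.2 (NNReal.summable_coe.1 h.norm)
  simpa only [enorm_term, absNorm] using h1

theorem hasSum_ev {X : MvPowerSeries (Fin n) ℂ} {z : Fin n → ℂ}
    (h : absNorm (fun i => ‖z i‖₊) X ≠ ∞) :
    HasSum (fun α => MvPowerSeries.coeff α X * ∏ i, z i ^ α i) (ev X z) :=
  (summable_of_absNorm_ne_top h).of_norm.hasSum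

theorem ev_add {X Y : MvPowerSeries (Fin n) ℂ} {z : Fin n → ℂ}
    (hX : absNorm (fun i => ‖z i‖₊) X ≠ ∞) (hY : absNorm (fun i => ‖z i‖₊) Y ≠ ∞) :
    ev (X + Y) z = ev X z + ev Y z := by
  rw [ev, ← ((hasSum_ev hX).add (hasSum_ev hY)).tsum_eq]
  exact tsum_congr fun α => by rw [map_add, add_mul]

theorem ev_sum {ι : Type*} (s : Finset ι) {X : ι → MvPowerSeries (Fin n) ℂ} {z : Fin n → ℂ}
    (hX : ∀ i ∈ s, absNorm (fun i => ‖z i‖₊) (X i) ≠ ∞) :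
    ev (∑ i ∈ s, X i) z = ∑ i ∈ s, ev (X i) z := by
  have h := hasSum_sum (f := fun i α => MvPowerSeries.coeff α (X i) * ∏ j, z j ^ α j)
    fun i hi => hasSum_ev (hX i hi)
  rw [ev, ← h.tsum_eq]
  exact tsum_congr fun α => by rw [map_sum, Finset.sum_mul]

theorem ev_mul {X Y : MvPowerSeries (Fin n) ℂ} {z : Fin n → ℂ}
    (hX : absNorm (fun i => ‖z i‖₊) X ≠ ∞) (hY : absNorm (fun i => ‖z i‖₊) Y ≠ ∞) :
    ev (X * Y) z = ev X z * ev Y z := by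
  classical
  have h1 := summable_of_absNorm_ne_top hX
  have h2 := summable_of_absNorm_ne_top hY
  have h4 := summable_mul_of_summable_norm h1 h2
  rw [ev, ev, ev, Summable.tsum_mul_tsum_eq_tsum_sum_antidiagonal h1.of_norm h2.of_norm h4]
  refine tsum_congr fun α => ?_
  rw [MvPowerSeries.coeff_mul, Finset.sum_mul]
  refine Finset.sum_congr rfl fun p hp => ?_
  have h5 : (∏ i, z i ^ α i) = (∏ i, z i ^ p.1 i) * ∏ i, z i ^ p.2 i := by
    rw [← Finset.HasAntidiagonal.mem_antidiagonal.1 hp]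
    simp only [Finsupp.add_apply, pow_add, Finset.prod_mul_distrib]
  rw [h5, mul_mul_mul_comm]

theorem enorm_ev_le (X : MvPowerSeries (Fin n) ℂ) (z : Fin n → ℂ) :
    ‖ev X z‖ₑ ≤ absNorm (fun i => ‖z i‖₊) X := by
  by_cases h : absNorm (fun i => ‖z i‖₊) X = ∞
  · rw [h]; exact le_top
  · have h1 := summable_of_absNorm_ne_top h
    have h3 : absNorm (fun i => ‖z i‖₊) X =
        ∑' α, ‖MvPowerSeries.coeff α X * ∏ i, z i ^ α i‖ₑ := by simp only [enorm_term, absNorm]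
    rw [h3]
    exact enorm_tsum_le_tsum_enorm

/-- Fubini in `ℝ≥0∞`, peeling off the first index. It reduces sums over multi-indices to
one-variable series, both for geometric majorants and for the weights. -/
theorem tsum_prod_eq_prod_tsum (a : Fin n → ℕ → ℝ≥0∞) :
    ∑' α : Fin n →₀ ℕ, ∏ i, a i (α i) = ∏ i, ∑' k, a i k := by
  have h0 : ∀ m (a : Fin m → ℕ → ℝ≥0∞), ∑' α : Fin m → ℕ, ∏ i, a i (α i) = ∏ i, ∑' k, a i k := by
    intro m
    induction m with
    | zero => intro a; simp
    | succ m ih =>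
      intro a
      rw [← (Fin.consEquiv fun _ => ℕ).tsum_eq, ENNReal.tsum_prod', Fin.prod_univ_succ, ← ih,
        ← ENNReal.tsum_mul_right]
      refine tsum_congr fun k => ?_
      rw [← ENNReal.tsum_mul_left]
      refine tsum_congr fun α => ?_
      simp [Fin.prod_univ_succ, Fin.consEquiv]
  rw [← h0, ← Finsupp.equivFunOnFinite.symm.tsum_eq]
  rfl

theorem tsum_radius_ne_top {r : Fin n → ℝ≥0} (hr : ∀ i, r i < 1) : ∑' α, radius r α ≠ ∞ := by
  simp only [radius]
  rw [tsum_prod_eq_prod_tsum fun i k => (r i : ℝ≥0∞) ^ k]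
  refine ENNReal.prod_ne_top fun i _ => ?_
  rw [ENNReal.tsum_geometric]
  rw [Ne, ENNReal.inv_eq_top, tsub_eq_zero_iff_le, not_le]
  exact_mod_cast hr i

end

/-! ### Taylor expansion of holomorphic functions on polydisks -/

section

/-- The Taylor expansion at `0` of a bounded holomorphic function on a disc, with the Cauchy
estimates for its coefficients. -/
theorem taylor_of_bounded {R M : ℝ} (hR : 0 < R) {g : ℂ → ℂ} (hg : DifferentiableOn ℂ g (ball 0 R))
    (hM : ∀ w ∈ ball (0 : ℂ) R, ‖g w‖ ≤ M) :
    (∀ k, ‖iteratedDeriv k g 0 / k.factorial‖ ≤ M * R⁻¹ ^ k) ∧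
      ∀ w ∈ ball (0 : ℂ) R, HasSum (fun k => iteratedDeriv k g 0 / k.factorial * w ^ k) (g w) := by
  constructor
  · intro k
    -- Cauchy's estimate needs a closed disc inside the domain, so it is applied at `ρ < R` and `ρ`
    -- tends to `R`.
    have h1 : ∀ᶠ ρ in 𝓝[<] R, ‖iteratedDeriv k g 0 / k.factorial‖ ≤ M * ρ⁻¹ ^ k := by
      filter_upwards [Ioo_mem_nhdsLT hR] with ρ hρ
      have hsub : closedBall (0 : ℂ) ρ ⊆ ball 0 R := closedBall_subset_ball hρ.2
      have := Complex.norm_iteratedDeriv_le_of_forall_mem_sphere_norm_le (f := g) (c := 0) (C := M)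
        k hρ.1 ((hg.mono hsub).diffContOnCl_ball subset_rfl)
        (fun z hz => hM z (hsub (sphere_subset_closedBall hz)))
      have hk : (0 : ℝ) < k.factorial := by positivity
      rw [norm_div, Complex.norm_natCast, div_le_iff₀ hk]
      refine this.trans (le_of_eq ?_)
      rw [inv_pow]; field_simp
    have h2 : Tendsto (fun ρ : ℝ => M * ρ⁻¹ ^ k) (𝓝[<] R) (𝓝 (M * R⁻¹ ^ k)) :=
      (((tendsto_inv₀ hR.ne').pow k).const_mul M).mono_left nhdsWithin_le_nhds
    exact ge_of_tendsto h2 h1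
  · intro w hw
    refine (Complex.hasSum_taylorSeries_on_ball (c := 0) hg hw).congr_fun fun k => ?_
    simp only [sub_zero, smul_eq_mul]
    ring

variable {n : ℕ}

/-- A geometric majorant. The constant is kept linear in `M`, because `exists_norm_taylor_cons_le`
applies it with `M * R⁻¹ ^ k` and needs the decay in `k`. -/
theorem absNorm_le_of_coeff_le {X : MvPowerSeries (Fin n) ℂ} {R M : ℝ} (hR : 0 < R)
    (hX : ∀ α, ‖MvPowerSeries.coeff α X‖ ≤ M * ∏ i, R⁻¹ ^ α i) (r : Fin n → ℝ≥0) :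
    absNorm r X ≤ ENNReal.ofReal M * ∑' α, radius (fun i => r i / R.toNNReal) α := by
  rw [← ENNReal.tsum_mul_left]
  refine ENNReal.tsum_le_tsum fun α => ?_
  have h2 : radius (fun i => r i / R.toNNReal) α =
      radius (fun _ => R.toNNReal⁻¹) α * radius r α := by
    simp only [radius, ← Finset.prod_mul_distrib, div_eq_inv_mul, ENNReal.coe_mul, mul_pow]
  rw [h2, ← mul_assoc]
  gcongr
  have h3 : radius (fun _ => R.toNNReal⁻¹) α = ENNReal.ofReal (∏ i, R⁻¹ ^ α i) := by
    rw [radius, ENNReal.ofReal_prod_of_nonneg fun i _ => by positivity]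
    refine Finset.prod_congr rfl fun i _ => ?_
    rw [ENNReal.ofReal_pow (by positivity), ENNReal.ofReal, Real.toNNReal_inv]
  rw [h3, ← ENNReal.ofReal_mul' (Finset.prod_nonneg fun i _ => by positivity), ← ofReal_norm]
  exact ENNReal.ofReal_le_ofReal (hX α)

theorem tsum_radius_div_ne_top {R : ℝ} (hR : 0 < R) {r : Fin n → ℝ≥0}
    (hr : ∀ i, (r i : ℝ) < R) : ∑' α, radius (fun i => r i / R.toNNReal) α ≠ ∞ := by
  refine tsum_radius_ne_top fun i => ?_
  rw [div_lt_one (Real.toNNReal_pos.2 hR), ← NNReal.coe_lt_coe, Real.coe_toNNReal _ hR.le]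
  exact hr i

theorem absNorm_ne_top_of_coeff_le {X : MvPowerSeries (Fin n) ℂ} {R M : ℝ} (hR : 0 < R)
    (hX : ∀ α, ‖MvPowerSeries.coeff α X‖ ≤ M * ∏ i, R⁻¹ ^ α i) {r : Fin n → ℝ≥0}
    (hr : ∀ i, (r i : ℝ) < R) : absNorm r X ≠ ∞ :=
  ne_top_of_le_ne_top (ENNReal.mul_ne_top ENNReal.ofReal_ne_top (tsum_radius_div_ne_top hR hr))
    (absNorm_le_of_coeff_le hR hX r)

/-- The coefficients, as functions of the other variables, of the expansion of a bounded
holomorphic function in its first variable. -/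
theorem differentiableOn_iteratedDeriv_cons {R M : ℝ} (hR : 0 < R) {F : (Fin (n + 1) → ℂ) → ℂ}
    (hF : DifferentiableOn ℂ F {z | ∀ i, ‖z i‖ < R}) (hM : ∀ z, (∀ i, ‖z i‖ < R) → ‖F z‖ ≤ M)
    (k : ℕ) : DifferentiableOn ℂ
      (fun z' : Fin n → ℂ => iteratedDeriv k (fun w => F (Fin.cons w z')) 0 / k.factorial)
      {z | ∀ i, ‖z i‖ < R} := by
  have hopen : ∀ m, IsOpen {z : Fin m → ℂ | ∀ i, ‖z i‖ < R} := fun m => by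
    simp only [Set.ofPred_forall]
    exact isOpen_iInter_of_finite fun i => isOpen_lt (by fun_prop) continuous_const
  have hM0 : 0 ≤ M := (norm_nonneg _).trans (hM 0 (by simpa using hR))
  have hmem : ∀ w ∈ ball (0 : ℂ) R, ∀ z' : Fin n → ℂ, (∀ i, ‖z' i‖ < R) →
      ∀ i, ‖(Fin.cons w z' : Fin (n + 1) → ℂ) i‖ < R := by
    intro w hw z' hz' i
    refine Fin.cases ?_ (fun j => ?_) i
    · simpa using hw
    · simpa using hz' j
  have hslice : ∀ z' : Fin n → ℂ, (∀ i, ‖z' i‖ < R) →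
      DifferentiableOn ℂ (fun w => F (Fin.cons w z')) (ball 0 R) := by
    intro z' hz'
    refine hF.comp (f := fun w => (Fin.cons w z' : Fin (n + 1) → ℂ)) ?_ fun w hw => hmem w hw z' hz'
    refine differentiableOn_pi.2 fun i => ?_
    refine Fin.cases ?_ (fun j => ?_) i
    · simp only [Fin.cons_zero]; fun_prop
    · simp
  have hslice' : ∀ w ∈ ball (0 : ℂ) R, DifferentiableOn ℂ
      (fun z' : Fin n → ℂ => F (Fin.cons w z')) {z | ∀ i, ‖z i‖ < R} := by
    intro w hw
    refine hF.comp (f := fun z' => (Fin.cons w z' : Fin (n + 1) → ℂ)) ?_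
      fun z' hz' => hmem w hw z' hz'
    refine differentiableOn_pi.2 fun i => ?_
    refine Fin.cases ?_ (fun j => ?_) i
    · simp
    · simp only [Fin.cons_succ]; fun_prop
  set a : ℕ → (Fin n → ℂ) → ℂ := fun k z' =>
    iteratedDeriv k (fun w => F (Fin.cons w z')) 0 / k.factorial with ha
  have htay : ∀ z' : Fin n → ℂ, (∀ i, ‖z' i‖ < R) → (∀ k, ‖a k z'‖ ≤ M * R⁻¹ ^ k) ∧
      ∀ w ∈ ball (0 : ℂ) R, HasSum (fun k => a k z' * w ^ k) (F (Fin.cons w z')) := fun z' hz' =>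
    taylor_of_bounded hR (hslice z' hz') fun w hw => hM _ (hmem w hw z' hz')
  change DifferentiableOn ℂ (a k) _
  induction k using Nat.strong_induction_on with
  | _ k ih =>
  -- points `h m → 0` in the punctured disc
  set h : ℕ → ℂ := fun m => ((R / (m + 2) : ℝ) : ℂ) with hh
  have hpos : ∀ m : ℕ, 0 < R / (m + 2) := fun m => by positivity
  have hnorm : ∀ m, ‖h m‖ = R / (m + 2) := fun m => by
    rw [hh, Complex.norm_real, Real.norm_of_nonneg (hpos m).le]
  have hhalf : ∀ m, ‖h m‖ ≤ R / 2 := fun m => by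
    rw [hnorm]; gcongr; linarith [Nat.cast_nonneg (α := ℝ) m]
  have hball : ∀ m, h m ∈ ball (0 : ℂ) R := fun m => by
    rw [mem_ball_zero_iff]; linarith [hhalf m]
  have hne : ∀ m, h m ≠ 0 := fun m => by
    rw [← norm_pos_iff, hnorm]; exact hpos m
  have hto : Tendsto (fun m => ‖h m‖) atTop (𝓝 0) := by
    simp only [hnorm]
    exact tendsto_const_nhds.div_atTop
      (tendsto_atTop_add_const_right _ _ tendsto_natCast_atTop_atTop)
  -- `a k` is the limit of these difference quotients, which are holomorphic in `z'` by induction on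
  -- `k`. The tail of the Taylor series makes the error `O(‖h m‖)` uniformly in `z'`; the bound `‖h
  -- m‖ ≤ R / 2` makes that tail geometric with ratio at most `1 / 2`.
  refine differentiableOn_of_tendstoUniformlyOn_nhds (l := atTop)
    (f := fun (m : ℕ) z' => (F (Fin.cons (h m) z') - ∑ j ∈ Finset.range k, a j z' * h m ^ j) / h m ^ k)
    (hopen n) (fun m => ?_) (fun x hx => ⟨_, (hopen n).mem_nhds hx, ?_⟩)
  · simp only [div_eq_mul_inv]
    refine DifferentiableOn.mul_const ((hslice' _ (hball m)).fun_sub ?_) _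
    exact DifferentiableOn.fun_sum fun j hj => (ih j (Finset.mem_range.1 hj)).mul_const _
  · have key : ∀ m, ∀ z' : Fin n → ℂ, (∀ i, ‖z' i‖ < R) →
        ‖(F (Fin.cons (h m) z') - ∑ j ∈ Finset.range k, a j z' * h m ^ j) / h m ^ k - a k z'‖ ≤
          ‖h m‖ * (2 * M * R⁻¹ ^ (k + 1)) := by
      intro m z' hz'
      obtain ⟨hb, hs⟩ := htay z' hz'
      have hs' := (hasSum_nat_add_iff' (k + 1)).2 (hs _ (hball m))
      rw [Finset.sum_range_succ, ← sub_sub] at hs'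
      have h1 : (F (Fin.cons (h m) z') - ∑ j ∈ Finset.range k, a j z' * h m ^ j) / h m ^ k - a k z'
          = (F (Fin.cons (h m) z') - ∑ j ∈ Finset.range k, a j z' * h m ^ j - a k z' * h m ^ k) /
            h m ^ k := by
        have := pow_ne_zero k (hne m)
        field_simp
      have h2 : ∀ j, ‖a (j + (k + 1)) z' * h m ^ (j + (k + 1))‖ ≤
          (M * R⁻¹ ^ (k + 1) * ‖h m‖ ^ (k + 1)) * (1 / 2) ^ j := by
        intro j
        rw [norm_mul, norm_pow]
        calc ‖a (j + (k + 1)) z'‖ * ‖h m‖ ^ (j + (k + 1))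
            ≤ (M * R⁻¹ ^ (j + (k + 1))) * ‖h m‖ ^ (j + (k + 1)) := by gcongr; exact hb _
          _ = (M * R⁻¹ ^ (k + 1) * ‖h m‖ ^ (k + 1)) * (R⁻¹ * ‖h m‖) ^ j := by
            rw [pow_add, pow_add, mul_pow]; ring
          _ ≤ _ := by
            gcongr
            rw [inv_mul_le_iff₀ hR]; linarith [hhalf m]
      have h3 : HasSum (fun j : ℕ => (M * R⁻¹ ^ (k + 1) * ‖h m‖ ^ (k + 1)) * (1 / 2 : ℝ) ^ j)
          ((M * R⁻¹ ^ (k + 1) * ‖h m‖ ^ (k + 1)) * 2) := hasSum_geometric_two.mul_left _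
      have h4 := hs'.tsum_eq ▸ tsum_of_norm_bounded h3 h2
      rw [h1, norm_div, norm_pow, div_le_iff₀ (pow_pos (norm_pos_iff.2 (hne m)) k)]
      refine h4.trans (le_of_eq ?_)
      ring
    refine Metric.tendstoUniformlyOn_iff.2 fun ε hε => ?_
    have h5 : Tendsto (fun m => ‖h m‖ * (2 * M * R⁻¹ ^ (k + 1))) atTop (𝓝 0) := by
      simpa using hto.mul_const (2 * M * R⁻¹ ^ (k + 1))
    filter_upwards [h5.eventually_lt_const hε] with m hm z' hz'
    rw [dist_comm, dist_eq_norm]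
    exact (key m z' hz').trans_lt hm

theorem taylor_cons {R M : ℝ} (hR : 0 < R) {F : (Fin (n + 1) → ℂ) → ℂ}
    (hF : DifferentiableOn ℂ F {z | ∀ i, ‖z i‖ < R}) (hM : ∀ z, (∀ i, ‖z i‖ < R) → ‖F z‖ ≤ M)
    {z' : Fin n → ℂ} (hz' : ∀ i, ‖z' i‖ < R) :
    (∀ k, ‖iteratedDeriv k (fun w => F (Fin.cons w z')) 0 / k.factorial‖ ≤ M * R⁻¹ ^ k) ∧
      ∀ w ∈ ball (0 : ℂ) R, HasSum (fun k =>
        iteratedDeriv k (fun w => F (Fin.cons w z')) 0 / k.factorial * w ^ k)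
        (F (Fin.cons w z')) := by
  refine taylor_of_bounded hR (g := fun w => F (Fin.cons w z')) ?_ fun w hw => hM _ fun i => ?_
  · refine hF.comp (f := fun w => (Fin.cons w z' : Fin (n + 1) → ℂ)) ?_ fun w hw i => ?_
    · refine differentiableOn_pi.2 fun i => ?_
      refine Fin.cases ?_ (fun j => ?_) i
      · simp only [Fin.cons_zero]; fun_prop
      · simp
    · refine Fin.cases ?_ (fun j => ?_) i
      · simpa using hw
      · simpa using hz' j
  · refine Fin.cases ?_ (fun j => ?_) i
    · simpa using hw
    · simpa using hz' j

/-- A bounded holomorphic function on a polydisk is the sum of a power series, and the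
coefficients satisfy the Cauchy estimates. -/
theorem exists_powerSeries_of_bounded {R M : ℝ} (hR : 0 < R) {F : (Fin n → ℂ) → ℂ}
    (hF : DifferentiableOn ℂ F {z | ∀ i, ‖z i‖ < R}) (hM : ∀ z, (∀ i, ‖z i‖ < R) → ‖F z‖ ≤ M) :
    ∃ X : MvPowerSeries (Fin n) ℂ, (∀ α, ‖MvPowerSeries.coeff α X‖ ≤ M * ∏ i, R⁻¹ ^ α i) ∧
      ∀ z, (∀ i, ‖z i‖ < R) → ev X z = F z := by
  induction n generalizing M with
  | zero =>
    refine ⟨MvPowerSeries.C (F 0), fun α => ?_, fun z _ => ?_⟩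
    · rw [Subsingleton.elim α 0]
      simpa using hM 0 (fun i => i.elim0)
    · rw [ev, tsum_eq_single 0 (fun α hα => (hα (Subsingleton.elim _ _)).elim)]
      simp [Subsingleton.elim z 0]
  | succ n ih =>
    -- The `k`-th coefficient in the first variable is expanded in the others. Its bound is `M * R⁻¹
    -- ^ k`, which is why the induction generalizes `M`.
    choose! X hX hX' using fun k : ℕ => ih
      (differentiableOn_iteratedDeriv_cons hR hF hM k) (fun z' hz' => (taylor_cons hR hF hM hz').1 k)
    let Y : MvPowerSeries (Fin (n + 1)) ℂ := fun α => MvPowerSeries.coeff α.tail (X (α 0))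
    have hYc : ∀ α, MvPowerSeries.coeff α Y = MvPowerSeries.coeff α.tail (X (α 0)) := fun α => rfl
    have hY : ∀ α, ‖MvPowerSeries.coeff α Y‖ ≤ M * ∏ i, R⁻¹ ^ α i := by
      intro α
      rw [hYc, Fin.prod_univ_succ, ← mul_assoc]
      exact hX (α 0) α.tail
    refine ⟨Y, hY, fun z hz => ?_⟩
    have hs := hasSum_ev (absNorm_ne_top_of_coeff_le hR hY (r := fun i => ‖z i‖₊) hz)
    let e : ℕ × (Fin n →₀ ℕ) ≃ (Fin (n + 1) →₀ ℕ) :=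
      { toFun := fun p => Finsupp.cons p.1 p.2
        invFun := fun α => (α 0, α.tail)
        left_inv := fun p => by simp
        right_inv := fun α => by simp }
    have hs2 := e.hasSum_iff.2 hs
    have hz' : ∀ i, ‖Fin.tail z i‖ < R := fun i => hz i.succ
    have hfib : ∀ k : ℕ, HasSum (fun α : Fin n →₀ ℕ =>
        ((fun α => MvPowerSeries.coeff α Y * ∏ i, z i ^ α i) ∘ e) (k, α))
        (iteratedDeriv k (fun w => F (Fin.cons w (Fin.tail z))) 0 / k.factorial * z 0 ^ k) := by
      intro k
      rw [← hX' k _ hz']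
      refine ((hasSum_ev (absNorm_ne_top_of_coeff_le hR (hX k)
        (r := fun i => ‖Fin.tail z i‖₊) hz')).mul_right (z 0 ^ k)).congr_fun fun α => ?_
      simp only [Function.comp, e, Equiv.coe_fn_mk, hYc, Finsupp.tail_cons, Finsupp.cons_zero,
        Fin.prod_univ_succ, Finsupp.cons_succ, Fin.tail]
      ring
    have h1 := hs2.prod_fiberwise hfib
    have h2 := (taylor_cons hR hF hM hz').2 (z 0) (by simpa using hz 0)
    simp only [Fin.cons_self_tail] at h2
    exact h1.unique h2

theorem isOpen_polydisk (n : ℕ) : IsOpen (polydisk n) := by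
  simp only [polydisk, Set.ofPred_forall]
  exact isOpen_iInter_of_finite fun i => isOpen_lt (by fun_prop) continuous_const

theorem convex_polydisk (n : ℕ) : Convex ℝ (polydisk n) := by
  have : polydisk n = ⋂ i, (fun z : Fin n → ℂ => z i) ⁻¹' ball 0 1 := by
    ext z; simp [polydisk]
  rw [this]
  exact convex_iInter fun i =>
    (convex_ball (0 : ℂ) 1).linear_preimage (LinearMap.proj (R := ℝ) (φ := fun _ : Fin n => ℂ) i)

theorem differentiable_monomial (α : Fin n →₀ ℕ) :
    Differentiable ℂ fun z : Fin n → ℂ => ∏ i, z i ^ α i := fun z => by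
  classical
  exact (HasFDerivAt.finsetProd (u := Finset.univ) (g := fun i (z : Fin n → ℂ) => z i ^ α i)
    fun i _ => DifferentiableAt.hasFDerivAt (by fun_prop)).differentiableAt

/-- The sum of a power series that converges on the polydisk is holomorphic there. -/
theorem differentiableOn_ev {X : MvPowerSeries (Fin n) ℂ}
    (hX : ∀ r : ℝ≥0, r < 1 → absNorm (fun _ => r) X ≠ ∞) :
    DifferentiableOn ℂ (ev X) (polydisk n) := by
  refine differentiableOn_of_tendstoUniformlyOn_nhds (l := atTop)
    (f := fun (s : Finset (Fin n →₀ ℕ)) z => ∑ α ∈ s, MvPowerSeries.coeff α X * ∏ i, z i ^ α i)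
    (isOpen_polydisk n) (fun s => ?_) (fun x hx => ?_)
  · exact DifferentiableOn.fun_sum fun α _ => ((differentiable_monomial α).const_mul _).differentiableOn
  · obtain ⟨r, hr1, hr⟩ : ∃ r : ℝ≥0, r < 1 ∧ ∀ i, ‖x i‖₊ < r := by
      obtain ⟨r, hr, hr'⟩ := exists_between (a₁ := Finset.univ.sup fun i => ‖x i‖₊) (a₂ := (1 : ℝ≥0))
        ((Finset.sup_lt_iff (by simp)).2 fun i _ => hx i)
      exact ⟨r, hr', fun i => (Finset.le_sup (f := fun i => ‖x i‖₊) (Finset.mem_univ i)).trans_lt hr⟩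
    refine ⟨{z | ∀ i, ‖z i‖ < r}, ?_, ?_⟩
    · refine IsOpen.mem_nhds ?_ hr
      simp only [Set.ofPred_forall]
      exact isOpen_iInter_of_finite fun i => isOpen_lt (by fun_prop) continuous_const
    · have h1 := summable_of_absNorm_ne_top (X := X) (z := fun _ => ((r : ℝ) : ℂ))
        (by simpa using hX r hr1)
      refine tendstoUniformlyOn_tsum h1 fun α z hz => ?_
      rw [norm_mul, norm_mul, norm_prod, norm_prod]
      gcongr with i
      rw [norm_pow, norm_pow]
      gcongr
      simpa using (hz i).le

end

/-! ### Parseval's identity on polycircles; uniqueness and existence of the representing series -/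

section

variable {n : ℕ}

/-- The point with coordinates `tᵢ e^{2πi θᵢ}`. -/
noncomputable def torusPoint (t : Fin n → ℝ≥0) (θ : UnitAddTorus (Fin n)) : Fin n → ℂ :=
  fun i => ((t i : ℝ) : ℂ) * fourier 1 (θ i)

theorem continuous_torusPoint (t : Fin n → ℝ≥0) : Continuous (torusPoint t) := by
  unfold torusPoint; fun_prop

theorem norm_fourier_apply (k : ℤ) (s : UnitAddCircle) : ‖(fourier k s : ℂ)‖ = 1 := by
  rw [fourier_apply]; exact Circle.norm_coe _

theorem nnnorm_torusPoint (t : Fin n → ℝ≥0) (θ : UnitAddTorus (Fin n)) (i : Fin n) :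
    ‖torusPoint t θ i‖₊ = t i := by
  ext
  rw [coe_nnnorm, torusPoint, norm_mul, norm_fourier_apply]
  simp

theorem monomial_torusPoint (t : Fin n → ℝ≥0) (θ : UnitAddTorus (Fin n)) (α : Fin n →₀ ℕ) :
    ∏ i, torusPoint t θ i ^ α i =
      (((radius t α).toReal : ℝ) : ℂ) * UnitAddTorus.mFourier (fun i => (α i : ℤ)) θ := by
  simp only [torusPoint, mul_pow, Finset.prod_mul_distrib, radius, ENNReal.toReal_prod,
    ENNReal.toReal_pow, ENNReal.coe_toReal, UnitAddTorus.mFourier, ContinuousMap.coe_mk]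
  congr 1
  · push_cast; rfl
  · refine Finset.prod_congr rfl fun i _ => ?_
    simp only [fourier_apply, ← Circle.coe_pow, ← AddCircle.toCircle_nsmul]
    simp

/-- The normalized Haar measure of the torus. -/
noncomputable def torusMeasure (n : ℕ) : Measure (UnitAddTorus (Fin n)) :=
  Measure.pi fun _ => AddCircle.haarAddCircle

instance (n : ℕ) : IsProbabilityMeasure (torusMeasure n) := by
  unfold torusMeasure; infer_instance

theorem orthonormal_mFourier (n : ℕ) : Orthonormal ℂ fun k : Fin n → ℤ =>
    ContinuousMap.toLp (E := ℂ) 2 (torusMeasure n) ℂ (UnitAddTorus.mFourier k) :=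
  UnitAddTorus.orthonormal_mFourier

/-- **Parseval's identity** for power series on a polycircle. -/
theorem lintegral_enorm_ev_sq {X : MvPowerSeries (Fin n) ℂ} {t : Fin n → ℝ≥0}
    (hX : absNorm t X ≠ ∞) :
    ∫⁻ θ, ‖ev X (torusPoint t θ)‖ₑ ^ 2 ∂torusMeasure n =
      ∑' α, (‖MvPowerSeries.coeff α X‖ₑ * radius t α) ^ 2 := by
  set a : (Fin n →₀ ℕ) → ℂ := fun α =>
    MvPowerSeries.coeff α X * (((radius t α).toReal : ℝ) : ℂ) with ha
  have hae : ∀ α, ‖a α‖ₑ = ‖MvPowerSeries.coeff α X‖ₑ * radius t α := by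
    intro α
    rw [ha, enorm_mul, ← ofReal_norm (((radius t α).toReal : ℝ) : ℂ), Complex.norm_real,
      Real.norm_of_nonneg ENNReal.toReal_nonneg, ENNReal.ofReal_toReal (radius_ne_top _ _)]
  have hasum : Summable fun α => ‖a α‖ := by
    have h1 : ∑' α, ‖a α‖ₑ ≠ ∞ := by simpa only [hae, absNorm] using hX
    simp only [enorm_eq_nnnorm] at h1
    exact NNReal.summable_coe.2 (ENNReal.tsum_coe_ne_top_iff_summable.1 h1)
  let u : (Fin n →₀ ℕ) → C(UnitAddTorus (Fin n), ℂ) := fun α =>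
    UnitAddTorus.mFourier (fun i => (α i : ℤ))
  have hcs : Summable fun α => a α • u α := by
    refine Summable.of_norm ?_
    simpa only [norm_smul, u, UnitAddTorus.mFourier_norm, mul_one] using hasum
  obtain ⟨f, hf⟩ := hcs
  have hfe : ∀ θ, f θ = ev X (torusPoint t θ) := by
    intro θ
    have h1 := (ContinuousMap.evalCLM ℂ θ).hasSum hf
    have h2 := hasSum_ev (X := X) (z := torusPoint t θ) (by simpa only [nnnorm_torusPoint] using hX)
    refine h1.unique (h2.congr_fun fun α => ?_)
    rw [monomial_torusPoint]
    simp only [map_smul, ContinuousMap.evalCLM_apply, smul_eq_mul, u, ha]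
    ring
  let T := ContinuousMap.toLp (E := ℂ) 2 (torusMeasure n) ℂ
  have hL := T.hasSum hf
  have hu : Orthonormal ℂ fun α => T (u α) := by
    refine (orthonormal_mFourier n).comp (fun (α : Fin n →₀ ℕ) i => (α i : ℤ))
      fun α β h => ?_
    ext i
    simpa using congrFun h i
  have hcoef : ∀ α, inner ℂ (T (u α)) (T f) = a α := by
    intro α
    have h1 := (innerSL ℂ (T (u α))).hasSum hL
    have h2 : HasSum (fun β => if β = α then a α else 0) (a α) := hasSum_ite_eq α (a α)
    refine h1.unique (h2.congr_fun fun β => ?_)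
    simp only [map_smul, innerSL_apply_apply, smul_eq_mul]
    rw [orthonormal_iff_ite.1 hu]
    by_cases h : β = α
    · rw [if_pos h, if_pos h.symm, mul_one, h]
    · rw [if_neg h, if_neg (Ne.symm h), mul_zero]
  -- No completeness of the exponentials is needed: the series for `T f` is paired with `T f`
  -- itself, and `hcoef` turns each term into `‖a α‖ ^ 2`.
  have hnorm : HasSum (fun α => ‖a α‖ ^ 2) (‖T f‖ ^ 2) := by
    have h1 := (innerSL ℂ (T f)).hasSum hL
    have h2 := Complex.hasSum_re h1
    have h3 : ((innerSL ℂ (T f)) (T f)).re = ‖T f‖ ^ 2 := by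
      rw [innerSL_apply_apply, inner_self_eq_norm_sq_to_K]
      norm_cast
    rw [h3] at h2
    refine h2.congr_fun fun α => ?_
    simp only [map_smul, innerSL_apply_apply, smul_eq_mul]
    rw [← inner_conj_symm, hcoef, Complex.mul_conj, Complex.normSq_eq_norm_sq]
    norm_cast
  have hint : ∫⁻ θ, ‖f θ‖ₑ ^ 2 ∂torusMeasure n = ENNReal.ofReal (‖T f‖ ^ 2) := by
    have h1 : eLpNorm f 2 (torusMeasure n) = ‖T f‖ₑ := by
      rw [Lp.enorm_def]
      exact (eLpNorm_congr_ae (ContinuousMap.coeFn_toLp _ f)).symm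
    have h2 := eLpNorm_nnreal_pow_eq_lintegral (f := f) (μ := torusMeasure n) (p := 2) two_ne_zero
    have h3 : ((2 : ℝ≥0) : ℝ≥0∞) = 2 := rfl
    rw [h3, h1] at h2
    rw [ENNReal.ofReal_pow (norm_nonneg _), ofReal_norm]
    simpa using h2.symm
  simp only [← hfe]
  rw [hint, ← hnorm.tsum_eq, ENNReal.ofReal_tsum_of_nonneg (fun α => sq_nonneg _) hnorm.summable]
  refine tsum_congr fun α => ?_
  rw [← hae, ENNReal.ofReal_pow (norm_nonneg _), ofReal_norm]

/-- By Parseval, the sum of the squared moduli of the weighted coefficients over a single polycircle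
is zero, and positive radii do not hide any coefficient. -/
theorem coeff_eq_zero_of_ev_eq_zero {X : MvPowerSeries (Fin n) ℂ} {r : ℝ≥0} (hr : 0 < r)
    (hX : absNorm (fun _ => r) X ≠ ∞) (h : ∀ z : Fin n → ℂ, (∀ i, ‖z i‖₊ = r) → ev X z = 0) :
    X = 0 := by
  have h1 := lintegral_enorm_ev_sq hX
  have h2 : ∀ θ, ev X (torusPoint (fun _ => r) θ) = 0 := fun θ =>
    h _ fun i => nnnorm_torusPoint _ θ i
  simp only [h2, enorm_zero, ne_eq, OfNat.ofNat_ne_zero, not_false_eq_true, zero_pow,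
    lintegral_zero] at h1
  ext α
  have h3 := ENNReal.tsum_eq_zero.1 h1.symm α
  rw [sq_eq_zero_iff, mul_eq_zero, or_iff_left (radius_ne_zero (fun _ => hr) α)] at h3
  simpa using h3

theorem absNorm_sub_ne_top {r : Fin n → ℝ≥0} {X Y : MvPowerSeries (Fin n) ℂ}
    (hX : absNorm r X ≠ ∞) (hY : absNorm r Y ≠ ∞) : absNorm r (X - Y) ≠ ∞ := by
  rw [sub_eq_add_neg]
  refine ne_top_of_le_ne_top ?_ (absNorm_add_le _ _ _)
  rw [absNorm_neg]
  exact ENNReal.add_ne_top.2 ⟨hX, hY⟩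

theorem ev_sub {X Y : MvPowerSeries (Fin n) ℂ} {z : Fin n → ℂ}
    (hX : absNorm (fun i => ‖z i‖₊) X ≠ ∞) (hY : absNorm (fun i => ‖z i‖₊) Y ≠ ∞) :
    ev (X - Y) z = ev X z - ev Y z := by
  rw [ev, ← ((hasSum_ev hX).sub (hasSum_ev hY)).tsum_eq]
  exact tsum_congr fun α => by rw [map_sub, sub_mul]

theorem eq_of_ev_eq {X Y : MvPowerSeries (Fin n) ℂ} {r : ℝ≥0} (hr : 0 < r)
    (hX : absNorm (fun _ => r) X ≠ ∞) (hY : absNorm (fun _ => r) Y ≠ ∞)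
    (h : ∀ z : Fin n → ℂ, (∀ i, ‖z i‖₊ = r) → ev X z = ev Y z) : X = Y := by
  rw [← sub_eq_zero]
  refine coeff_eq_zero_of_ev_eq_zero hr (absNorm_sub_ne_top hX hY) fun z hz => ?_
  have hz' : (fun i => ‖z i‖₊) = fun _ => r := funext hz
  rw [ev_sub (by rwa [hz']) (by rwa [hz']), h z hz, sub_self]

theorem Represents.absNorm_ne_top {X : MvPowerSeries (Fin n) ℂ} {g : (Fin n → ℂ) → ℂ}
    (h : Represents X g) {r : Fin n → ℝ≥0} (hr : ∀ i, r i < 1) : absNorm r X ≠ ∞ := by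
  have := absNorm_ne_top_of_summable (h (fun i => ((r i : ℝ) : ℂ)) fun i => by
    simpa using hr i).summable
  simpa using this

theorem Represents.ev_eq {X : MvPowerSeries (Fin n) ℂ} {g : (Fin n → ℂ) → ℂ}
    (h : Represents X g) {z : Fin n → ℂ} (hz : z ∈ polydisk n) : ev X z = g z :=
  (h z hz).tsum_eq

theorem represents_iff {X : MvPowerSeries (Fin n) ℂ} {g : (Fin n → ℂ) → ℂ} :
    Represents X g ↔ (∀ r : Fin n → ℝ≥0, (∀ i, r i < 1) → absNorm r X ≠ ∞) ∧
      ∀ z ∈ polydisk n, ev X z = g z := by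
  refine ⟨fun h => ⟨fun r hr => h.absNorm_ne_top hr, fun z hz => h.ev_eq hz⟩, fun h z hz => ?_⟩
  rw [← h.2 z hz]
  exact hasSum_ev (h.1 _ hz)

theorem Represents.eq {X Y : MvPowerSeries (Fin n) ℂ} {g : (Fin n → ℂ) → ℂ}
    (hX : Represents X g) (hY : Represents Y g) : X = Y := by
  have hr : (1 / 2 : ℝ≥0) < 1 := by rw [← NNReal.coe_lt_coe]; norm_num
  refine eq_of_ev_eq (r := 1 / 2) (by simp) (hX.absNorm_ne_top fun _ => hr)
    (hY.absNorm_ne_top fun _ => hr) fun z hz => ?_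
  have hz' : z ∈ polydisk n := fun i => by
    rw [← coe_nnnorm, hz i]; exact_mod_cast hr
  rw [hX.ev_eq hz', hY.ev_eq hz']

theorem Represents.mul {X Y : MvPowerSeries (Fin n) ℂ} {f g : (Fin n → ℂ) → ℂ}
    (hX : Represents X f) (hY : Represents Y g) : Represents (X * Y) fun z => f z * g z := by
  refine represents_iff.2 ⟨fun r hr => ?_, fun z hz => ?_⟩
  · exact ne_top_of_le_ne_top (ENNReal.mul_ne_top (hX.absNorm_ne_top hr) (hY.absNorm_ne_top hr))
      (absNorm_mul_le _ _ _)
  · rw [ev_mul (hX.absNorm_ne_top hz) (hY.absNorm_ne_top hz), hX.ev_eq hz, hY.ev_eq hz]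

theorem Represents.differentiableOn {X : MvPowerSeries (Fin n) ℂ} {g : (Fin n → ℂ) → ℂ}
    (h : Represents X g) : DifferentiableOn ℂ g (polydisk n) :=
  (differentiableOn_ev fun _ hr => h.absNorm_ne_top fun _ => hr).congr fun _ hz => (h.ev_eq hz).symm

theorem exists_le_norm_of_mem_polydisk {z : Fin n → ℂ} (hz : z ∈ polydisk n) :
    ∃ r : ℝ≥0, 0 < r ∧ r < 1 ∧ ∀ i, ‖z i‖₊ < r := by
  obtain ⟨r, hr, hr'⟩ := exists_between (a₁ := Finset.univ.sup fun i => ‖z i‖₊) (a₂ := (1 : ℝ≥0))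
    ((Finset.sup_lt_iff (by simp)).2 fun i _ => hz i)
  exact ⟨r, zero_le.trans_lt hr, hr', fun i =>
    (Finset.le_sup (f := fun i => ‖z i‖₊) (Finset.mem_univ i)).trans_lt hr⟩

theorem exists_powerSeries_of_differentiableOn {R : ℝ} (hR : 0 < R) {F : (Fin n → ℂ) → ℂ}
    {U : Set (Fin n → ℂ)} (hU : {z | ∀ i, ‖z i‖ ≤ R} ⊆ U) (hF : DifferentiableOn ℂ F U) :
    ∃ (X : MvPowerSeries (Fin n) ℂ) (M : ℝ),
      (∀ α, ‖MvPowerSeries.coeff α X‖ ≤ M * ∏ i, R⁻¹ ^ α i) ∧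
      ∀ z, (∀ i, ‖z i‖ < R) → ev X z = F z := by
  have hc : IsCompact {z : Fin n → ℂ | ∀ i, ‖z i‖ ≤ R} := by
    have : {z : Fin n → ℂ | ∀ i, ‖z i‖ ≤ R} = Set.univ.pi fun _ => closedBall 0 R := by
      ext z; simp
    rw [this]
    exact isCompact_univ_pi fun _ => isCompact_closedBall _ _
  obtain ⟨M, hM⟩ := hc.exists_bound_of_continuousOn (hF.mono hU).continuousOn
  obtain ⟨X, h1, h2⟩ := exists_powerSeries_of_bounded (M := M) hR
    (hF.mono fun z hz => hU fun i => (hz i).le) (fun z hz => hM z fun i => (hz i).le)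
  exact ⟨X, M, h1, h2⟩

/-- A holomorphic function on the polydisk is represented by a power series. -/
theorem exists_represents {f : (Fin n → ℂ) → ℂ} (hf : DifferentiableOn ℂ f (polydisk n)) :
    ∃ X : MvPowerSeries (Fin n) ℂ, Represents X f := by
  have h : ∀ R : ℝ≥0, 0 < R → R < 1 → ∃ (X : MvPowerSeries (Fin n) ℂ) (M : ℝ),
      (∀ α, ‖MvPowerSeries.coeff α X‖ ≤ M * ∏ i, (R : ℝ)⁻¹ ^ α i) ∧
      ∀ z, (∀ i, ‖z i‖ < R) → ev X z = f z := fun R h0 h1 =>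
    exists_powerSeries_of_differentiableOn (U := polydisk n) (by exact_mod_cast h0)
      (fun z hz i => (hz i).trans_lt (by exact_mod_cast h1)) hf
  choose! X M hX hX' using h
  have hhalf : (1 / 2 : ℝ≥0) < 1 := by rw [← NNReal.coe_lt_coe]; norm_num
  -- The expansions obtained at different radii agree on a polycircle of radius smaller than both,
  -- so one series serves the whole open polydisk.
  have heq : ∀ R : ℝ≥0, 0 < R → R < 1 → X R = X (1 / 2) := by
    intro R h0 h1
    obtain ⟨ρ, hρ0, hρ⟩ := exists_between (lt_min h0 (show (0 : ℝ≥0) < 1 / 2 by simp))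
    have hρ1 := hρ.trans_le (min_le_left _ _)
    have hρ2 := hρ.trans_le (min_le_right _ _)
    refine eq_of_ev_eq (r := ρ) hρ0
      (absNorm_ne_top_of_coeff_le (by exact_mod_cast h0) (hX R h0 h1) fun _ => by
        exact_mod_cast hρ1)
      (absNorm_ne_top_of_coeff_le (by norm_num) (hX (1 / 2) (by simp) hhalf) fun _ => by
        exact_mod_cast hρ2) fun z hz => ?_
    rw [hX' R h0 h1 z fun i => ?_, hX' (1 / 2) (by simp) hhalf z fun i => ?_]
    · rw [← coe_nnnorm, hz i]; exact_mod_cast hρ2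
    · rw [← coe_nnnorm, hz i]; exact_mod_cast hρ1
  refine ⟨X (1 / 2), fun z hz => ?_⟩
  obtain ⟨r, hr0, hr1, hr⟩ := exists_le_norm_of_mem_polydisk hz
  rw [← heq r hr0 hr1, ← hX' r hr0 hr1 z hr]
  exact hasSum_ev (absNorm_ne_top_of_coeff_le (by exact_mod_cast hr0) (hX r hr0 hr1) hr)

end

/-! ### A monomial order realized by radii, and leading exponents of ideals -/

section

open MvPowerSeries

variable {n : ℕ}

/-- The natural number `∏ pᵢ^{αᵢ}`, where `p₀, p₁, …` are the primes. It orders the exponents. -/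
noncomputable def primeCode (α : Fin n →₀ ℕ) : ℕ := ∏ i : Fin n, Nat.nth Nat.Prime i ^ α i

theorem primeCode_pos (α : Fin n →₀ ℕ) : 0 < primeCode α :=
  Finset.prod_pos fun i _ => pow_pos (Nat.prime_nth_prime i).pos _

theorem primeCode_add (α β : Fin n →₀ ℕ) : primeCode (α + β) = primeCode α * primeCode β := by
  simp [primeCode, pow_add, Finset.prod_mul_distrib]

/-- Unique factorization. Together with `primeCode_add` this makes the comparison of codes a
monomial order, and one for which only finitely many exponents lie below a given one. -/
theorem primeCode_injective : Function.Injective (primeCode (n := n)) := by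
  have key : ∀ (α : Fin n →₀ ℕ) (j : Fin n),
      (primeCode α).factorization (Nat.nth Nat.Prime j) = α j := by
    intro α j
    have h0 : ∀ i ∈ (Finset.univ : Finset (Fin n)), Nat.nth Nat.Prime i ^ α i ≠ 0 := fun i _ =>
      pow_ne_zero _ (Nat.prime_nth_prime i).ne_zero
    rw [primeCode, Nat.factorization_prod h0, Finset.sum_apply', Finset.sum_eq_single j]
    · simp [Nat.Prime.factorization_pow (Nat.prime_nth_prime j)]
    · intro i _ hij
      rw [Nat.Prime.factorization_pow (Nat.prime_nth_prime i), Finsupp.single_apply, if_neg]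
      intro h
      exact hij (Fin.ext (Nat.nth_injective Nat.infinite_setOfPred_prime h))
    · simp
  intro α β h
  ext j
  rw [← key α j, ← key β j, h]

/-- The radii `pᵢ^{-T}`, for which `r^α = (primeCode α)^{-T}`. -/
noncomputable def primeRadius (n T : ℕ) (i : Fin n) : ℝ≥0 := ((Nat.nth Nat.Prime i : ℝ≥0)⁻¹) ^ T

theorem primeRadius_pos (T : ℕ) (i : Fin n) : 0 < primeRadius n T i :=
  pow_pos (inv_pos.2 (by exact_mod_cast (Nat.prime_nth_prime i).pos)) _

theorem primeRadius_anti {S T : ℕ} (h : S ≤ T) (i : Fin n) :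
    primeRadius n T i ≤ primeRadius n S i :=
  pow_le_pow_of_le_one zero_le (inv_le_one_of_one_le₀
    (by exact_mod_cast (Nat.prime_nth_prime i).one_lt.le)) h

theorem radius_primeRadius (T : ℕ) (α : Fin n →₀ ℕ) :
    radius (primeRadius n T) α = (((primeCode α : ℝ≥0)⁻¹ ^ T : ℝ≥0) : ℝ≥0∞) := by
  have h : radius (primeRadius n T) α = ((∏ i, primeRadius n T i ^ α i : ℝ≥0) : ℝ≥0∞) := by
    simp [radius]
  rw [h, primeCode, Nat.cast_prod, ← Finset.prod_inv_distrib, ← Finset.prod_pow]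
  congr 1
  refine Finset.prod_congr rfl fun i _ => ?_
  rw [primeRadius, ← pow_mul, mul_comm, pow_mul, inv_pow, Nat.cast_pow]

/-- `σ` is the least exponent of `X` for the order of `primeCode`, with coefficient `1`. -/
def Leads (X : MvPowerSeries (Fin n) ℂ) (σ : Fin n →₀ ℕ) : Prop :=
  coeff σ X = 1 ∧ ∀ β, primeCode β < primeCode σ → coeff β X = 0

/-- The least exponent of `X`, after division by its coefficient. That `σ` occurs in `X` itself is
recorded because it later contradicts a remainder with no coefficients at leading exponents. -/
theorem exists_leads {I : Ideal (MvPowerSeries (Fin n) ℂ)} {X : MvPowerSeries (Fin n) ℂ}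
    (hX : X ∈ I) (h0 : X ≠ 0) : ∃ σ, coeff σ X ≠ 0 ∧ ∃ Y ∈ I, Leads Y σ := by
  have hne : {α | coeff α X ≠ 0}.Nonempty := by
    by_contra h
    refine h0 (MvPowerSeries.ext fun α => ?_)
    by_contra hα
    exact h ⟨α, by simpa using hα⟩
  let σ := Function.argminOn primeCode {α | coeff α X ≠ 0} hne
  have hσ : coeff σ X ≠ 0 := Function.argminOn_mem primeCode {α | coeff α X ≠ 0} hne
  refine ⟨σ, hσ, C (coeff σ X)⁻¹ * X, I.mul_mem_left _ hX, ?_, fun β hβ => ?_⟩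
  · rw [coeff_C_mul, inv_mul_cancel₀ hσ]
  · rw [coeff_C_mul]
    by_contra h
    exact Function.not_lt_argminOn primeCode {α | coeff α X ≠ 0}
      (a := β) (by simpa using right_ne_zero_of_mul h) hβ

/-- Dickson's lemma: the minimal leading exponents form an antichain in `ℕⁿ`, hence a finite set. -/
theorem exists_finset_leads (I : Ideal (MvPowerSeries (Fin n) ℂ)) :
    ∃ S : Finset (Fin n →₀ ℕ), (∀ σ ∈ S, ∃ Y ∈ I, Leads Y σ) ∧
      ∀ α, (∃ Y ∈ I, Leads Y α) → ∃ σ ∈ S, σ ≤ α := by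
  let E : Set (Fin n →₀ ℕ) := {α | ∃ Y ∈ I, Leads Y α}
  have hfin : {α | Minimal (· ∈ E) α}.Finite :=
    WellQuasiOrderedLE.finite_of_isAntichain (setOfPred_minimal_antichain _)
  refine ⟨hfin.toFinset, fun σ hσ => ?_, fun α hα => ?_⟩
  · exact ((hfin.mem_toFinset).1 hσ).prop
  · obtain ⟨σ, h1, h2⟩ := exists_minimal_le_of_wellFoundedLT (· ∈ E) α hα
    exact ⟨σ, hfin.mem_toFinset.2 h2, h1⟩

/-- The truncation of a power series to the exponents of code at most `m`. -/
noncomputable def codeTrunc (m : ℕ) (X : MvPowerSeries (Fin n) ℂ) : MvPowerSeries (Fin n) ℂ :=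
  fun α => if primeCode α ≤ m then coeff α X else 0

theorem coeff_codeTrunc (m : ℕ) (X : MvPowerSeries (Fin n) ℂ) (α : Fin n →₀ ℕ) :
    coeff α (codeTrunc m X) = if primeCode α ≤ m then coeff α X else 0 := rfl

/-- Only finitely many codes are at most `m`, so the truncation is a polynomial. It replaces
multipliers in the ideal that may diverge everywhere. -/
theorem absNorm_codeTrunc_ne_top (m : ℕ) (X : MvPowerSeries (Fin n) ℂ) (r : Fin n → ℝ≥0) :
    absNorm r (codeTrunc m X) ≠ ∞ := by
  have hfin : {α : Fin n →₀ ℕ | primeCode α ≤ m}.Finite :=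
    (Set.finite_Iic m).preimage primeCode_injective.injOn
  rw [absNorm, tsum_eq_sum (s := hfin.toFinset) fun α hα => ?_]
  · exact ENNReal.sum_ne_top.2 fun α _ => ENNReal.mul_ne_top (by simp) (radius_ne_top _ _)
  · rw [coeff_codeTrunc, if_neg (by simpa using hα)]
    simp

/-- Elements of the ideal generated by convergent power series agree up to any order with
convergent ones, whose values are controlled by those of the generators. -/
theorem exists_controlled_of_mem_span {φ : ℕ → MvPowerSeries (Fin n) ℂ} {r : Fin n → ℝ≥0}
    (hφ : ∀ k, absNorm r (φ k) ≠ ∞) {X : MvPowerSeries (Fin n) ℂ}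
    (hX : X ∈ Ideal.span (Set.range φ)) (m : ℕ) :
    ∃ Y ∈ Ideal.span (Set.range φ), (∀ β, primeCode β ≤ m → coeff β Y = coeff β X) ∧
      absNorm r Y ≠ ∞ ∧ ∃ (N : ℕ) (B : ℝ≥0), ∀ z : Fin n → ℂ, (∀ i, ‖z i‖₊ ≤ r i) →
        ‖ev Y z‖ₑ ≤ B * ∑ j ∈ Finset.range N, ‖ev (φ j) z‖ₑ := by
  classical
  induction hX using Submodule.span_induction with
  | mem x hx =>
    obtain ⟨k, rfl⟩ := hx
    refine ⟨φ k, Ideal.subset_span ⟨k, rfl⟩, fun _ _ => rfl, hφ k, k + 1, 1, fun z _ => ?_⟩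
    rw [ENNReal.coe_one, one_mul]
    exact Finset.single_le_sum (f := fun j => ‖ev (φ j) z‖ₑ) (fun _ _ => zero_le) (by simp)
  | zero =>
    refine ⟨0, zero_mem _, fun _ _ => rfl, by simp [absNorm_zero], 0, 0, fun z _ => ?_⟩
    simp [ev]
  | add x y _ _ hx hy =>
    obtain ⟨X, hXI, hX1, hX2, N, B, hX3⟩ := hx
    obtain ⟨Y, hYI, hY1, hY2, N', B', hY3⟩ := hy
    refine ⟨X + Y, add_mem hXI hYI, fun β hβ => ?_, ?_, max N N', B + B', fun z hz => ?_⟩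
    · rw [map_add, map_add, hX1 β hβ, hY1 β hβ]
    · exact ne_top_of_le_ne_top (ENNReal.add_ne_top.2 ⟨hX2, hY2⟩) (absNorm_add_le _ _ _)
    · rw [ev_add (ne_top_of_le_ne_top hX2 (absNorm_mono hz _))
        (ne_top_of_le_ne_top hY2 (absNorm_mono hz _)), ENNReal.coe_add, add_mul]
      refine (enorm_add_le _ _).trans (add_le_add ((hX3 z hz).trans ?_) ((hY3 z hz).trans ?_))
      · gcongr; exact le_max_left _ _
      · gcongr; exact le_max_right _ _
  | smul a x _ hx =>
    obtain ⟨X, hXI, hX1, hX2, N, B, hX3⟩ := hx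
    have ha := absNorm_codeTrunc_ne_top m a r
    -- Codes are at least `1` and multiply, so a coefficient of the product with code at most `m`
    -- involves only coefficients of the factors with code at most `m`. Truncating `a` does not
    -- change it.
    refine ⟨codeTrunc m a * X, Ideal.mul_mem_left _ _ hXI, fun β hβ => ?_, ?_, N,
      (absNorm r (codeTrunc m a)).toNNReal * B, fun z hz => ?_⟩
    · rw [smul_eq_mul, coeff_mul, coeff_mul]
      refine Finset.sum_congr rfl fun p hp => ?_
      have h1 : primeCode p.1 * primeCode p.2 ≤ m := by
        rw [← primeCode_add, Finset.HasAntidiagonal.mem_antidiagonal.1 hp]; exact hβ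
      have h2 := primeCode_pos p.1
      have h3 := primeCode_pos p.2
      rw [coeff_codeTrunc, if_pos (by nlinarith), hX1 _ (by nlinarith)]
    · exact ne_top_of_le_ne_top (ENNReal.mul_ne_top ha hX2) (absNorm_mul_le _ _ _)
    · rw [ev_mul (ne_top_of_le_ne_top ha (absNorm_mono hz _))
        (ne_top_of_le_ne_top hX2 (absNorm_mono hz _)), enorm_mul, ENNReal.coe_mul, mul_assoc,
        ENNReal.coe_toNNReal ha]
      exact mul_le_mul' ((enorm_ev_le _ _).trans (absNorm_mono hz _)) (hX3 z hz)

/-- For small radii the leading monomial dominates. -/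
theorem eventually_absNorm_monomial_sub_le {g : MvPowerSeries (Fin n) ℂ} {σ : Fin n →₀ ℕ}
    (hg : Leads g σ) {T₀ : ℕ} (h : absNorm (primeRadius n T₀) g ≠ ∞) :
    ∀ᶠ T in atTop, absNorm (primeRadius n T) (monomial σ 1 - g) ≤
      2⁻¹ * radius (primeRadius n T) σ := by
  classical
  set A := (absNorm (primeRadius n T₀) g).toNNReal with hA
  set m := primeCode σ with hm
  have hm0 : 0 < m := primeCode_pos σ
  -- Exponents before `σ` do not occur, `σ` cancels, and later ones have code at least `m + 1`. Each
  -- further unit of `T` thus gains a factor `1 / (m + 1)`, while the monomial `σ` itself only loses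
  -- `1 / m`.
  have h1 : ∀ T, absNorm (primeRadius n (T₀ + T)) (monomial σ 1 - g) ≤
      ((A * ((m + 1 : ℝ≥0)⁻¹) ^ T : ℝ≥0) : ℝ≥0∞) := by
    intro T
    rw [ENNReal.coe_mul, hA, ENNReal.coe_toNNReal h, absNorm, absNorm, ← ENNReal.tsum_mul_right]
    refine ENNReal.tsum_le_tsum fun β => ?_
    rcases lt_trichotomy (primeCode β) m with hβ | hβ | hβ
    · rw [map_sub, hg.2 β hβ, coeff_monomial, if_neg (by rintro rfl; exact hβ.ne rfl)]
      simp
    · rw [primeCode_injective hβ, map_sub, hg.1, coeff_monomial, if_pos rfl]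
      simp
    · rw [map_sub, coeff_monomial, if_neg (by rintro rfl; exact hβ.ne rfl), zero_sub, enorm_neg,
        mul_assoc]
      gcongr
      rw [radius_primeRadius, radius_primeRadius, ← ENNReal.coe_mul, pow_add]
      gcongr
      exact_mod_cast hβ
  have h2 : Tendsto (fun T : ℕ => A * m ^ T₀ * (m / (m + 1) : ℝ≥0) ^ T) atTop (𝓝 0) := by
    have : (m / (m + 1) : ℝ≥0) < 1 := by
      rw [div_lt_one (by positivity)]; exact lt_add_one _
    simpa using (NNReal.tendsto_pow_atTop_nhds_zero_of_lt_one this).const_mul (A * m ^ T₀)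
  have h3 : ∀ᶠ T in atTop, absNorm (primeRadius n (T + T₀)) (monomial σ 1 - g) ≤
      2⁻¹ * radius (primeRadius n (T + T₀)) σ := by
    filter_upwards [h2.eventually_lt_const (show (0 : ℝ≥0) < 2⁻¹ by simp)] with T hT
    rw [add_comm T]
    refine (h1 T).trans ?_
    rw [radius_primeRadius, ← ENNReal.coe_two, ← ENNReal.coe_inv two_ne_zero, ← ENNReal.coe_mul,
      ENNReal.coe_le_coe, ← hm]
    have hmpos : (0 : ℝ≥0) < m := by exact_mod_cast hm0
    calc A * (m + 1 : ℝ≥0)⁻¹ ^ T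
        = (A * m ^ T₀ * (m / (m + 1) : ℝ≥0) ^ T) * (m : ℝ≥0)⁻¹ ^ (T₀ + T) := by
          rw [pow_add, div_pow, inv_pow, inv_pow, inv_pow]
          field_simp
      _ ≤ _ := by gcongr
  rw [← map_add_atTop_eq_nat T₀, eventually_map]
  exact h3
end

/-! ### Division by finitely many series, with estimates -/

section

open MvPowerSeries

variable {n : ℕ}

open scoped Classical in
/-- The quotient by the monomial `σ` of the part of `X` supported on `{α | σ ≤ α, sel α = σ}`. -/
noncomputable def selQuot (sel : (Fin n →₀ ℕ) → (Fin n →₀ ℕ)) (σ : Fin n →₀ ℕ)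
    (X : MvPowerSeries (Fin n) ℂ) : MvPowerSeries (Fin n) ℂ :=
  fun γ => if sel (γ + σ) = σ then coeff (γ + σ) X else 0

open scoped Classical in
theorem coeff_selQuot (sel : (Fin n →₀ ℕ) → (Fin n →₀ ℕ)) (σ γ : Fin n →₀ ℕ)
    (X : MvPowerSeries (Fin n) ℂ) :
    coeff γ (selQuot sel σ X) = if sel (γ + σ) = σ then coeff (γ + σ) X else 0 := rfl

/-- The sets `{α | sel α = σ}` are disjoint, so splitting `X` into these pieces costs no constant.
-/
theorem sum_absNorm_selQuot_le (sel : (Fin n →₀ ℕ) → (Fin n →₀ ℕ)) (S : Finset (Fin n →₀ ℕ))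
    (X : MvPowerSeries (Fin n) ℂ) (r : Fin n → ℝ≥0) :
    ∑ σ ∈ S, absNorm r (selQuot sel σ X) * radius r σ ≤ absNorm r X := by
  classical
  have h1 : ∀ σ, absNorm r (selQuot sel σ X) * radius r σ ≤
      ∑' α, if sel α = σ then ‖coeff α X‖ₑ * radius r α else 0 := by
    intro σ
    rw [absNorm, ← ENNReal.tsum_mul_right]
    refine le_trans (le_of_eq (tsum_congr fun γ => ?_))
      (ENNReal.tsum_comp_le_tsum_of_injective (add_left_injective σ) _)
    rw [coeff_selQuot, mul_assoc, ← radius_add]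
    split_ifs <;> simp
  refine (Finset.sum_le_sum fun σ _ => h1 σ).trans ?_
  rw [← Summable.tsum_finsetSum fun _ _ => ENNReal.summable, absNorm]
  refine ENNReal.tsum_le_tsum fun α => ?_
  rw [Finset.sum_ite_eq]
  split_ifs <;> simp

/-- The error term of one step of the division by the series `g σ`, whose leading monomials
are the `σ ∈ S`. -/
noncomputable def divStep (sel : (Fin n →₀ ℕ) → (Fin n →₀ ℕ)) (S : Finset (Fin n →₀ ℕ))
    (g : (Fin n →₀ ℕ) → MvPowerSeries (Fin n) ℂ) (X : MvPowerSeries (Fin n) ℂ) :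
    MvPowerSeries (Fin n) ℂ :=
  ∑ σ ∈ S, selQuot sel σ X * (monomial σ 1 - g σ)

/-- Each `g σ` differs from its leading monomial by at most half the size of that monomial, and the
pieces of `X` are disjoint: replacing the monomials by the `g σ` is a perturbation of norm at most
`1 / 2`. -/
theorem absNorm_divStep_le (sel : (Fin n →₀ ℕ) → (Fin n →₀ ℕ)) {S : Finset (Fin n →₀ ℕ)}
    {g : (Fin n →₀ ℕ) → MvPowerSeries (Fin n) ℂ} {r : Fin n → ℝ≥0}
    (hg : ∀ σ ∈ S, absNorm r (monomial σ 1 - g σ) ≤ 2⁻¹ * radius r σ)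
    (X : MvPowerSeries (Fin n) ℂ) :
    absNorm r (divStep sel S g X) ≤ 2⁻¹ * absNorm r X := by
  refine (absNorm_sum_le _ _ _).trans (le_trans ?_ (mul_le_mul_right
    (sum_absNorm_selQuot_le sel S X r) _))
  rw [Finset.mul_sum]
  refine Finset.sum_le_sum fun σ hσ => (absNorm_mul_le _ _ _).trans ?_
  rw [mul_left_comm]
  gcongr
  exact hg σ hσ

/-- Each coefficient of `divStep` is a finite linear combination of coefficients of its argument, so
coefficientwise summation is enough to sum the Neumann series. -/
theorem hasSum_coeff_divStep (sel : (Fin n →₀ ℕ) → (Fin n →₀ ℕ)) (S : Finset (Fin n →₀ ℕ))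
    (g : (Fin n →₀ ℕ) → MvPowerSeries (Fin n) ℂ) {X : ℕ → MvPowerSeries (Fin n) ℂ}
    {Y : MvPowerSeries (Fin n) ℂ} (h : ∀ α, HasSum (fun j => coeff α (X j)) (coeff α Y))
    (α : Fin n →₀ ℕ) :
    HasSum (fun j => coeff α (divStep sel S g (X j))) (coeff α (divStep sel S g Y)) := by
  classical
  simp only [divStep, map_sum, coeff_mul]
  refine hasSum_sum fun σ _ => hasSum_sum fun p _ => HasSum.mul_right _ ?_
  simp only [coeff_selQuot]
  split_ifs
  · exact h _
  · exact hasSum_zero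

/-- The Neumann series for the division operator. -/
theorem exists_eq_add_divStep (sel : (Fin n →₀ ℕ) → (Fin n →₀ ℕ)) {S : Finset (Fin n →₀ ℕ)}
    {g : (Fin n →₀ ℕ) → MvPowerSeries (Fin n) ℂ} {r : Fin n → ℝ≥0} (hr : ∀ i, 0 < r i)
    (hg : ∀ σ ∈ S, absNorm r (monomial σ 1 - g σ) ≤ 2⁻¹ * radius r σ)
    {X : MvPowerSeries (Fin n) ℂ} (hX : absNorm r X ≠ ∞) :
    ∃ Y, Y = X + divStep sel S g Y ∧ absNorm r Y ≤ 2 * absNorm r X := by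
  set Z : ℕ → MvPowerSeries (Fin n) ℂ := fun j => (divStep sel S g)^[j] X with hZ
  have hZ0 : ∀ j, Z (j + 1) = divStep sel S g (Z j) := fun j => Function.iterate_succ_apply' _ _ _
  have hZn : ∀ j, absNorm r (Z j) ≤ 2⁻¹ ^ j * absNorm r X := by
    intro j
    induction j with
    | zero => simp [hZ]
    | succ j ih =>
      rw [hZ0, pow_succ', mul_assoc]
      exact (absNorm_divStep_le sel hg _).trans (by gcongr)
  have hZs : ∑' j, absNorm r (Z j) ≤ 2 * absNorm r X := by
    refine (ENNReal.tsum_le_tsum hZn).trans ?_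
    rw [ENNReal.tsum_mul_right, ENNReal.tsum_geometric, ENNReal.one_sub_inv_two, inv_inv]
  have hsum : ∀ α, Summable fun j => coeff α (Z j) := by
    intro α
    have h1 : (∑' j, ‖coeff α (Z j)‖ₑ) * radius r α ≠ ∞ := by
      refine ne_top_of_le_ne_top (ENNReal.mul_ne_top ENNReal.ofNat_ne_top hX) (le_trans ?_ hZs)
      rw [← ENNReal.tsum_mul_right]
      exact ENNReal.tsum_le_tsum fun j =>
        ENNReal.le_tsum (f := fun α => ‖coeff α (Z j)‖ₑ * radius r α) α
    have h2 : ∑' j, ‖coeff α (Z j)‖ₑ ≠ ∞ := fun h => h1 (by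
      rw [h, ENNReal.top_mul (radius_ne_zero hr α)])
    simp only [enorm_eq_nnnorm] at h2
    exact Summable.of_nnnorm (ENNReal.tsum_coe_ne_top_iff_summable.1 h2)
  let Y : MvPowerSeries (Fin n) ℂ := fun α => ∑' j, coeff α (Z j)
  have hY : ∀ α, HasSum (fun j => coeff α (Z j)) (coeff α Y) := fun α => (hsum α).hasSum
  refine ⟨Y, ?_, le_trans ?_ hZs⟩
  · ext α
    have h1 := hasSum_coeff_divStep sel S g hY α
    simp only [← hZ0] at h1
    have h2 := (hasSum_nat_add_iff' (f := fun j => coeff α (Z j)) 1).2 (hY α)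
    rw [map_add, h1.unique h2]
    simp [hZ]
  · simp only [absNorm]
    rw [ENNReal.tsum_comm]
    refine ENNReal.tsum_le_tsum fun α => ?_
    rw [ENNReal.tsum_mul_right]
    gcongr
    rw [← (hY α).tsum_eq]
    exact enorm_tsum_le_tsum_enorm

/-- Recovers the part of `X` supported on `P`, the multiples of the exponents in `S`. What is left
of `X` is the remainder of the division. -/
theorem sum_selQuot_mul_monomial {sel : (Fin n →₀ ℕ) → (Fin n →₀ ℕ)} {S : Finset (Fin n →₀ ℕ)}
    {P : (Fin n →₀ ℕ) → Prop} [DecidablePred P] (hsel : ∀ α, P α → sel α ∈ S ∧ sel α ≤ α)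
    (hP : ∀ α, ∀ σ ∈ S, σ ≤ α → P α) (X : MvPowerSeries (Fin n) ℂ) (α : Fin n →₀ ℕ) :
    coeff α (∑ σ ∈ S, selQuot sel σ X * monomial σ 1) = if P α then coeff α X else 0 := by
  classical
  rw [map_sum]
  simp only [coeff_mul_monomial, mul_one, coeff_selQuot]
  split_ifs with h
  · obtain ⟨h1, h2⟩ := hsel α h
    rw [Finset.sum_eq_single_of_mem _ h1 fun σ _ hσ => ?_]
    · rw [if_pos h2, tsub_add_cancel_of_le h2, if_pos rfl]
    · split_ifs with h3 h4
      · rw [tsub_add_cancel_of_le h3] at h4; exact absurd h4.symm hσ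
      · rfl
      · rfl
  · refine Finset.sum_eq_zero fun σ hσ => ?_
    rw [if_neg fun h' => h (hP α σ hσ h')]

/-- **Uniform control of an ideal by finitely many generators.** For a sequence of convergent power
series `φ k`, finitely many of them bound all the others on a common polydisk, with constants
proportional to the norms of the `φ k`. -/
theorem exists_enorm_ev_le {φ : ℕ → MvPowerSeries (Fin n) ℂ} {T₀ : ℕ}
    (hφ : ∀ k, absNorm (primeRadius n T₀) (φ k) ≠ ∞) :
    ∃ T ≥ T₀, ∃ (N : ℕ) (B : ℝ≥0), ∀ k, ∀ z : Fin n → ℂ, (∀ i, ‖z i‖₊ ≤ primeRadius n T i) →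
      ‖ev (φ k) z‖ₑ ≤ B * absNorm (primeRadius n T) (φ k) *
        ∑ j ∈ Finset.range N, ‖ev (φ j) z‖ₑ := by
  classical
  set I := Ideal.span (Set.range φ) with hI
  obtain ⟨S, hS, hS'⟩ := exists_finset_leads I
  have hg : ∀ σ ∈ S, ∃ Y ∈ I, Leads Y σ ∧ absNorm (primeRadius n T₀) Y ≠ ∞ ∧
      ∃ (N : ℕ) (B : ℝ≥0), ∀ z : Fin n → ℂ, (∀ i, ‖z i‖₊ ≤ primeRadius n T₀ i) →
        ‖ev Y z‖ₑ ≤ B * ∑ j ∈ Finset.range N, ‖ev (φ j) z‖ₑ := by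
    intro σ hσ
    obtain ⟨X, hXI, hX⟩ := hS σ hσ
    -- The element `X` with leading exponent `σ` may diverge. Agreement up to the code of `σ` is
    -- enough for `Y` to keep the same leading exponent and coefficient.
    obtain ⟨Y, hYI, hY, h1, h2⟩ := exists_controlled_of_mem_span hφ hXI (primeCode σ)
    exact ⟨Y, hYI, ⟨by rw [hY _ le_rfl, hX.1], fun β hβ => by rw [hY _ hβ.le, hX.2 _ hβ]⟩, h1, h2⟩
  choose! g hgI hgL hgn N B hgB using hg
  have hev : ∀ᶠ T in atTop, T₀ ≤ T ∧ ∀ σ ∈ S, absNorm (primeRadius n T) (monomial σ 1 - g σ) ≤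
      2⁻¹ * radius (primeRadius n T) σ :=
    (eventually_ge_atTop T₀).and ((Finset.eventually_all S).2 fun σ hσ =>
      eventually_absNorm_monomial_sub_le (hgL σ hσ) (hgn σ hσ))
  obtain ⟨T, hT0, hT⟩ := hev.exists
  set r := primeRadius n T with hr
  have hr0 : ∀ i, 0 < r i := primeRadius_pos T
  have hrT : ∀ i, r i ≤ primeRadius n T₀ i := primeRadius_anti hT0
  let P : (Fin n →₀ ℕ) → Prop := fun α => ∃ σ ∈ S, σ ≤ α
  choose! sel hsel using fun (α : Fin n →₀ ℕ) (h : P α) => h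
  refine ⟨T, hT0, S.sup N, (∑ σ ∈ S, 2 * (radius r σ).toNNReal⁻¹ * B σ), fun k z hz => ?_⟩
  have hφk : absNorm r (φ k) ≠ ∞ := ne_top_of_le_ne_top (hφ k) (absNorm_mono hrT _)
  -- With quotients `q_σ = selQuot sel σ Y`, the equation for `Y` reads `Y - ∑ q_σ ζ^σ = φ k - ∑ q_σ
  -- g_σ`. The left side has no coefficients at multiples of leading exponents and the right side
  -- lies in `I`, so both are `0`.
  obtain ⟨Y, hY, hYn⟩ := exists_eq_add_divStep sel hr0 hT hφk
  have hYn' : absNorm r Y ≠ ∞ :=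
    ne_top_of_le_ne_top (ENNReal.mul_ne_top ENNReal.ofNat_ne_top hφk) hYn
  -- the remainder vanishes
  have hrem : Y - ∑ σ ∈ S, selQuot sel σ Y * monomial σ 1 = 0 := by
    by_contra h0
    have h1 : Y - ∑ σ ∈ S, selQuot sel σ Y * monomial σ 1 =
        φ k - ∑ σ ∈ S, selQuot sel σ Y * g σ := by
      nth_rewrite 1 [hY]
      simp only [divStep, mul_sub, Finset.sum_sub_distrib]
      ring
    have h2 : Y - ∑ σ ∈ S, selQuot sel σ Y * monomial σ 1 ∈ I := by
      rw [h1]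
      exact sub_mem (Ideal.subset_span ⟨k, rfl⟩)
        (sum_mem fun σ hσ => Ideal.mul_mem_left _ _ (hgI σ hσ))
    obtain ⟨σ, hσ, hσ'⟩ := exists_leads h2 h0
    have hPσ : P σ := hS' σ hσ'
    refine hσ ?_
    rw [map_sub, sum_selQuot_mul_monomial hsel (fun α σ h h' => ⟨σ, h, h'⟩), if_pos hPσ, sub_self]
  have heq : φ k = ∑ σ ∈ S, selQuot sel σ Y * g σ := by
    have h1 : Y = φ k + (∑ σ ∈ S, selQuot sel σ Y * monomial σ 1 -
        ∑ σ ∈ S, selQuot sel σ Y * g σ) := by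
      rw [← Finset.sum_sub_distrib]
      simpa only [divStep, mul_sub] using hY
    rw [sub_eq_zero] at hrem
    rw [← hrem] at h1
    linear_combination -h1
  have hq : ∀ σ ∈ S, absNorm r (selQuot sel σ Y) ≤
      2 * ((radius r σ).toNNReal⁻¹ : ℝ≥0) * absNorm r (φ k) := by
    intro σ hσ
    have h1 : absNorm r (selQuot sel σ Y) * radius r σ ≤ absNorm r Y :=
      (Finset.single_le_sum (f := fun σ => absNorm r (selQuot sel σ Y) * radius r σ)
        (fun _ _ => zero_le) hσ).trans (sum_absNorm_selQuot_le sel S Y r)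
    have h2 := h1.trans hYn
    have h3 := radius_ne_zero hr0 σ
    have h4 := radius_ne_top r σ
    rw [ENNReal.coe_inv (by simp [ENNReal.toNNReal_eq_zero_iff, h3, h4]), ENNReal.coe_toNNReal h4,
      mul_right_comm, ← div_eq_mul_inv]
    exact (ENNReal.le_div_iff_mul_le (Or.inl h3) (Or.inl h4)).2 h2
  have hqn : ∀ σ ∈ S, absNorm r (selQuot sel σ Y) ≠ ∞ := fun σ hσ =>
    ne_top_of_le_ne_top (ENNReal.mul_ne_top (ENNReal.mul_ne_top ENNReal.ofNat_ne_top
      ENNReal.coe_ne_top) hφk) (hq σ hσ)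
  have hgn' : ∀ σ ∈ S, absNorm (fun i => ‖z i‖₊) (g σ) ≠ ∞ := fun σ hσ =>
    ne_top_of_le_ne_top (hgn σ hσ) (absNorm_mono (fun i => (hz i).trans (hrT i)) _)
  have hqn' : ∀ σ ∈ S, absNorm (fun i => ‖z i‖₊) (selQuot sel σ Y) ≠ ∞ := fun σ hσ =>
    ne_top_of_le_ne_top (hqn σ hσ) (absNorm_mono hz _)
  nth_rewrite 1 [heq]
  rw [ev_sum S fun σ hσ => ne_top_of_le_ne_top (ENNReal.mul_ne_top (hqn' σ hσ) (hgn' σ hσ))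
    (absNorm_mul_le _ _ _), ENNReal.ofNNReal_finsetSum, Finset.sum_mul, Finset.sum_mul]
  refine (enorm_sum_le _ _).trans (Finset.sum_le_sum fun σ hσ => ?_)
  rw [ev_mul (hqn' σ hσ) (hgn' σ hσ), enorm_mul]
  calc ‖ev (selQuot sel σ Y) z‖ₑ * ‖ev (g σ) z‖ₑ
      ≤ (2 * ((radius r σ).toNNReal⁻¹ : ℝ≥0) * absNorm r (φ k)) *
        (B σ * ∑ j ∈ Finset.range (S.sup N), ‖ev (φ j) z‖ₑ) := by
        refine mul_le_mul' (((enorm_ev_le _ _).trans (absNorm_mono hz _)).trans (hq σ hσ)) ?_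
        refine (hgB σ hσ z fun i => (hz i).trans (hrT i)).trans ?_
        gcongr
        exact Finset.le_sup hσ
    _ = _ := by push_cast; ring

end

/-! ### Uniform doubling for the coordinate slices of `φ` -/

section

variable {n : ℕ}

/-- On a bounded polydisk, the Taylor coefficients in the first variable are all controlled by
finitely many of them, uniformly in the other variables. -/
theorem exists_norm_taylor_cons_le {R M : ℝ} (hR : 0 < R) {F : (Fin (n + 1) → ℂ) → ℂ}
    (hF : DifferentiableOn ℂ F {z | ∀ i, ‖z i‖ < R}) (hM : ∀ z, (∀ i, ‖z i‖ < R) → ‖F z‖ ≤ M) :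
    ∃ (r : Fin n → ℝ≥0) (N : ℕ) (B : ℝ≥0), (∀ i, 0 < r i ∧ (r i : ℝ) < R) ∧
      ∀ z' : Fin n → ℂ, (∀ i, ‖z' i‖₊ ≤ r i) → ∀ k,
        ‖iteratedDeriv k (fun w => F (Fin.cons w z')) 0 / k.factorial‖ ≤ B * R⁻¹ ^ k *
          ∑ j ∈ Finset.range N, ‖iteratedDeriv j (fun w => F (Fin.cons w z')) 0 / j.factorial‖ := by
  have hM0 : 0 ≤ M := (norm_nonneg _).trans (hM 0 (by simpa using hR))
  choose φ hφ hφ' using fun k : ℕ => exists_powerSeries_of_bounded hR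
    (differentiableOn_iteratedDeriv_cons hR hF hM k)
    (fun z' hz' => (taylor_cons hR hF hM hz').1 k)
  obtain ⟨T₀, hT₀⟩ : ∃ T₀ : ℕ, ∀ i, (primeRadius n T₀ i : ℝ) < R := by
    obtain ⟨T, hT⟩ := exists_pow_lt_of_lt_one hR (show (2⁻¹ : ℝ) < 1 by norm_num)
    refine ⟨T, fun i => lt_of_le_of_lt ?_ hT⟩
    rw [primeRadius, NNReal.coe_pow, NNReal.coe_inv]
    gcongr
    exact_mod_cast (Nat.prime_nth_prime i).two_le
  obtain ⟨T, hT, N, B, h⟩ := exists_enorm_ev_le (φ := φ) (T₀ := T₀) fun k =>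
    absNorm_ne_top_of_coeff_le hR (hφ k) hT₀
  have hTR : ∀ i, (primeRadius n T i : ℝ) < R := fun i =>
    lt_of_le_of_lt (by exact_mod_cast primeRadius_anti hT i) (hT₀ i)
  set A := ∑' α, radius (fun i => primeRadius n T i / R.toNNReal) α with hA
  have hAt : A ≠ ∞ := tsum_radius_div_ne_top hR hTR
  refine ⟨primeRadius n T, N, B * M.toNNReal * A.toNNReal,
    fun i => ⟨primeRadius_pos T i, hTR i⟩, fun z' hz' k => ?_⟩
  have hz'' : ∀ i, ‖z' i‖ < R := fun i => lt_of_le_of_lt (by exact_mod_cast hz' i) (hTR i)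
  have h1 := h k z' hz'
  have h2 : absNorm (primeRadius n T) (φ k) ≤ ENNReal.ofReal (M * R⁻¹ ^ k) * A :=
    absNorm_le_of_coeff_le hR (hφ k) _
  have h3 : ‖ev (φ k) z'‖ₑ ≤ ENNReal.ofReal (((B * M.toNNReal * A.toNNReal : ℝ≥0) : ℝ) * R⁻¹ ^ k *
      ∑ j ∈ Finset.range N, ‖ev (φ j) z'‖) := by
    have h4 : ‖ev (φ k) z'‖ₑ ≤ B * (ENNReal.ofReal (M * R⁻¹ ^ k) * A) *
        ∑ j ∈ Finset.range N, ‖ev (φ j) z'‖ₑ := h1.trans (by gcongr)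
    refine h4.trans (le_of_eq ?_)
    rw [ENNReal.ofReal_mul hM0, ENNReal.ofReal_mul (by positivity),
      ENNReal.ofReal_mul (NNReal.coe_nonneg _), ENNReal.ofReal_sum_of_nonneg fun _ _ => norm_nonneg _,
      ENNReal.ofReal_coe_nnreal, ENNReal.coe_mul, ENNReal.coe_mul, ENNReal.coe_toNNReal hAt]
    simp only [ofReal_norm]
    rw [ENNReal.ofReal]
    ring
  rw [← ofReal_norm, ENNReal.ofReal_le_ofReal_iff (by positivity)] at h3
  simp only [hφ' _ z' hz''] at h3
  exact h3

/-- Local doubling: near a given point, a holomorphic function on a small disc of fixed size in a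
coordinate direction is controlled by its values on arbitrarily small concentric discs. -/
theorem exists_doubling_nhds {φ : (Fin n → ℂ) → ℂ} {U : Set (Fin n → ℂ)} (hU : IsOpen U)
    (hφ : DifferentiableOn ℂ φ U) (i : Fin n) {p : Fin n → ℂ} (hp : p ∈ U) :
    ∃ V ∈ 𝓝 p, ∃ s > 0, ∀ ε > 0, ∃ C ≥ 0, ∀ z ∈ V, ∀ M : ℝ,
      (∀ μ : ℂ, ‖μ‖ ≤ ε → ‖φ (z + Pi.single i μ)‖ ≤ M) →
      ∀ μ : ℂ, ‖μ‖ ≤ s → ‖φ (z + Pi.single i μ)‖ ≤ C * M := by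
  -- The extra variable `x 0` moves along the coordinate `i` while the others move the base point.
  -- All slices near `p` become expansions in the first variable, with coefficients holomorphic in
  -- the base point.
  let ψ : (Fin (n + 1) → ℂ) → Fin n → ℂ := fun x => p + Fin.tail x + Pi.single i (x 0)
  have hψ : Differentiable ℂ ψ := by
    refine differentiable_pi.2 fun j => ?_
    simp only [ψ, Pi.add_apply, Fin.tail]
    by_cases hj : j = i
    · subst hj; simp only [Pi.single_eq_same]; fun_prop
    · simp only [Pi.single_eq_of_ne hj]; fun_prop
  have hψ0 : ψ 0 = p := by
    ext j; simp [ψ, Fin.tail]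
  have hopen : IsOpen (ψ ⁻¹' U) := hU.preimage hψ.continuous
  obtain ⟨R, hR, hRsub⟩ := Metric.nhds_basis_closedBall.mem_iff.1
    (hopen.mem_nhds (show (0 : Fin (n + 1) → ℂ) ∈ ψ ⁻¹' U by rw [Set.mem_preimage, hψ0]; exact hp))
  have hF : DifferentiableOn ℂ (φ ∘ ψ) (closedBall 0 R) :=
    hφ.comp hψ.differentiableOn fun x hx => hRsub hx
  obtain ⟨M, hM⟩ := (isCompact_closedBall (0 : Fin (n + 1) → ℂ) R).exists_bound_of_continuousOn
    hF.continuousOn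
  have hmem : ∀ z : Fin (n + 1) → ℂ, (∀ i, ‖z i‖ < R) → z ∈ closedBall (0 : Fin (n + 1) → ℂ) R :=
    fun z hz => by
      rw [mem_closedBall_zero_iff, pi_norm_le_iff_of_nonneg hR.le]
      exact fun i => (hz i).le
  have hF' : DifferentiableOn ℂ (φ ∘ ψ) {z | ∀ i, ‖z i‖ < R} := hF.mono fun z hz => hmem z hz
  have hM' : ∀ z : Fin (n + 1) → ℂ, (∀ i, ‖z i‖ < R) → ‖(φ ∘ ψ) z‖ ≤ M := fun z hz =>
    hM z (hmem z hz)
  obtain ⟨r, N, B, hr, hB⟩ := exists_norm_taylor_cons_le hR hF' hM'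
  refine ⟨{z | ∀ j, ‖z j - p j‖ < r j}, ?_, R / 2, by positivity, fun ε hε => ?_⟩
  · refine IsOpen.mem_nhds ?_ fun j => by simpa using (hr j).1
    simp only [Set.ofPred_forall]
    exact isOpen_iInter_of_finite fun i => isOpen_lt (by fun_prop) continuous_const
  -- The radius `R / 2` has been fixed before `ε`; only the constant depends on `ε`. Cauchy's
  -- estimates on the disc of radius `δ` bound the first `N` coefficients, `hB` bounds the others by
  -- these, and `‖μ‖ ≤ R / 2` makes the series geometric.
  set δ := min ε R with hδ
  have hδ0 : 0 < δ := lt_min hε hR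
  refine ⟨2 * B * ∑ j ∈ Finset.range N, δ⁻¹ ^ j, by positivity, fun z hz M₁ hM₁ μ hμ => ?_⟩
  have hM₁0 : 0 ≤ M₁ := (norm_nonneg _).trans (hM₁ 0 (by simpa using hε.le))
  set z' : Fin n → ℂ := fun j => z j - p j with hz'
  have hval : ∀ w : ℂ, (φ ∘ ψ) (Fin.cons w z') = φ (z + Pi.single i w) := by
    intro w
    simp only [Function.comp, ψ, Fin.tail_cons, Fin.cons_zero]
    congr 2
    ext j; simp [hz']
  have hz'R : ∀ j, ‖z' j‖ < R := fun j => (hz j).trans (hr j).2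
  have hz'r : ∀ j, ‖z' j‖₊ ≤ r j := fun j => by exact_mod_cast (hz j).le
  have hT1 : ∀ j, ‖iteratedDeriv j (fun w => (φ ∘ ψ) (Fin.cons w z')) 0 / j.factorial‖ ≤
      M₁ * δ⁻¹ ^ j := by
    refine (taylor_of_bounded hδ0 (g := fun w => (φ ∘ ψ) (Fin.cons w z')) ?_ fun w hw => ?_).1
    · refine hF'.comp (f := fun w => (Fin.cons w z' : Fin (n + 1) → ℂ)) ?_ fun w hw j => ?_
      · refine differentiableOn_pi.2 fun j => ?_
        refine Fin.cases ?_ (fun j => ?_) j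
        · simp only [Fin.cons_zero]; fun_prop
        · simp
      · refine Fin.cases ?_ (fun j => ?_) j
        · rw [mem_ball_zero_iff] at hw
          simpa using hw.trans_le (min_le_right _ _)
        · simpa using hz'R j
    · rw [hval]
      rw [mem_ball_zero_iff] at hw
      exact hM₁ w (hw.le.trans (min_le_left _ _))
  have hμR : μ ∈ ball (0 : ℂ) R := by rw [mem_ball_zero_iff]; linarith
  have hs := (taylor_cons hR hF' hM' hz'R).2 μ hμR
  rw [hval] at hs
  have hbound : ∀ k, ‖iteratedDeriv k (fun w => (φ ∘ ψ) (Fin.cons w z')) 0 / k.factorial * μ ^ k‖ ≤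
      (B * (M₁ * ∑ j ∈ Finset.range N, δ⁻¹ ^ j)) * (1 / 2) ^ k := by
    intro k
    rw [norm_mul, norm_pow]
    calc _ ≤ (B * R⁻¹ ^ k * ∑ j ∈ Finset.range N, M₁ * δ⁻¹ ^ j) * ‖μ‖ ^ k := by
          gcongr
          refine (hB z' hz'r k).trans ?_
          gcongr with j _
          exact hT1 j
      _ = (B * (M₁ * ∑ j ∈ Finset.range N, δ⁻¹ ^ j)) * (R⁻¹ * ‖μ‖) ^ k := by
          rw [← Finset.mul_sum, mul_pow]; ring
      _ ≤ _ := by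
          gcongr
          rw [inv_mul_le_iff₀ hR]; linarith
  have h3 := hs.tsum_eq ▸ tsum_of_norm_bounded
    (hasSum_geometric_two.mul_left (B * (M₁ * ∑ j ∈ Finset.range N, δ⁻¹ ^ j) : ℝ)) hbound
  refine h3.trans (le_of_eq ?_)
  ring

/-- Doubling with constants that are uniform on a compact set. -/
theorem exists_doubling_compact {φ : (Fin n → ℂ) → ℂ} {U K : Set (Fin n → ℂ)} (hU : IsOpen U)
    (hφ : DifferentiableOn ℂ φ U) (i : Fin n) (hK : IsCompact K) (hKU : K ⊆ U) :
    ∃ s > 0, ∀ ε > 0, ∃ C ≥ 0, ∀ z ∈ K, ∀ M : ℝ,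
      (∀ μ : ℂ, ‖μ‖ ≤ ε → ‖φ (z + Pi.single i μ)‖ ≤ M) →
      ∀ μ : ℂ, ‖μ‖ ≤ s → ‖φ (z + Pi.single i μ)‖ ≤ C * M := by
  refine hK.induction_on (p := fun K => ∃ s > 0, ∀ ε > 0, ∃ C ≥ 0, ∀ z ∈ K, ∀ M : ℝ,
      (∀ μ : ℂ, ‖μ‖ ≤ ε → ‖φ (z + Pi.single i μ)‖ ≤ M) →
      ∀ μ : ℂ, ‖μ‖ ≤ s → ‖φ (z + Pi.single i μ)‖ ≤ C * M) ?_ ?_ ?_ ?_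
  · exact ⟨1, one_pos, fun _ _ => ⟨0, le_rfl, by simp⟩⟩
  · rintro A B hAB ⟨s, hs, h⟩
    refine ⟨s, hs, fun ε hε => ?_⟩
    obtain ⟨C, hC, h'⟩ := h ε hε
    exact ⟨C, hC, fun z hz => h' z (hAB hz)⟩
  · rintro A B ⟨s, hs, h⟩ ⟨s', hs', h'⟩
    refine ⟨min s s', lt_min hs hs', fun ε hε => ?_⟩
    obtain ⟨C, hC, h1⟩ := h ε hε
    obtain ⟨C', hC', h2⟩ := h' ε hε
    refine ⟨max C C', hC.trans (le_max_left _ _), fun z hz M hM μ hμ => ?_⟩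
    have hM0 : 0 ≤ M := (norm_nonneg _).trans (hM 0 (by simpa using hε.le))
    rcases hz with hz | hz
    · exact (h1 z hz M hM μ (hμ.trans (min_le_left _ _))).trans
        (by gcongr; exact le_max_left _ _)
    · exact (h2 z hz M hM μ (hμ.trans (min_le_right _ _))).trans
        (by gcongr; exact le_max_right _ _)
  · intro p hp
    obtain ⟨V, hV, h⟩ := exists_doubling_nhds hU hφ i (hKU hp)
    exact ⟨V, mem_nhdsWithin_of_mem_nhds hV, h⟩

/-- Doubling for all coordinate slices of a polydisk: the values on the disc of radius `R` are
controlled by those on the disc of radius `s₀`. -/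
theorem exists_doubling_slices {φ : (Fin n → ℂ) → ℂ} {U : Set (Fin n → ℂ)} (hU : IsOpen U)
    (hφ : DifferentiableOn ℂ φ U) (i : Fin n) {R : ℝ} (hRU : {z | ∀ i, ‖z i‖ ≤ R} ⊆ U) {s₀ : ℝ}
    (hs₀ : 0 < s₀) : ∃ C ≥ 0, ∀ z : Fin n → ℂ, (∀ j, ‖z j‖ ≤ R) → ∀ M : ℝ,
      (∀ w : ℂ, ‖w‖ ≤ s₀ → ‖φ (Function.update z i w)‖ ≤ M) →
      ∀ w : ℂ, ‖w‖ ≤ R → ‖φ (Function.update z i w)‖ ≤ C * M := by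
  have hc : IsCompact {z : Fin n → ℂ | ∀ i, ‖z i‖ ≤ R} := by
    have : {z : Fin n → ℂ | ∀ i, ‖z i‖ ≤ R} = Set.univ.pi fun _ => closedBall 0 R := by
      ext z; simp
    rw [this]
    exact isCompact_univ_pi fun _ => isCompact_closedBall _ _
  obtain ⟨s, hs, h⟩ := exists_doubling_compact hU hφ i hc hRU
  obtain ⟨C, hC, h⟩ := h (min (s / 4) s₀) (by positivity)
  have hupd : ∀ (z : Fin n → ℂ) (a b : ℂ),
      Function.update z i a + Pi.single i b = Function.update z i (a + b) := by
    intro z a b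
    ext j
    by_cases hj : j = i
    · subst hj; simp
    · simp [hj]
  -- A chain of discs. Each step enlarges the controlled radius by `s / 2`: moving from `w` towards
  -- `0` by `3 * s / 4`, or to `0` itself if `w` is closer, gives a centre whose disc of radius `min
  -- (s / 4) s₀` is already controlled and whose disc of radius `s` contains `w`.
  have key : ∀ k : ℕ, ∃ C' ≥ 0, ∀ z : Fin n → ℂ, (∀ j, ‖z j‖ ≤ R) → ∀ M : ℝ,
      (∀ w : ℂ, ‖w‖ ≤ s₀ → ‖φ (Function.update z i w)‖ ≤ M) →
      ∀ w : ℂ, ‖w‖ ≤ R → ‖w‖ ≤ s₀ + k * (s / 2) → ‖φ (Function.update z i w)‖ ≤ C' * M := by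
    intro k
    induction k with
    | zero => exact ⟨1, zero_le_one, fun z hz M hM w _ hw => by
        rw [one_mul]; exact hM w (by simpa using hw)⟩
    | succ k ih =>
      obtain ⟨C', hC', ih⟩ := ih
      refine ⟨max C' (C * C'), hC'.trans (le_max_left _ _), fun z hz M hM w hwR hw => ?_⟩
      have hM0 : 0 ≤ M := (norm_nonneg _).trans (hM 0 (by simpa using hs₀.le))
      by_cases hsm : ‖w‖ ≤ s₀ + k * (s / 2)
      · exact (ih z hz M hM w hwR hsm).trans (by gcongr; exact le_max_left _ _)
      push Not at hsm
      -- a centre near `w` whose small disc lies in the region already controlled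
      obtain ⟨c, hcw, hcR, hck⟩ : ∃ c : ℂ, ‖w - c‖ ≤ s ∧ ‖c‖ + min (s / 4) s₀ ≤ ‖w‖ ∧
          ‖c‖ + min (s / 4) s₀ ≤ s₀ + k * (s / 2) := by
        have hk0 : 0 ≤ k * (s / 2) := by positivity
        have hm1 := min_le_left (s / 4) s₀
        have hm2 := min_le_right (s / 4) s₀
        have hw0 : 0 < ‖w‖ := by linarith
        rcases le_total ‖w‖ (3 * s / 4) with h34 | h34
        · refine ⟨0, by rw [sub_zero]; linarith, ?_, ?_⟩ <;> rw [norm_zero] <;> linarith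
        · refine ⟨((1 - 3 * s / 4 / ‖w‖ : ℝ) : ℂ) * w, ?_, ?_, ?_⟩
          · have : w - ((1 - 3 * s / 4 / ‖w‖ : ℝ) : ℂ) * w = ((3 * s / 4 / ‖w‖ : ℝ) : ℂ) * w := by
              push_cast; ring
            rw [this, norm_mul, Complex.norm_real, Real.norm_of_nonneg (by positivity),
              div_mul_cancel₀ _ hw0.ne']
            linarith
          all_goals
            have h1 : 0 ≤ 1 - 3 * s / 4 / ‖w‖ := by
              rw [sub_nonneg, div_le_one hw0]; exact h34
            rw [norm_mul, Complex.norm_real, Real.norm_of_nonneg h1, sub_mul,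
              div_mul_cancel₀ _ hw0.ne']
            push_cast at hw
            linarith
      have h1 := h (Function.update z i c) (fun j => by
        by_cases hj : j = i
        · subst hj
          have : 0 < min (s / 4) s₀ := by positivity
          simp only [Function.update_self]; linarith
        · simpa [hj] using hz j) (C' * M) (fun μ hμ => by
        rw [hupd]
        have := norm_add_le c μ
        exact ih z hz M hM _ (by linarith) (by linarith)) (w - c) hcw
      rw [hupd, add_sub_cancel] at h1
      refine h1.trans ?_
      rw [← mul_assoc]
      gcongr
      exact le_max_right _ _
  obtain ⟨k, hk⟩ := exists_nat_ge ((R - s₀) / (s / 2))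
  obtain ⟨C', hC', h'⟩ := key k
  refine ⟨C', hC', fun z hz M hM w hw => h' z hz M hM w hw ?_⟩
  rw [div_le_iff₀ (by positivity)] at hk
  linarith

end

/-! ### One variable: lower bounds without zeros, circular means, and a single zero -/

section

/-- A Harnack type inequality: a zero-free holomorphic function bounded by `1` that is not small at
one point is not small nearby. -/
theorem exists_le_norm_of_ne_zero {ρ s δ : ℝ} (hs0 : 0 ≤ s) (hs : s < (ρ - 1) / 2)
    (hδ : 0 < δ) : ∃ c > 0, ∀ g : ℂ → ℂ, DifferentiableOn ℂ g (ball 0 ρ) →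
      (∀ z ∈ ball (0 : ℂ) ρ, g z ≠ 0) → (∀ z ∈ ball (0 : ℂ) ρ, ‖g z‖ ≤ 1) →
      ∀ w : ℂ, ‖w‖ ≤ s → δ ≤ ‖g w‖ → ∀ z : ℂ, ‖z‖ ≤ 1 → c ≤ ‖g z‖ := by
  -- The disc of radius `R` about `w` stays inside `ball 0 ρ`, and the condition on `s` makes it
  -- contain the closed unit disc.
  set R := ρ - s with hR
  have hR1 : 1 + s < R := by linarith
  have hR0 : 0 < R := by linarith
  rcases lt_or_ge 1 δ with hδ1 | hδ1
  · refine ⟨1, one_pos, fun g _ _ h1 w hw hδw => ?_⟩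
    have := h1 w (by rw [mem_ball_zero_iff]; linarith)
    linarith
  -- The summand `1` keeps `M` strictly positive when `δ = 1`, as Borel–Carathéodory requires.
  set M := Real.log (1 / δ) + 1 with hM
  have hM0 : 0 < M := by
    have := Real.log_nonneg (x := 1 / δ) (by rw [le_div_iff₀ hδ]; linarith)
    linarith
  refine ⟨δ * Real.exp (-(2 * M * (1 + s) / (R - (1 + s)))), by positivity,
    fun g hg h0 h1 w hw hδw z hz => ?_⟩
  have hsub : ∀ u ∈ ball (0 : ℂ) R, w + u ∈ ball (0 : ℂ) ρ := fun u hu => by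
    rw [mem_ball_zero_iff] at *
    have := norm_add_le w u
    linarith
  set G : ℂ → ℂ := fun u => g (w + u) with hG
  have hGd : DifferentiableOn ℂ G (ball 0 R) :=
    hg.comp (by fun_prop) fun u hu => hsub u hu
  have hG0 : ∀ u ∈ ball (0 : ℂ) R, G u ≠ 0 := fun u hu => h0 _ (hsub u hu)
  -- A primitive `h` of `G' / G` with `h 0 = 0` is a holomorphic logarithm of `G / G 0`. The bounds
  -- `|G| ≤ 1` and `|G 0| ≥ δ` limit `Re h` from above, so Borel–Carathéodory limits `|h|`, and
  -- hence `Re h` from below.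
  obtain ⟨h, hh0, hh⟩ := ((hGd.deriv isOpen_ball).div hGd hG0).isExactOn_ball.with_val_at 0 0
  have hhd : DifferentiableOn ℂ h (ball 0 R) := fun u hu =>
    (hh u hu).differentiableAt.differentiableWithinAt
  have hconst : ∀ u ∈ ball (0 : ℂ) R, G u * Complex.exp (-h u) = G 0 := by
    intro u hu
    have hder : ∀ v ∈ ball (0 : ℂ) R,
        HasDerivAt (fun v => G v * Complex.exp (-h v)) 0 v := by
      intro v hv
      have h3 := (hGd.differentiableAt (isOpen_ball.mem_nhds hv)).hasDerivAt
      have h4 := h3.mul (hh v hv).neg.cexp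
      refine h4.congr_deriv ?_
      have := hG0 v hv
      simp only [Pi.div_apply, Pi.neg_apply]
      field_simp
      ring
    have h5 := (convex_ball (0 : ℂ) R).is_const_of_fderivWithin_eq_zero (𝕜 := ℂ)
      (f := fun v => G v * Complex.exp (-h v))
      (fun v hv => (hder v hv).differentiableAt.differentiableWithinAt)
      (fun v hv => by
        rw [fderivWithin_of_isOpen isOpen_ball hv]
        have := (hder v hv).hasFDerivAt.fderiv
        rw [this]; ext; simp) hu (mem_ball_self hR0)
    rw [h5, hh0]; simp
  have hGexp : ∀ u ∈ ball (0 : ℂ) R, ‖G u‖ = ‖g w‖ * Real.exp (h u).re := by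
    intro u hu
    have h6 : G u = G 0 * Complex.exp (h u) := by
      rw [← hconst u hu, mul_assoc, ← Complex.exp_add]; simp
    rw [h6, norm_mul, Complex.norm_exp]
    simp [hG]
  have hre : Set.MapsTo h (ball 0 R) {z | z.re ≤ M} := by
    intro u hu
    have h7 := h1 _ (hsub u hu)
    change ‖G u‖ ≤ 1 at h7
    rw [hGexp u hu] at h7
    have h8 : Real.exp (h u).re ≤ 1 / δ := by
      rw [le_div_iff₀ hδ, mul_comm]
      exact (mul_le_mul_of_nonneg_right hδw (Real.exp_pos _).le).trans h7
    have h9 := (Real.le_log_iff_exp_le (by positivity)).2 h8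
    simp only [Set.mem_ofPred_eq]
    linarith
  have hzw : ‖z - w‖ ≤ 1 + s := (norm_sub_le _ _).trans (by linarith)
  have hzw' : z - w ∈ ball (0 : ℂ) R := by rw [mem_ball_zero_iff]; linarith
  have hbc := Complex.borelCaratheodory_zero hM0 hhd hre hR0 hzw' hh0
  have hbc' : ‖h (z - w)‖ ≤ 2 * M * (1 + s) / (R - (1 + s)) := by
    refine hbc.trans ?_
    have : 0 < R - (1 + s) := by linarith
    gcongr
  have h10 := hGexp _ hzw'
  simp only [hG, add_sub_cancel] at h10
  rw [h10]
  gcongr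
  have := (abs_le.1 (Complex.abs_re_le_norm (h (z - w)))).1
  linarith

/-- The mean of `|g|²` over the unit circle. -/
noncomputable def circleSq (g : ℂ → ℂ) : ℝ≥0∞ :=
  ∫⁻ s : UnitAddCircle, ‖g (fourier 1 s)‖ₑ ^ 2 ∂AddCircle.haarAddCircle

theorem circleSq_mono {g h : ℂ → ℂ} {C : ℝ≥0} (H : ∀ e : ℂ, ‖e‖ = 1 → ‖g e‖ ≤ C * ‖h e‖) :
    circleSq g ≤ (C : ℝ≥0∞) ^ 2 * circleSq h := by
  rw [circleSq, circleSq, ← lintegral_const_mul' _ _ (by simp)]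
  refine lintegral_mono fun s => ?_
  simp only
  rw [← mul_pow]
  gcongr
  have := H _ (norm_fourier_apply 1 s)
  simp only [enorm_eq_nnnorm]
  exact_mod_cast this

/-- The quadratic mean over circles of a holomorphic function increases with the radius. -/
theorem circleSq_dilation_le {f : ℂ → ℂ} (hf : DifferentiableOn ℂ f (ball 0 1)) {t r : ℝ≥0}
    (ht : t < 1) (hr : r ≤ 1) :
    circleSq (fun e => f (r * t * e)) ≤ circleSq fun e => f (t * e) := by
  have hf' : DifferentiableOn ℂ (fun z : Fin 1 → ℂ => f (z 0)) (polydisk 1) :=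
    hf.comp (f := fun z : Fin 1 → ℂ => z 0) (by fun_prop) fun z hz => by simpa using hz 0
  obtain ⟨X, hX⟩ := exists_represents hf'
  have key : ∀ u : ℝ≥0, u < 1 → circleSq (fun e => f (u * e)) =
      ∑' α, (‖MvPowerSeries.coeff α X‖ₑ * radius (fun _ => u) α) ^ 2 := by
    intro u hu
    rw [← lintegral_enorm_ev_sq (hX.absNorm_ne_top fun _ => hu), circleSq, torusMeasure,
      ← (measurePreserving_funUnique AddCircle.haarAddCircle (Fin 1)).lintegral_comp_emb
        (MeasurableEquiv.measurableEmbedding _)]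
    refine lintegral_congr fun θ => ?_
    rw [hX.ev_eq]
    · simp [torusPoint]
    · intro i
      rw [← coe_nnnorm, nnnorm_torusPoint]; exact_mod_cast hu
  have h1 := key (r * t) ((mul_le_of_le_one_left zero_le hr).trans_lt ht)
  push_cast at h1
  rw [h1, key t ht]
  refine ENNReal.tsum_le_tsum fun α => ?_
  gcongr
  exact radius_mono (fun _ => mul_le_of_le_one_left zero_le hr) α

/-- The square of the pseudohyperbolic distance on the disc of radius `R` is bounded away from `1`
on compact sets. -/
theorem exists_blaschke_bound {R ρ s : ℝ} (hρ0 : 0 ≤ ρ) (hρ : ρ < R) (hs0 : 0 ≤ s) (hs : s < R) :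
    ∃ q : ℝ, 0 < q ∧ q < 1 ∧ ∀ a w : ℂ, ‖a‖ ≤ ρ → ‖w‖ ≤ s →
      R * ‖w - a‖ ≤ q * ‖(R : ℂ) ^ 2 - (starRingEnd ℂ) a * w‖ := by
  have hR : 0 < R := hρ0.trans_lt hρ
  -- By the identity `hid`, one minus the squared quotient is `(R² - |a|²)(R² - |w|²) / |R² - āw|²`.
  -- Since `|R² - āw| ≤ 2R²`, this is at least `κ`, and `q = √(1 - κ)`.
  set κ := (R ^ 2 - ρ ^ 2) * (R ^ 2 - s ^ 2) / (2 * R ^ 2) ^ 2 with hκ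
  have h1 : 0 < R ^ 2 - ρ ^ 2 := by nlinarith
  have h2 : 0 < R ^ 2 - s ^ 2 := by nlinarith
  have hκ0 : 0 < κ := by positivity
  have hκ1 : κ < 1 := by
    rw [hκ, div_lt_one (by positivity)]
    nlinarith [sq_nonneg ρ, sq_nonneg s, mul_pos (pow_pos hR 2) (pow_pos hR 2)]
  refine ⟨√(1 - κ), Real.sqrt_pos.2 (by linarith), ?_, fun a w ha hw => ?_⟩
  · rw [Real.sqrt_lt' one_pos]; linarith
  · have hid : ‖(R : ℂ) ^ 2 - (starRingEnd ℂ) a * w‖ ^ 2 - (R * ‖w - a‖) ^ 2 =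
        (R ^ 2 - ‖a‖ ^ 2) * (R ^ 2 - ‖w‖ ^ 2) := by
      have h3 : ((R : ℂ) ^ 2) = ((R ^ 2 : ℝ) : ℂ) := by push_cast; rfl
      rw [h3, mul_pow]
      simp only [← Complex.normSq_eq_norm_sq, Complex.normSq_apply, Complex.sub_re, Complex.sub_im,
        Complex.mul_re, Complex.mul_im, Complex.conj_re, Complex.conj_im, Complex.ofReal_re,
        Complex.ofReal_im]
      ring
    have hle : ‖(R : ℂ) ^ 2 - (starRingEnd ℂ) a * w‖ ≤ 2 * R ^ 2 := by
      refine (norm_sub_le _ _).trans ?_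
      rw [norm_mul, RCLike.norm_conj, norm_pow, Complex.norm_real, Real.norm_of_nonneg hR.le]
      have : ‖a‖ * ‖w‖ ≤ R * R := mul_le_mul (ha.trans hρ.le) (hw.trans hs.le) (norm_nonneg _) hR.le
      nlinarith
    have h4 : (R ^ 2 - ρ ^ 2) * (R ^ 2 - s ^ 2) ≤ (R ^ 2 - ‖a‖ ^ 2) * (R ^ 2 - ‖w‖ ^ 2) := by
      have h5 : ‖a‖ ^ 2 ≤ ρ ^ 2 := by gcongr
      have h6 : ‖w‖ ^ 2 ≤ s ^ 2 := by gcongr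
      exact mul_le_mul (by linarith) (by linarith) h2.le (by linarith)
    have h7 : κ * ‖(R : ℂ) ^ 2 - (starRingEnd ℂ) a * w‖ ^ 2 ≤
        (R ^ 2 - ρ ^ 2) * (R ^ 2 - s ^ 2) := by
      rw [hκ, div_mul_eq_mul_div, div_le_iff₀ (by positivity)]
      gcongr
    refine abs_le_of_sq_le_sq' ?_ (by positivity) |>.2
    rw [mul_pow √(1 - κ), Real.sq_sqrt (by linarith)]
    linarith

/-- The elementary estimate behind the removal of one zero. -/
theorem exists_replace_linear_factor {f : ℂ → ℂ} (hf : DifferentiableOn ℂ f (ball 0 1)) (a : ℂ)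
    {t r : ℝ≥0} (hr : r ≤ 1) : ∃ k : ℂ → ℂ, DifferentiableOn ℂ k (ball 0 1) ∧
      (∀ e : ℂ, ‖e‖ = 1 → ‖t * e - a‖ * ‖f (r * t * e)‖ ≤ 2 * ‖k (r * t * e)‖) ∧
      ∀ e : ℂ, ‖e‖ = 1 → ‖k (t * e)‖ = ‖t * e - a‖ * ‖f (t * e)‖ := by
  have hr' : (r : ℝ) ≤ 1 := by exact_mod_cast hr
  -- If `|a| ≥ t`, the factor `w - a` is kept: `|r t e - a| ≥ (1 - r) t`, so passing from `t e` to
  -- `r t e` loses at most a factor `2`. If `|a| < t`, that factor could vanish at `r t e`; it is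
  -- replaced by the reflected factor `t - ā w / t`, which has the same modulus on `|w| = t` and no
  -- zero in `|w| ≤ t`.
  rcases le_or_gt (t : ℝ) ‖a‖ with hta | hta
  · refine ⟨fun w => (w - a) * f w, by fun_prop, fun e he => ?_, fun e _ => norm_mul _ _⟩
    rw [norm_mul, ← mul_assoc]
    gcongr
    have h1 : (t * e - a : ℂ) = (r * t * e - a) + ((1 - r : ℝ) * t : ℝ) * e := by push_cast; ring
    have h2 : ‖(((1 - r : ℝ) * t : ℝ) * e : ℂ)‖ = (1 - r) * t := by
      rw [norm_mul, he, mul_one, Complex.norm_real, Real.norm_of_nonneg]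
      exact mul_nonneg (by linarith) t.2
    have h3 : ‖(t * e - a : ℂ)‖ ≤ ‖(r * t * e - a : ℂ)‖ + (1 - r) * t := by
      rw [h1]; exact (norm_add_le _ _).trans (by rw [h2])
    have h4 : ‖a‖ - r * t ≤ ‖(r * t * e - a : ℂ)‖ := by
      have := norm_sub_norm_le a (r * t * e : ℂ)
      rw [norm_sub_rev, norm_mul, he, norm_mul, Complex.norm_real, Complex.norm_real] at this
      simpa using this
    linarith
  · have ht0 : (0 : ℝ) < t := (norm_nonneg a).trans_lt hta
    have ht0' : (t : ℂ) ≠ 0 := by exact_mod_cast ht0.ne'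
    refine ⟨fun w => (t - (starRingEnd ℂ) a * (w / t)) * f w, by fun_prop, fun e he => ?_,
      fun e he => ?_⟩
    all_goals
      have hconj : ‖(t * e - a : ℂ)‖ = ‖(t - (starRingEnd ℂ) a * e : ℂ)‖ := by
        have h1 : (t * e - a : ℂ) = e * (starRingEnd ℂ) (t - (starRingEnd ℂ) a * e) := by
          simp only [map_sub, map_mul, Complex.conj_conj, Complex.conj_ofReal]
          have h2 : e * (starRingEnd ℂ) e = 1 := by
            rw [Complex.mul_conj, Complex.normSq_eq_norm_sq, he]; simp
          linear_combination (a : ℂ) * h2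
        rw [h1, norm_mul, he, one_mul, RCLike.norm_conj]
    · rw [norm_mul, ← mul_assoc, hconj]
      gcongr
      have h0 : (r * t * e / t : ℂ) = r * e := by field_simp
      rw [h0]
      have h1 : (t - (starRingEnd ℂ) a * e : ℂ) =
          (t - (starRingEnd ℂ) a * (r * e)) - ((1 - r : ℝ) : ℂ) * ((starRingEnd ℂ) a * e) := by
        push_cast; ring
      have h2 : ‖((1 - r : ℝ) : ℂ) * ((starRingEnd ℂ) a * e)‖ = (1 - r) * ‖a‖ := by
        rw [norm_mul, norm_mul, he, mul_one, RCLike.norm_conj, Complex.norm_real,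
          Real.norm_of_nonneg (by linarith)]
      have h3 : ‖(t - (starRingEnd ℂ) a * e : ℂ)‖ ≤
          ‖(t - (starRingEnd ℂ) a * (r * e) : ℂ)‖ + (1 - r) * ‖a‖ := by
        rw [h1]; exact (norm_sub_le _ _).trans (by rw [h2])
      have h4 : t - r * ‖a‖ ≤ ‖(t - (starRingEnd ℂ) a * (r * e) : ℂ)‖ := by
        have := norm_sub_norm_le (t : ℂ) ((starRingEnd ℂ) a * (r * e) : ℂ)
        rw [norm_mul, norm_mul, he, RCLike.norm_conj, Complex.norm_real, Complex.norm_real] at this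
        simp only [NNReal.norm_eq, mul_one] at this
        linarith
      linarith
    · rw [norm_mul, hconj, mul_div_cancel_left₀ _ ht0']

end

/-! ### The dilation estimate in one variable -/

section

/-- Division by a Blaschke factor of the disc of radius `R`. -/
theorem exists_eq_blaschke_mul {R : ℝ} (hR : 0 < R) {g : ℂ → ℂ}
    (hg : DifferentiableOn ℂ g (ball 0 R)) (hgc : ContinuousOn g (closedBall 0 R))
    (hg1 : ∀ z ∈ closedBall (0 : ℂ) R, ‖g z‖ ≤ 1) {a : ℂ} (ha : a ∈ ball (0 : ℂ) R)
    (hga : g a = 0) : ∃ g₁ : ℂ → ℂ, DifferentiableOn ℂ g₁ (ball 0 R) ∧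
      ContinuousOn g₁ (closedBall 0 R) ∧ (∀ z ∈ closedBall (0 : ℂ) R, ‖g₁ z‖ ≤ 1) ∧
      ∀ z : ℂ, g z * (R ^ 2 - (starRingEnd ℂ) a * z) = R * (z - a) * g₁ z := by
  set g₁ : ℂ → ℂ := fun z => dslope g a z * ((R ^ 2 - (starRingEnd ℂ) a * z) / R) with hg₁
  have hnhds : ball (0 : ℂ) R ∈ 𝓝 a := isOpen_ball.mem_nhds ha
  have hR' : (R : ℂ) ≠ 0 := by exact_mod_cast hR.ne'
  have hd : DifferentiableOn ℂ g₁ (ball 0 R) :=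
    ((Complex.differentiableOn_dslope hnhds).2 hg).mul (by fun_prop)
  have hc : ContinuousOn g₁ (closedBall 0 R) :=
    ((continuousOn_dslope (mem_of_superset hnhds ball_subset_closedBall)).2
      ⟨hgc, hg.differentiableAt hnhds⟩).mul (by fun_prop)
  have hid : ∀ z : ℂ, g z * (R ^ 2 - (starRingEnd ℂ) a * z) = R * (z - a) * g₁ z := by
    intro z
    have h1 : (z - a) * dslope g a z = g z := by
      rw [← smul_eq_mul, sub_smul_dslope, hga, sub_zero]
    rw [← h1, hg₁]
    field_simp
  refine ⟨g₁, hd, hc, fun z hz => ?_, hid⟩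
  have hcl : closure (ball (0 : ℂ) R) = closedBall 0 R := closure_ball 0 hR.ne'
  -- The Blaschke factor has modulus `1` on `|w| = R`, so `|g₁| = |g|` there and the maximum
  -- principle carries the bound inside.
  refine Complex.norm_le_of_forall_mem_frontier_norm_le (U := ball 0 R) isBounded_ball
    ⟨hd, by rwa [hcl]⟩ (fun w hw => ?_) (by rwa [hcl])
  rw [frontier_ball 0 hR.ne', mem_sphere_zero_iff_norm] at hw
  have h2 : ‖(R ^ 2 - (starRingEnd ℂ) a * w : ℂ)‖ = R * ‖w - a‖ := by
    have h3 : (R ^ 2 - (starRingEnd ℂ) a * w : ℂ) = w * (starRingEnd ℂ) (w - a) := by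
      have h4 : w * (starRingEnd ℂ) w = R ^ 2 := by
        rw [Complex.mul_conj, Complex.normSq_eq_norm_sq, hw]; norm_cast
      rw [map_sub]
      linear_combination -h4
    rw [h3, norm_mul, hw, RCLike.norm_conj]
  have hwa : 0 < ‖w - a‖ := by
    rw [norm_sub_pos_iff]
    rintro rfl
    rw [mem_ball_zero_iff] at ha
    linarith
  have h5 := congrArg norm (hid w)
  rw [norm_mul, h2, norm_mul, norm_mul, Complex.norm_real, Real.norm_of_nonneg hR.le] at h5
  have h6 : ‖g w‖ = ‖g₁ w‖ := by
    have : 0 < R * ‖w - a‖ := by positivity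
    nlinarith
  rw [← h6]
  exact hg1 w (by rw [mem_closedBall_zero_iff]; exact hw.le)

/-- The dilation estimate for functions that are not too small at some point. -/
theorem exists_circleSq_mul_dilation_le_of_pow {R ρ s q : ℝ} (hρ1 : 1 < ρ) (hρ : ρ < R)
    (hs0 : 0 ≤ s) (hs : s < (ρ - 1) / 2) (hq0 : 0 < q) (hq1 : q < 1)
    (hq : ∀ a w : ℂ, ‖a‖ ≤ ρ → ‖w‖ ≤ s →
      R * ‖w - a‖ ≤ q * ‖(R : ℂ) ^ 2 - (starRingEnd ℂ) a * w‖) (N : ℕ) :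
    ∃ K : ℝ≥0, ∀ g : ℂ → ℂ, DifferentiableOn ℂ g (ball 0 R) → ContinuousOn g (closedBall 0 R) →
      (∀ z ∈ closedBall (0 : ℂ) R, ‖g z‖ ≤ 1) → ∀ w : ℂ, ‖w‖ ≤ s → q ^ N ≤ ‖g w‖ →
      ∀ f : ℂ → ℂ, DifferentiableOn ℂ f (ball 0 1) → ∀ t r : ℝ≥0, t < 1 → r ≤ 1 →
        circleSq (fun e => g (t * e) * f (r * t * e)) ≤
          K * circleSq fun e => g (t * e) * f (t * e) := by
  have hR0 : 0 < R := by linarith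
  have hte : ∀ t : ℝ≥0, t < 1 → ∀ e : ℂ, ‖e‖ = 1 → ‖(t * e : ℂ)‖ ≤ 1 := fun t ht e he => by
    rw [norm_mul, he, mul_one, Complex.norm_real]
    simpa using ht.le
  -- the zero-free case
  have hfree : ∀ N : ℕ, ∃ K : ℝ≥0, ∀ g : ℂ → ℂ, DifferentiableOn ℂ g (ball 0 R) →
      (∀ z ∈ closedBall (0 : ℂ) R, ‖g z‖ ≤ 1) → ∀ w : ℂ, ‖w‖ ≤ s → q ^ N ≤ ‖g w‖ →
      (∀ z ∈ ball (0 : ℂ) ρ, g z ≠ 0) →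
      ∀ f : ℂ → ℂ, DifferentiableOn ℂ f (ball 0 1) → ∀ t r : ℝ≥0, t < 1 → r ≤ 1 →
        circleSq (fun e => g (t * e) * f (r * t * e)) ≤
          K * circleSq fun e => g (t * e) * f (t * e) := by
    intro N
    obtain ⟨c, hc, hcg⟩ := exists_le_norm_of_ne_zero hs0 hs (pow_pos hq0 N)
    refine ⟨(c⁻¹.toNNReal) ^ 2, fun g hg hg1 w hw hqw h0 f hf t r ht hr => ?_⟩
    have hlow := hcg g (hg.mono (ball_subset_ball hρ.le)) h0 (fun z hz => hg1 z
      ((ball_subset_ball hρ.le).trans ball_subset_closedBall hz)) w hw hqw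
    calc circleSq (fun e => g (t * e) * f (r * t * e))
        ≤ ((1 : ℝ≥0) : ℝ≥0∞) ^ 2 * circleSq fun e => f (r * t * e) :=
          circleSq_mono fun e he => by
            rw [norm_mul, NNReal.coe_one]
            gcongr
            exact hg1 _ (by
              rw [mem_closedBall_zero_iff]; exact (hte t ht e he).trans (by linarith))
      _ ≤ circleSq fun e => f (t * e) := by
          simpa using circleSq_dilation_le hf ht hr
      _ ≤ _ := by
          rw [ENNReal.coe_pow]
          refine circleSq_mono fun e he => ?_
          rw [norm_mul, Real.coe_toNNReal _ (by positivity), ← mul_assoc]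
          refine le_mul_of_one_le_left (norm_nonneg _) ?_
          rw [inv_mul_eq_div, one_le_div hc]
          exact hlow _ (hte t ht e he)
  -- lower bound for the values of the Blaschke quotient
  have hstep : ∀ g : ℂ → ℂ, DifferentiableOn ℂ g (ball 0 R) → ContinuousOn g (closedBall 0 R) →
      (∀ z ∈ closedBall (0 : ℂ) R, ‖g z‖ ≤ 1) → ∀ a ∈ ball (0 : ℂ) ρ, g a = 0 →
      ∃ g₁ : ℂ → ℂ, DifferentiableOn ℂ g₁ (ball 0 R) ∧
      ContinuousOn g₁ (closedBall 0 R) ∧ (∀ z ∈ closedBall (0 : ℂ) R, ‖g₁ z‖ ≤ 1) ∧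
      (∀ z : ℂ, g z * (R ^ 2 - (starRingEnd ℂ) a * z) = R * (z - a) * g₁ z) ∧
      ∀ w : ℂ, ‖w‖ ≤ s → ‖g w‖ ≤ q * ‖g₁ w‖ := by
    intro g hg hgc hg1 a ha hga
    obtain ⟨g₁, h1, h2, h3, h4⟩ :=
      exists_eq_blaschke_mul hR0 hg hgc hg1 (ball_subset_ball hρ.le ha) hga
    refine ⟨g₁, h1, h2, h3, h4, fun w hw => ?_⟩
    rw [mem_ball_zero_iff] at ha
    have h5 := congrArg norm (h4 w)
    rw [norm_mul, norm_mul, norm_mul, Complex.norm_real, Real.norm_of_nonneg hR0.le] at h5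
    have h6 := hq a w ha.le hw
    have h7 : 0 < ‖(R ^ 2 - (starRingEnd ℂ) a * w : ℂ)‖ := by
      have h8 : ‖a‖ * ‖w‖ < R ^ 2 := by
        have : ‖a‖ * ‖w‖ ≤ ρ * s := mul_le_mul ha.le hw (norm_nonneg _) (by linarith)
        nlinarith
      have h9 := norm_sub_norm_le ((R : ℂ) ^ 2) ((starRingEnd ℂ) a * w)
      rw [norm_pow, Complex.norm_real, Real.norm_of_nonneg hR0.le, norm_mul,
        RCLike.norm_conj] at h9
      linarith
    have h10 : ‖g w‖ * ‖(R ^ 2 - (starRingEnd ℂ) a * w : ℂ)‖ ≤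
        (q * ‖g₁ w‖) * ‖(R ^ 2 - (starRingEnd ℂ) a * w : ℂ)‖ := by
      rw [h5, mul_right_comm q]
      gcongr
    exact le_of_mul_le_mul_right h10 h7
  -- `N` limits the number of zeros in `|a| < ρ` to be removed: each division raises the value at
  -- `w` by a factor at least `1 / q`, while the quotients remain bounded by `1`. For `N = 0` a zero
  -- would give `1 ≤ q`.
  induction N with
  | zero =>
    obtain ⟨K, hK⟩ := hfree 0
    refine ⟨K, fun g hg hgc hg1 w hw hqw => hK g hg hg1 w hw hqw fun a ha hga => ?_⟩
    obtain ⟨g₁, -, -, h3, -, h5⟩ := hstep g hg hgc hg1 a ha hga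
    have h6 := h5 w hw
    have h7 := h3 w (by rw [mem_closedBall_zero_iff]; linarith)
    rw [pow_zero] at hqw
    nlinarith
  | succ N ih =>
    obtain ⟨K, hK⟩ := ih
    obtain ⟨K', hK'⟩ := hfree (N + 1)
    have hRρ : 0 < R ^ 2 - ρ := by nlinarith
    set u : ℝ≥0 := (R / (R ^ 2 - ρ)).toNNReal with hu
    set v : ℝ≥0 := (2 * R).toNNReal with hv
    refine ⟨max K' (u ^ 2 * 2 ^ 2 * K * v ^ 2), fun g hg hgc hg1 w hw hqw f hf t r ht hr => ?_⟩
    by_cases h0 : ∀ z ∈ ball (0 : ℂ) ρ, g z ≠ 0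
    · refine (hK' g hg hg1 w hw hqw h0 f hf t r ht hr).trans ?_
      gcongr
      exact le_max_left _ _
    push Not at h0
    obtain ⟨a, ha, hga⟩ := h0
    obtain ⟨g₁, h1, h2, h3, h4, h5⟩ := hstep g hg hgc hg1 a ha hga
    rw [mem_ball_zero_iff] at ha
    have hqw' : q ^ N ≤ ‖g₁ w‖ := by
      have := hqw.trans (h5 w hw)
      rw [pow_succ'] at this
      exact le_of_mul_le_mul_left this hq0
    -- The zero of `g` is moved into the other factor: the pair `(g, f)` becomes `(g₁, k)`, to which
    -- the induction hypothesis applies. That `k` depends on `t` is harmless, because the hypothesis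
    -- is uniform in `f`.
    obtain ⟨k, hk, hk1, hk2⟩ := exists_replace_linear_factor hf a (t := t) hr
    -- bounds for the denominator of the Blaschke factor on the unit disc
    have hden : ∀ z : ℂ, ‖z‖ ≤ 1 → R ^ 2 - ρ ≤ ‖(R ^ 2 - (starRingEnd ℂ) a * z : ℂ)‖ ∧
        ‖(R ^ 2 - (starRingEnd ℂ) a * z : ℂ)‖ ≤ 2 * R ^ 2 := by
      intro z hz
      have h8 : ‖a‖ * ‖z‖ ≤ ρ * 1 := mul_le_mul ha.le hz (norm_nonneg _) (by linarith)
      constructor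
      · have h9 := norm_sub_norm_le ((R : ℂ) ^ 2) ((starRingEnd ℂ) a * z)
        rw [norm_pow, Complex.norm_real, Real.norm_of_nonneg hR0.le, norm_mul,
          RCLike.norm_conj] at h9
        linarith
      · have h9 := norm_sub_le ((R : ℂ) ^ 2) ((starRingEnd ℂ) a * z)
        rw [norm_pow, Complex.norm_real, Real.norm_of_nonneg hR0.le, norm_mul,
          RCLike.norm_conj] at h9
        nlinarith
    have hgn : ∀ z : ℂ, ‖g z‖ * ‖(R ^ 2 - (starRingEnd ℂ) a * z : ℂ)‖ =
        R * ‖z - a‖ * ‖g₁ z‖ := fun z => by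
      have h8 := congrArg norm (h4 z)
      rwa [norm_mul, norm_mul, norm_mul, Complex.norm_real, Real.norm_of_nonneg hR0.le] at h8
    calc circleSq (fun e => g (t * e) * f (r * t * e))
        ≤ (u : ℝ≥0∞) ^ 2 * circleSq fun e => (t * e - a) * f (r * t * e) * g₁ (t * e) := by
          refine circleSq_mono fun e he => ?_
          rw [norm_mul, norm_mul, norm_mul, hu, Real.coe_toNNReal _ (by positivity)]
          have h8 := hgn (t * e)
          have h9 := (hden _ (hte t ht e he)).1
          have h10 : ‖g (t * e)‖ ≤ R / (R ^ 2 - ρ) * (‖(t * e - a : ℂ)‖ * ‖g₁ (t * e)‖) := by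
            rw [div_mul_eq_mul_div, le_div_iff₀ hRρ, ← mul_assoc, ← h8]
            gcongr
          calc _ ≤ (R / (R ^ 2 - ρ) * (‖(t * e - a : ℂ)‖ * ‖g₁ (t * e)‖)) *
                ‖f (r * t * e)‖ := by gcongr
            _ = _ := by ring
      _ ≤ (u : ℝ≥0∞) ^ 2 * (((2 : ℝ≥0) : ℝ≥0∞) ^ 2 *
            circleSq fun e => g₁ (t * e) * k (r * t * e)) := by
          gcongr
          refine circleSq_mono fun e he => ?_
          have h8 := mul_le_mul_of_nonneg_right (hk1 e he) (norm_nonneg (g₁ (t * e)))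
          rw [norm_mul, norm_mul, norm_mul]
          refine h8.trans (le_of_eq ?_)
          push_cast; ring
      _ ≤ (u : ℝ≥0∞) ^ 2 * (((2 : ℝ≥0) : ℝ≥0∞) ^ 2 *
            (K * circleSq fun e => g₁ (t * e) * k (t * e))) := by
          gcongr
          exact hK g₁ h1 h2 h3 w hw hqw' k hk t r ht hr
      _ ≤ (u : ℝ≥0∞) ^ 2 * (((2 : ℝ≥0) : ℝ≥0∞) ^ 2 *
            (K * ((v : ℝ≥0∞) ^ 2 * circleSq fun e => g (t * e) * f (t * e)))) := by
          gcongr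
          refine circleSq_mono fun e he => ?_
          rw [norm_mul, norm_mul, hk2 e he, hv, Real.coe_toNNReal _ (by positivity), ← mul_assoc,
            ← mul_assoc]
          have h8 := hgn (t * e)
          have h9 := (hden _ (hte t ht e he)).2
          have h10 : R * (‖g₁ (t * e)‖ * ‖(t * e - a : ℂ)‖) ≤ R * (2 * R * ‖g (t * e)‖) := by
            calc _ = ‖g (t * e)‖ * ‖(R ^ 2 - (starRingEnd ℂ) a * (t * e) : ℂ)‖ := by
                  rw [h8]; ring
              _ ≤ ‖g (t * e)‖ * (2 * R ^ 2) := by gcongr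
              _ = _ := by ring
          exact mul_le_mul_of_nonneg_right (le_of_mul_le_mul_left h10 hR0) (norm_nonneg _)
      _ = ((u ^ 2 * 2 ^ 2 * K * v ^ 2 : ℝ≥0) : ℝ≥0∞) *
            circleSq fun e => g (t * e) * f (t * e) := by
          push_cast; ring
      _ ≤ _ := by
          gcongr
          exact le_max_right _ _

/-- The dilation estimate in one variable, with a constant that depends only on the doubling
constant. -/
theorem exists_circleSq_mul_dilation_le {R s : ℝ} (hR : 1 < R) (hs0 : 0 ≤ s)
    (hs : s < (R - 1) / 4) (C : ℝ) : ∃ K : ℝ≥0, ∀ g : ℂ → ℂ, DifferentiableOn ℂ g (ball 0 R) →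
      ContinuousOn g (closedBall 0 R) →
      (∀ M : ℝ, (∀ w : ℂ, ‖w‖ ≤ s → ‖g w‖ ≤ M) → ∀ w : ℂ, ‖w‖ ≤ R → ‖g w‖ ≤ C * M) →
      ∀ f : ℂ → ℂ, DifferentiableOn ℂ f (ball 0 1) → ∀ t r : ℝ≥0, t < 1 → r ≤ 1 →
        circleSq (fun e => g (t * e) * f (r * t * e)) ≤
          K * circleSq fun e => g (t * e) * f (t * e) := by
  have hR0 : 0 < R := by linarith
  set ρ := (R + 1) / 2 with hρ
  obtain ⟨q, hq0, hq1, hq⟩ := exists_blaschke_bound (R := R) (ρ := ρ) (s := s) (by linarith)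
    (by linarith) hs0 (by linarith)
  set D := max C 1 with hD
  have hD0 : 0 < D := lt_of_lt_of_le one_pos (le_max_right _ _)
  obtain ⟨N, hN⟩ := exists_pow_lt_of_lt_one (show 0 < 1 / D by positivity) hq1
  obtain ⟨K, hK⟩ := exists_circleSq_mul_dilation_le_of_pow (R := R) (ρ := ρ) (by linarith)
    (by linarith) hs0 (by linarith) hq0 hq1 hq N
  refine ⟨K, fun g hg hgc hdoub f hf t r ht hr => ?_⟩
  have hcs : IsCompact (closedBall (0 : ℂ) s) := isCompact_closedBall _ _
  obtain ⟨w, hw, hmax⟩ := hcs.exists_isMaxOn ⟨0, by simpa using hs0⟩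
    ((hgc.mono (closedBall_subset_closedBall (by linarith))).norm)
  rw [mem_closedBall_zero_iff] at hw
  have hb : ∀ z : ℂ, ‖z‖ ≤ R → ‖g z‖ ≤ D * ‖g w‖ := fun z hz =>
    (hdoub ‖g w‖ (fun x hx => hmax (by simpa using hx)) z hz).trans
      (by gcongr; exact le_max_left _ _)
  have hte : ∀ e : ℂ, ‖e‖ = 1 → ‖(t * e : ℂ)‖ ≤ 1 := fun e he => by
    rw [norm_mul, he, mul_one, Complex.norm_real]
    simpa using ht.le
  -- Slices that vanish identically must be allowed. If the maximum over the small disc is `0`,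
  -- doubling forces `g = 0` on the large one.
  rcases eq_or_ne (g w) 0 with h0 | h0
  · have h1 : circleSq (fun e => g (t * e) * f (r * t * e)) ≤ ((0 : ℝ≥0) : ℝ≥0∞) ^ 2 *
        circleSq fun e => f (r * t * e) := circleSq_mono fun e he => by
      have := hb (t * e) ((hte e he).trans hR.le)
      rw [h0, norm_zero, mul_zero] at this
      rw [norm_mul, le_antisymm this (norm_nonneg _)]
      simp
    refine h1.trans ?_
    simp
  · have hgw : 0 < ‖g w‖ := norm_pos_iff.2 h0
    -- This normalization makes the supremum at most `1` and the modulus at `w` equal to `1 / D`,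
    -- which exceeds `q ^ N`.
    set c : ℂ := (((D * ‖g w‖)⁻¹ : ℝ) : ℂ) with hc
    have hcn : ‖c‖ = (D * ‖g w‖)⁻¹ := by
      rw [hc, Complex.norm_real, Real.norm_of_nonneg (by positivity)]
    have h1 := hK (fun z => c * g z) (hg.const_mul c) (hgc.const_mul c) (fun z hz => by
        rw [mem_closedBall_zero_iff] at hz
        rw [norm_mul, hcn, inv_mul_le_iff₀ (by positivity), mul_one]
        exact hb z hz) w hw (by
        rw [norm_mul, hcn]
        refine hN.le.trans (le_of_eq ?_)
        field_simp) f hf t r ht hr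
    have h2 : ∀ h : ℂ → ℂ, circleSq (fun e => c * g (t * e) * h e) =
        ‖c‖ₑ ^ 2 * circleSq fun e => g (t * e) * h e := by
      intro h
      rw [circleSq, circleSq, ← lintegral_const_mul' _ _ (by simp)]
      refine lintegral_congr fun s => ?_
      rw [← mul_pow, mul_assoc, enorm_mul]
    rw [h2 fun e => f (r * t * e), h2 fun e => f (t * e), mul_left_comm] at h1
    have hc0 : ‖c‖ₑ ^ 2 ≠ 0 := by
      have : c ≠ 0 := by rw [← norm_pos_iff, hcn]; positivity
      simpa using this
    exact (ENNReal.mul_le_mul_iff_right hc0 (by simp)).1 h1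

end

/-! ### The dilation estimate on polycircles -/

section

variable {n : ℕ}

instance : (torusMeasure n).IsAddLeftInvariant := by
  unfold torusMeasure; infer_instance

/-- Invariance of Haar measure: averaging over rotations of one coordinate changes nothing, so an
estimate on the torus follows from a uniform estimate on each coordinate circle. -/
theorem lintegral_torus_rotate (i : Fin n) {H : UnitAddTorus (Fin n) → ℝ≥0∞} (hH : Measurable H) :
    ∫⁻ θ, H θ ∂torusMeasure n =
      ∫⁻ θ, ∫⁻ s, H (Pi.single i s + θ) ∂AddCircle.haarAddCircle ∂torusMeasure n := by
  rw [lintegral_lintegral_swap]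
  · simp only [lintegral_add_left_eq_self]
    simp
  · have : Measurable fun p : UnitAddTorus (Fin n) × UnitAddCircle =>
        (Pi.single i p.2 + p.1 : UnitAddTorus (Fin n)) := by
      refine measurable_pi_iff.2 fun j => ?_
      simp only [Pi.add_apply]
      by_cases hj : j = i
      · subst hj; simp only [Pi.single_eq_same]; fun_prop
      · simp only [Pi.single_eq_of_ne hj]; fun_prop
    exact (hH.comp this).aemeasurable

theorem torusPoint_rotate (i : Fin n) (t : Fin n → ℝ≥0) (θ : UnitAddTorus (Fin n))
    (s : UnitAddCircle) : torusPoint t (Pi.single i s + θ) =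
      Function.update (torusPoint t θ) i (t i * fourier 1 s * fourier 1 (θ i)) := by
  ext j
  by_cases hj : j = i
  · subst hj
    simp only [torusPoint, Pi.add_apply, Pi.single_eq_same, Function.update_self, fourier_apply,
      one_smul, AddCircle.toCircle_add, Circle.coe_mul]
    ring
  · simp [torusPoint, hj]

theorem torusPoint_mem_polydisk {t : Fin n → ℝ≥0} (ht : ∀ i, t i < 1)
    (θ : UnitAddTorus (Fin n)) : torusPoint t θ ∈ polydisk n := fun i => by
  rw [← coe_nnnorm, nnnorm_torusPoint]; exact_mod_cast ht i

theorem differentiable_update (z : Fin n → ℂ) (i : Fin n) (u : ℂ) :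
    Differentiable ℂ fun w : ℂ => Function.update z i (w * u) := by
  refine differentiable_pi.2 fun j => ?_
  by_cases hj : j = i
  · subst hj; simp only [Function.update_self]; fun_prop
  · simp only [Function.update_of_ne hj]; fun_prop

theorem update_mem_polydisk {z : Fin n → ℂ} (hz : z ∈ polydisk n) {i : Fin n} {w : ℂ}
    (hw : ‖w‖ < 1) : Function.update z i w ∈ polydisk n := fun j => by
  by_cases hj : j = i
  · subst hj; simpa using hw
  · simpa [hj] using hz j

/-- The dilation estimate on polycircles for the dilation of one coordinate. -/
theorem exists_torus_dilation_coord_le {φ : (Fin n → ℂ) → ℂ} {U : Set (Fin n → ℂ)} (hU : IsOpen U)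
    (hφ : DifferentiableOn ℂ φ U) {R : ℝ} (hR : 1 < R) (hRU : {z | ∀ i, ‖z i‖ ≤ R} ⊆ U)
    (i : Fin n) : ∃ K : ℝ≥0, ∀ f : (Fin n → ℂ) → ℂ, DifferentiableOn ℂ f (polydisk n) →
      ∀ (t : Fin n → ℝ≥0) (r : ℝ≥0), (∀ i, t i < 1) → r ≤ 1 →
        ∫⁻ θ, ‖φ (torusPoint t θ) * f (Function.update (torusPoint t θ) i
          (r * torusPoint t θ i))‖ₑ ^ 2 ∂torusMeasure n ≤
        K * ∫⁻ θ, ‖φ (torusPoint t θ) * f (torusPoint t θ)‖ₑ ^ 2 ∂torusMeasure n := by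
  obtain ⟨s, hs0, hs⟩ := exists_between (show 0 < (R - 1) / 4 by linarith)
  obtain ⟨C, -, hC⟩ := exists_doubling_slices hU hφ i hRU hs0
  obtain ⟨K, hK⟩ := exists_circleSq_mul_dilation_le hR hs0.le hs C
  refine ⟨K, fun f hf t r ht hr => ?_⟩
  have hDU : polydisk n ⊆ U := fun z hz => hRU fun i => ((hz i).le.trans hR.le)
  have hr1 : (r : ℝ) ≤ 1 := by exact_mod_cast hr
  have hupd : ∀ θ, Function.update (torusPoint t θ) i (r * torusPoint t θ i) ∈ polydisk n :=
    fun θ => by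
      have h1 := torusPoint_mem_polydisk ht θ
      refine update_mem_polydisk h1 ?_
      rw [norm_mul, Complex.norm_real, NNReal.norm_eq]
      exact (mul_le_of_le_one_left (norm_nonneg _) hr1).trans_lt (h1 i)
  have hc : Continuous fun θ => φ (torusPoint t θ) :=
    (hφ.continuousOn.mono hDU).comp_continuous (continuous_torusPoint t)
      (torusPoint_mem_polydisk ht)
  have hcf : Continuous fun θ => f (torusPoint t θ) :=
    hf.continuousOn.comp_continuous (continuous_torusPoint t) (torusPoint_mem_polydisk ht)
  have hcf' : Continuous fun θ => f (Function.update (torusPoint t θ) i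
      (r * torusPoint t θ i)) := by
    refine hf.continuousOn.comp_continuous ?_ hupd
    have := continuous_torusPoint t
    exact this.update i (by fun_prop)
  have e1 := lintegral_torus_rotate i
    (H := fun θ => ‖φ (torusPoint t θ) * f (Function.update (torusPoint t θ) i
      (r * torusPoint t θ i))‖ₑ ^ 2) ((hc.mul hcf').measurable.enorm.pow_const 2)
  have e2 := lintegral_torus_rotate i
    (H := fun θ => ‖φ (torusPoint t θ) * f (torusPoint t θ)‖ₑ ^ 2)
    ((hc.mul hcf).measurable.enorm.pow_const 2)
  rw [e1, e2, ← lintegral_const_mul' _ _ ENNReal.coe_ne_top]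
  refine lintegral_mono fun θ => ?_
  set z := torusPoint t θ with hz
  set u : ℂ := fourier 1 (θ i) with hu
  have hun : ‖u‖ = 1 := norm_fourier_apply 1 (θ i)
  have hzD : z ∈ polydisk n := torusPoint_mem_polydisk ht θ
  have hgd : DifferentiableOn ℂ (fun w : ℂ => φ (Function.update z i (w * u)))
      (closedBall 0 R) := by
    refine hφ.comp (differentiable_update z i u).differentiableOn fun w hw => hRU fun j => ?_
    by_cases hj : j = i
    · subst hj; simpa [hun] using hw
    · simpa [hj] using (hzD j).le.trans hR.le
  have h1 := hK (fun w => φ (Function.update z i (w * u))) (hgd.mono ball_subset_closedBall)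
    hgd.continuousOn (fun M hM w hw => by
      refine hC z (fun j => (hzD j).le.trans hR.le) M (fun w hw => ?_) (w * u) (by
        rw [norm_mul, hun, mul_one]; exact hw)
      have hu0 : u ≠ 0 := by rw [← norm_pos_iff, hun]; exact one_pos
      have := hM (w / u) (by rw [norm_div, hun, div_one]; exact hw)
      rwa [div_mul_cancel₀ _ hu0] at this)
    (fun w => f (Function.update z i (w * u)))
    (hf.comp (differentiable_update z i u).differentiableOn fun w hw =>
      update_mem_polydisk hzD (by rw [norm_mul, hun, mul_one]; simpa using hw))
    (t i) r (ht i) hr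
  simp only [circleSq] at h1
  simp only [torusPoint_rotate, ← hz, ← hu, Function.update_idem, Function.update_self]
  convert h1 using 6
  ring_nf

/-- The dilation estimate on polycircles. -/
theorem exists_torus_dilation_le {φ : (Fin n → ℂ) → ℂ} {U : Set (Fin n → ℂ)} (hU : IsOpen U)
    (hφ : DifferentiableOn ℂ φ U) {R : ℝ} (hR : 1 < R) (hRU : {z | ∀ i, ‖z i‖ ≤ R} ⊆ U) :
    ∃ K : ℝ≥0, ∀ f : (Fin n → ℂ) → ℂ, DifferentiableOn ℂ f (polydisk n) →
      ∀ (t : Fin n → ℝ≥0) (r : ℝ≥0), (∀ i, t i < 1) → r ≤ 1 →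
        ∫⁻ θ, ‖φ (torusPoint t θ) * f (fun i => r * torusPoint t θ i)‖ₑ ^ 2 ∂torusMeasure n ≤
        K * ∫⁻ θ, ‖φ (torusPoint t θ) * f (torusPoint t θ)‖ₑ ^ 2 ∂torusMeasure n := by
  classical
  -- The coordinates are dilated one at a time. With those in `S` dilated, `f` is again holomorphic
  -- on the polydisk, so the estimate for one more coordinate applies to it and the constants
  -- multiply.
  have key : ∀ S : Finset (Fin n), ∃ K : ℝ≥0, ∀ f : (Fin n → ℂ) → ℂ,
      DifferentiableOn ℂ f (polydisk n) →
      ∀ (t : Fin n → ℝ≥0) (r : ℝ≥0), (∀ i, t i < 1) → r ≤ 1 →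
        ∫⁻ θ, ‖φ (torusPoint t θ) * f (fun i => if i ∈ S then r * torusPoint t θ i else
          torusPoint t θ i)‖ₑ ^ 2 ∂torusMeasure n ≤
        K * ∫⁻ θ, ‖φ (torusPoint t θ) * f (torusPoint t θ)‖ₑ ^ 2 ∂torusMeasure n := by
    intro S
    induction S using Finset.induction_on with
    | empty => exact ⟨1, fun f _ t r _ _ => by simp⟩
    | insert i S hi ih =>
      obtain ⟨K, hK⟩ := ih
      obtain ⟨K', hK'⟩ := exists_torus_dilation_coord_le hU hφ hR hRU i
      refine ⟨K' * K, fun f hf t r ht hr => ?_⟩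
      have hr1 : (r : ℝ) ≤ 1 := by exact_mod_cast hr
      have hd : DifferentiableOn ℂ (fun z : Fin n → ℂ => f fun j => if j ∈ S then r * z j else z j)
          (polydisk n) := by
        refine hf.comp (f := fun z : Fin n → ℂ => fun j => if j ∈ S then r * z j else z j) ?_
          fun z hz j => ?_
        · refine differentiableOn_pi.2 fun j => ?_
          split_ifs <;> fun_prop
        · simp only
          split_ifs
          · rw [norm_mul, Complex.norm_real, NNReal.norm_eq]
            exact (mul_le_of_le_one_left (norm_nonneg _) hr1).trans_lt (hz j)
          · exact hz j
      have h1 := hK' _ hd t r ht hr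
      rw [ENNReal.coe_mul, mul_assoc]
      refine le_trans (le_of_eq (lintegral_congr fun θ => ?_))
        (h1.trans (mul_le_mul_right (hK f hf t r ht hr) _))
      congr 4
      ext j
      by_cases hj : j = i
      · subst hj; simp [hi]
      · simp [hj]
  simpa using key Finset.univ

end

/-! ### The weights: summability and moment measures -/

section

variable {n : ℕ}

/-- The squared norm of the monomial `ζ ^ k` in the one-variable space with parameter `b`. -/
noncomputable def monomialWeight (b : ℝ) (k : ℕ) : ℝ :=
  (Nat.factorial k : ℝ) * Real.Gamma (b + 2) / Real.Gamma ((k : ℝ) + b + 2)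

theorem weight_eq (β : Fin n → Set.Ici (-1 : ℝ)) (α : Fin n →₀ ℕ) :
    weight β α = ∏ i, monomialWeight (β i) (α i) := rfl

theorem monomialWeight_pos {b : ℝ} (hb : -1 ≤ b) (k : ℕ) : 0 < monomialWeight b k := by
  have h1 := Real.Gamma_pos_of_pos (show 0 < b + 2 by linarith)
  have h2 := Real.Gamma_pos_of_pos (show 0 < (k : ℝ) + b + 2 by
    have : (0 : ℝ) ≤ k := Nat.cast_nonneg _
    linarith)
  unfold monomialWeight
  positivity

theorem monomialWeight_succ {b : ℝ} (hb : -1 ≤ b) (k : ℕ) :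
    monomialWeight b (k + 1) = monomialWeight b k * (((k : ℝ) + 1) / (k + (b + 2))) := by
  have h0 : (0 : ℝ) < k + b + 2 := by
    have : (0 : ℝ) ≤ k := Nat.cast_nonneg _
    linarith
  have h2 := Real.Gamma_pos_of_pos h0
  have h3 : Real.Gamma (((k + 1 : ℕ) : ℝ) + b + 2) = (k + b + 2) * Real.Gamma (k + b + 2) := by
    rw [← Real.Gamma_add_one h0.ne']
    congr 1
    push_cast
    ring
  rw [monomialWeight, monomialWeight, h3, Nat.factorial_succ, ← add_assoc]
  push_cast
  field_simp

theorem summable_pow_div_monomialWeight {b : ℝ} (hb : -1 ≤ b) {x : ℝ} (hx0 : 0 < x) (hx : x < 1) :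
    Summable fun k => x ^ k / monomialWeight b k := by
  have hw := monomialWeight_pos hb
  refine summable_of_ratio_test_tendsto_lt_one hx (.of_forall fun k =>
    (div_pos (pow_pos hx0 k) (hw k)).ne') ?_
  have h1 : Tendsto (fun k : ℕ => ((k : ℝ) + 1) / (k + (b + 2))) atTop (𝓝 1) := by
    have := tendsto_add_mul_div_add_mul_atTop_nhds (𝕜 := ℝ) 1 (b + 2) 1 (d := 1) one_ne_zero
    simpa [add_comm] using this
  have h2 := h1.inv₀ one_ne_zero |>.const_mul x
  rw [inv_one, mul_one] at h2
  refine h2.congr fun k => ?_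
  have hk : (0 : ℝ) ≤ k := Nat.cast_nonneg _
  rw [Real.norm_of_nonneg (div_pos (pow_pos hx0 _) (hw _)).le,
    Real.norm_of_nonneg (div_pos (pow_pos hx0 _) (hw _)).le, monomialWeight_succ hb, pow_succ]
  have := (hw k).ne'
  have : (k : ℝ) + (b + 2) ≠ 0 := by linarith
  field_simp

/-- This sum is the reproducing kernel on the diagonal at `r`. It factors over the coordinates, and
each factor converges by the ratio test. -/
theorem tsum_radius_sq_div_weight_ne_top (β : Fin n → Set.Ici (-1 : ℝ)) {r : Fin n → ℝ≥0}
    (hr0 : ∀ i, 0 < r i) (hr : ∀ i, r i < 1) :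
    ∑' α, radius r α ^ 2 / ENNReal.ofReal (weight β α) ≠ ∞ := by
  have h1 : ∀ α : Fin n →₀ ℕ, radius r α ^ 2 / ENNReal.ofReal (weight β α) =
      ∏ i, ENNReal.ofReal (((r i : ℝ) ^ 2) ^ α i / monomialWeight (β i) (α i)) := fun α => by
    have hw : ∀ i, 0 < monomialWeight (β i) (α i) := fun i => monomialWeight_pos (β i).2 _
    rw [← ENNReal.ofReal_prod_of_nonneg fun i _ => by have := hw i; positivity,
      Finset.prod_div_distrib, ← weight_eq, ENNReal.ofReal_div_of_pos (weight_pos β α),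
      ENNReal.ofReal_prod_of_nonneg fun i _ => by positivity, radius, ← Finset.prod_pow]
    congr 1
    refine Finset.prod_congr rfl fun i _ => ?_
    rw [ENNReal.ofReal_pow (by positivity), ENNReal.ofReal_pow (by positivity),
      ENNReal.ofReal_coe_nnreal, pow_right_comm]
  simp only [h1]
  rw [tsum_prod_eq_prod_tsum
    fun i k => ENNReal.ofReal (((r i : ℝ) ^ 2) ^ k / monomialWeight (β i) k)]
  refine ENNReal.prod_ne_top fun i _ => ?_
  have h0 : (0 : ℝ) < r i := hr0 i
  have h2 : (r i : ℝ) < 1 := hr i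
  exact (summable_pow_div_monomialWeight (β i).2 (by positivity)
    (by nlinarith)).tsum_ofReal_ne_top

theorem _root_.ENNReal.tsum_mul_sq_le {ι : Type*} (f g : ι → ℝ≥0∞) :
    (∑' i, f i * g i) ^ 2 ≤ (∑' i, f i ^ 2) * ∑' i, g i ^ 2 := by
  have h1 : ∀ S : Finset ι, ∑ i ∈ S, f i * g i ≤
      (∑' i, f i ^ 2) ^ (1 / 2 : ℝ) * (∑' i, g i ^ 2) ^ (1 / 2 : ℝ) := fun S => by
    have h2 := ENNReal.inner_le_Lp_mul_Lq S f g (p := 2) (q := 2) Real.HolderConjugate.two_two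
    simp only [ENNReal.rpow_two] at h2
    refine h2.trans ?_
    gcongr <;> exact ENNReal.sum_le_tsum S
  rw [← ENNReal.mul_rpow_of_nonneg _ _ (by norm_num)] at h1
  rw [ENNReal.tsum_eq_iSup_sum]
  refine (pow_le_pow_left' (iSup_le h1) 2).trans (le_of_eq ?_)
  rw [← ENNReal.rpow_two, ← ENNReal.rpow_mul]
  norm_num

/-- Cauchy–Schwarz, with `√ω_α` distributed over the two factors. It gives continuity of evaluation,
uniformly on compact subsets of the polydisk. -/
theorem exists_absNorm_sq_le (β : Fin n → Set.Ici (-1 : ℝ)) {r : Fin n → ℝ≥0}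
    (hr0 : ∀ i, 0 < r i) (hr : ∀ i, r i < 1) : ∃ S : ℝ≥0, ∀ X : MvPowerSeries (Fin n) ℂ,
      absNorm r X ^ 2 ≤
        S * ∑' α, ‖MvPowerSeries.coeff α X‖ₑ ^ 2 * ENNReal.ofReal (weight β α) := by
  refine ⟨(∑' α, radius r α ^ 2 / ENNReal.ofReal (weight β α)).toNNReal, fun X => ?_⟩
  rw [ENNReal.coe_toNNReal (tsum_radius_sq_div_weight_ne_top β hr0 hr)]
  set w : (Fin n →₀ ℕ) → ℝ≥0∞ := fun α => ENNReal.ofReal (√(weight β α)) with hw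
  have hw0 : ∀ α, w α ≠ 0 := fun α => by
    simpa [hw] using weight_pos β α
  have hwt : ∀ α, w α ≠ ∞ := fun α => ENNReal.ofReal_ne_top
  have hw2 : ∀ α, ENNReal.ofReal (weight β α) = w α ^ 2 := fun α => by
    rw [hw, ← ENNReal.ofReal_pow (Real.sqrt_nonneg _), Real.sq_sqrt (weight_pos β α).le]
  simp only [hw2]
  have h1 : absNorm r X = ∑' α, radius r α / w α * (‖MvPowerSeries.coeff α X‖ₑ * w α) :=
    tsum_congr fun α => by
      rw [mul_comm ‖_‖ₑ (w α), ← mul_assoc, ENNReal.div_mul_cancel (hw0 α) (hwt α), mul_comm]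
  rw [h1]
  refine (ENNReal.tsum_mul_sq_le _ _).trans (le_of_eq ?_)
  congr 1
  · refine tsum_congr fun α => ?_
    rw [div_eq_mul_inv, mul_pow, ← ENNReal.inv_pow, ← div_eq_mul_inv]
  · simp only [mul_pow]

/-- The weights of the one-variable space are the moments of a probability measure on `[0, 1]`. -/
theorem exists_moment_measure {b : ℝ} (hb : -1 ≤ b) : ∃ ν : Measure ℝ≥0,
    IsProbabilityMeasure ν ∧ (∀ᵐ t ∂ν, t ≤ 1) ∧
      ∀ k : ℕ, ∫⁻ t, (t : ℝ≥0∞) ^ k ∂ν = ENNReal.ofReal (monomialWeight b k) := by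
  rcases hb.eq_or_lt with rfl | hb1
  -- For `b = -1`, the Hardy space case, all weights are `1`.
  · refine ⟨Measure.dirac 1, inferInstance, ?_, fun k => ?_⟩
    · rw [ae_dirac_eq]; simp
    · have h1 : Real.Gamma ((k : ℝ) + -1 + 2) = k.factorial := by
        rw [← Real.Gamma_nat_eq_factorial]; congr 1; ring
      have h2 : (-1 + 2 : ℝ) = 1 := by norm_num
      have h3 : (k.factorial : ℝ) ≠ 0 := by exact_mod_cast k.factorial_ne_zero
      rw [lintegral_dirac, monomialWeight, h1, h2, Real.Gamma_one, mul_one, div_self h3]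
      simp
  -- For `b > -1` the measure is the beta law with parameters `1` and `b + 1`, whose `k`-th moment
  -- is `B(k + 1, b + 1) / B(1, b + 1)`.
  · have hb' : 0 < b + 1 := by linarith
    have := ProbabilityTheory.isProbabilityMeasureBeta one_pos hb'
    refine ⟨(ProbabilityTheory.betaMeasure 1 (b + 1)).map Real.toNNReal,
      Measure.isProbabilityMeasure_map (by fun_prop), ?_, fun k => ?_⟩
    · rw [ae_map_iff (by fun_prop) measurableSet_Iic]
      rw [ProbabilityTheory.betaMeasure, ae_withDensity_iff
        (by unfold ProbabilityTheory.betaPDF; fun_prop)]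
      refine .of_forall fun x hx => ?_
      by_contra h
      refine hx (ProbabilityTheory.betaPDF_eq_zero_of_one_le ?_)
      have h2 : 1 < x.toNNReal := not_le.1 h
      exact (Real.one_lt_toNNReal.1 h2).le
    · rw [lintegral_map (by fun_prop) (by fun_prop), ProbabilityTheory.betaMeasure,
        lintegral_withDensity_eq_lintegral_mul _
          (by unfold ProbabilityTheory.betaPDF; fun_prop) (by fun_prop)]
      have hk : 0 < (k : ℝ) + 1 := by positivity
      have hB1 := ProbabilityTheory.beta_pos one_pos hb'
      have hB2 := ProbabilityTheory.beta_pos hk hb'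
      have h1 : ∀ x : ℝ, (ProbabilityTheory.betaPDF 1 (b + 1) *
          fun a : ℝ => ((a.toNNReal : ℝ≥0) : ℝ≥0∞) ^ k) x =
          ENNReal.ofReal (monomialWeight b k) * ProbabilityTheory.betaPDF (k + 1) (b + 1) x := by
        intro x
        have h2 : monomialWeight b k = ProbabilityTheory.beta (k + 1) (b + 1) /
            ProbabilityTheory.beta 1 (b + 1) := by
          have hG1 := Real.Gamma_pos_of_pos hb'
          rw [monomialWeight, ProbabilityTheory.beta, ProbabilityTheory.beta, Real.Gamma_one,
            show (k : ℝ) + b + 2 = k + 1 + (b + 1) by ring, show b + 2 = 1 + (b + 1) by ring,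
            Real.Gamma_nat_eq_factorial]
          field_simp
        simp only [Pi.mul_apply, ProbabilityTheory.betaPDF_eq]
        split_ifs with hx
        · rw [← ENNReal.ofReal, ← ENNReal.ofReal_pow hx.1.le, ← ENNReal.ofReal_mul' (by
              have := hx.1.le
              positivity),
            ← ENNReal.ofReal_mul (monomialWeight_pos hb k).le, h2]
          congr 1
          rw [sub_self, Real.rpow_zero, add_sub_cancel_right, add_sub_cancel_right,
            Real.rpow_natCast]
          field_simp
        · simp
      rw [lintegral_congr h1, lintegral_const_mul' _ _ ENNReal.ofReal_ne_top,
        ProbabilityTheory.lintegral_betaPDF_eq_one hk hb', mul_one]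

theorem measurable_radius (α : Fin n →₀ ℕ) : Measurable fun t : Fin n → ℝ≥0 => radius t α := by
  unfold radius
  fun_prop

/-- Inequalities between `ℓ²` norms over polycircles pass to the weighted spaces. -/
theorem tsum_weight_le (β : Fin n → Set.Ici (-1 : ℝ)) {a b : (Fin n →₀ ℕ) → ℝ≥0} {K : ℝ≥0}
    (h : ∀ t : Fin n → ℝ≥0, (∀ i, t i < 1) →
      ∑' α, ((a α : ℝ≥0∞) * radius t α) ^ 2 ≤ K * ∑' α, ((b α : ℝ≥0∞) * radius t α) ^ 2) :
    ∑' α, (a α : ℝ≥0∞) ^ 2 * ENNReal.ofReal (weight β α) ≤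
      K * ∑' α, (b α : ℝ≥0∞) ^ 2 * ENNReal.ofReal (weight β α) := by
  -- The moment measure may charge the radius `1`, where the hypothesis says nothing. Finite partial
  -- sums at `s * t` are continuous in `s`, and `s` tends to `1` from below.
  have hclosed : ∀ t : Fin n → ℝ≥0, (∀ i, t i ≤ 1) →
      ∑' α, ((a α : ℝ≥0∞) * radius t α) ^ 2 ≤ K * ∑' α, ((b α : ℝ≥0∞) * radius t α) ^ 2 := by
    intro t ht
    rw [ENNReal.tsum_eq_iSup_sum]
    refine iSup_le fun S => ?_
    have hc : Continuous fun s : ℝ≥0 =>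
        ((∑ α ∈ S, (a α * ∏ i, (s * t i) ^ α i) ^ 2 : ℝ≥0) : ℝ≥0∞) :=
      ENNReal.continuous_coe.comp (by fun_prop)
    have hl : (𝓝[<] (1 : ℝ≥0)).NeBot := nhdsLT_neBot_of_exists_lt ⟨0, one_pos⟩
    have h1 := (hc.tendsto 1).mono_left (nhdsWithin_le_nhds (s := Set.Iio 1))
    have h2 : ((∑ α ∈ S, (a α * ∏ i, (1 * t i) ^ α i) ^ 2 : ℝ≥0) : ℝ≥0∞) =
        ∑ α ∈ S, ((a α : ℝ≥0∞) * radius t α) ^ 2 := by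
      simp [radius]
    rw [h2] at h1
    refine le_of_tendsto h1 ?_
    filter_upwards [self_mem_nhdsWithin] with s hs
    have hs' : ∀ i, s * t i < 1 := fun i => (mul_le_of_le_one_right' (ht i)).trans_lt hs
    have h3 : ((∑ α ∈ S, (a α * ∏ i, (s * t i) ^ α i) ^ 2 : ℝ≥0) : ℝ≥0∞) =
        ∑ α ∈ S, ((a α : ℝ≥0∞) * radius (fun i => s * t i) α) ^ 2 := by
      simp [radius]
    rw [h3]
    refine (ENNReal.sum_le_tsum S).trans ((h _ hs').trans ?_)
    refine mul_le_mul_right (ENNReal.tsum_le_tsum fun α => ?_) _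
    have : radius (fun i => s * t i) α ≤ radius t α :=
      radius_mono (fun i => mul_le_of_le_one_left' (le_of_lt hs)) α
    gcongr
  choose ν hν hν1 hνm using fun i => exists_moment_measure (β i).2
  have hm : ∀ c : (Fin n →₀ ℕ) → ℝ≥0, ∑' α, (c α : ℝ≥0∞) ^ 2 * ENNReal.ofReal (weight β α) =
      ∫⁻ t, ∑' α, (c α : ℝ≥0∞) ^ 2 * radius t α ∂Measure.pi ν := by
    intro c
    rw [lintegral_tsum fun α => ((measurable_radius α).const_mul _).aemeasurable]
    refine tsum_congr fun α => ?_
    rw [lintegral_const_mul' _ _ (by simp)]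
    congr 1
    have hind := ProbabilityTheory.iIndepFun_pi (μ := ν)
      (X := fun i (t : ℝ≥0) => (t : ℝ≥0∞) ^ α i) fun i => by fun_prop
    have h4 := ProbabilityTheory.lintegral_prod_eq_prod_lintegral_of_indepFun Finset.univ _ hind
      fun i => by fun_prop
    rw [weight_eq, ENNReal.ofReal_prod_of_nonneg fun i _ => (monomialWeight_pos (β i).2 _).le]
    unfold radius
    rw [h4]
    refine Finset.prod_congr rfl fun i _ => ?_
    rw [← hνm i, ← (measurePreserving_eval ν i).lintegral_comp (by fun_prop)]
  rw [hm, hm, ← lintegral_const_mul' _ _ ENNReal.coe_ne_top]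
  refine lintegral_mono_ae ?_
  have h5 : ∀ᵐ t ∂Measure.pi ν, ∀ i, t i ≤ 1 :=
    ae_all_iff.2 fun i => (measurePreserving_eval ν i).quasiMeasurePreserving.ae (hν1 i)
  filter_upwards [h5] with t ht
  -- The means over polycircles involve `r^(2α)` and the moments `t^α`, hence the substitution `r =
  -- √t`.
  have h6 := hclosed (fun i => NNReal.sqrt (t i)) fun i => by simpa using ht i
  have h7 : ∀ α, radius (fun i => NNReal.sqrt (t i)) α ^ 2 = radius t α := fun α => by
    simp only [radius]
    rw [← Finset.prod_pow]
    refine Finset.prod_congr rfl fun i _ => ?_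
    rw [← pow_right_comm, ← ENNReal.coe_pow, NNReal.sq_sqrt]
  simpa only [mul_pow, h7] using h6

end

/-! ### Division by `φ` under locally uniform limits -/

section

theorem exists_mem_nhdsSet_tendstoUniformlyOn {E : Type*} [TopologicalSpace E] {F : ℕ → E → ℂ}
    {g : E → ℂ} {C : Set E} (hC : IsCompact C)
    (h : ∀ x ∈ C, ∃ t ∈ 𝓝 x, TendstoUniformlyOn F g atTop t) :
    ∃ W ∈ 𝓝ˢ C, TendstoUniformlyOn F g atTop W := by
  choose! t ht hF using h
  obtain ⟨s, hs, hsC⟩ := hC.elim_nhds_subcover_nhdsSet ht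
  refine ⟨_, hsC, ?_⟩
  rw [Metric.tendstoUniformlyOn_iff]
  intro ε hε
  have h1 : ∀ᶠ k in atTop, ∀ x ∈ s, ∀ y ∈ t x, dist (g y) (F k y) < ε :=
    (Finset.eventually_all s).2 fun x hx => Metric.tendstoUniformlyOn_iff.1 (hF x (hs x hx)) ε hε
  filter_upwards [h1] with k hk y hy
  obtain ⟨x, hx, hy⟩ := Set.mem_iUnion₂.1 hy
  exact hk x hx y hy

variable {E : Type*} [NormedAddCommGroup E] [NormedSpace ℂ E]

/-- A nonzero holomorphic function does not vanish on some small circle around a given point. -/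
theorem exists_circle_ne_zero {D : Set E} (hD : IsOpen D) (hDc : Convex ℝ D) {φ : E → ℂ}
    (hφ : DifferentiableOn ℂ φ D) {p q : E} (hp : p ∈ D) (hq : q ∈ D) (hφq : φ q ≠ 0) :
    ∃ r > 0, (∀ w ∈ closedBall (0 : ℂ) r, p + w • (q - p) ∈ D) ∧
      ∀ w ∈ sphere (0 : ℂ) r, φ (p + w • (q - p)) ≠ 0 := by
  set ℓ : ℂ → E := fun w => p + w • (q - p) with hℓ
  have hℓd : Differentiable ℂ ℓ := by fun_prop
  have hΩ : IsOpen (ℓ ⁻¹' D) := hD.preimage hℓd.continuous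
  have hΩc : Convex ℝ (ℓ ⁻¹' D) := by
    intro x hx y hy a b ha hb hab
    have : ℓ (a • x + b • y) = a • ℓ x + b • ℓ y := by
      have hp' : p = a • p + b • p := by rw [← add_smul, hab, one_smul]
      simp only [hℓ, smul_add, add_smul, smul_assoc]
      nth_rw 1 [hp']
      abel
    rw [Set.mem_preimage, this]
    exact hDc hx hy ha hb hab
  have h0 : (0 : ℂ) ∈ ℓ ⁻¹' D := by simpa [hℓ] using hp
  have h1 : (1 : ℂ) ∈ ℓ ⁻¹' D := by simpa [hℓ] using hq
  have hda : AnalyticOnNhd ℂ (φ ∘ ℓ) (ℓ ⁻¹' D) :=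
    (hφ.comp hℓd.differentiableOn fun w hw => hw).analyticOnNhd hΩ
  have hne : ∀ᶠ w in 𝓝[≠] 0, (φ ∘ ℓ) w ≠ 0 := by
    refine (hda 0 h0).eventually_eq_zero_or_eventually_ne_zero.resolve_left fun h => hφq ?_
    simpa [hℓ] using hda.eqOn_zero_of_preconnected_of_eventuallyEq_zero hΩc.isPreconnected h0 h h1
  obtain ⟨ε, hε, hne⟩ := Metric.eventually_nhds_iff.1 (eventually_nhdsWithin_iff.1 hne)
  obtain ⟨ε', hε', hD'⟩ := Metric.isOpen_iff.1 hΩ 0 h0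
  have hr : 0 < min ε ε' / 2 := by positivity
  refine ⟨min ε ε' / 2, hr, fun w hw => hD' ?_, fun w hw => hne ?_ ?_⟩
  · exact lt_of_le_of_lt (mem_closedBall.1 hw) (by have := min_le_right ε ε'; linarith)
  · rw [mem_sphere.1 hw]; have := min_le_left ε ε'; linarith
  · exact ne_of_mem_sphere hw hr.ne'

/-- Division by `φ` is continuous for locally uniform convergence. -/
theorem exists_eq_mul_of_tendstoUniformlyOn {D : Set E} (hD : IsOpen D) (hDc : Convex ℝ D)
    {φ : E → ℂ} (hφ : DifferentiableOn ℂ φ D) {q : E} (hq : q ∈ D) (hφq : φ q ≠ 0)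
    {f : ℕ → E → ℂ} (hf : ∀ k, DifferentiableOn ℂ (f k) D) {g : E → ℂ}
    (h : ∀ x ∈ D, ∃ t ∈ 𝓝 x, TendstoUniformlyOn (fun k z => φ z * f k z) g atTop t) :
    ∃ f₀ : E → ℂ, DifferentiableOn ℂ f₀ D ∧ ∀ z ∈ D, g z = φ z * f₀ z := by
  -- On a small circle about `p`, in the complex line towards `q`, and on its nearby translates,
  -- `|φ|` exceeds a fixed `δ`. There `f m - f k` is small, and the maximum principle carries this
  -- to the centre `x`, even where `φ x = 0`.
  have key : ∀ p ∈ D, ∃ t ∈ 𝓝 p, UniformCauchySeqOn f atTop t := by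
    intro p hp
    obtain ⟨r, hr, hrD, hrφ⟩ := exists_circle_ne_zero hD hDc hφ hp hq hφq
    have hℓ : Continuous fun x : E × ℂ => x.1 + x.2 • (q - p) := by fun_prop
    have hS : IsCompact (sphere (0 : ℂ) r) := isCompact_sphere 0 r
    have hC : IsCompact ((fun w : ℂ => p + w • (q - p)) '' sphere 0 r) :=
      hS.image (by fun_prop)
    obtain ⟨W, hW, hWu⟩ := exists_mem_nhdsSet_tendstoUniformlyOn hC (F := fun k z => φ z * f k z)
      (g := g) (by
        rintro _ ⟨w, hw, rfl⟩
        exact h _ (hrD w (sphere_subset_closedBall hw)))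
    have hcφ : ContinuousOn (fun w : ℂ => ‖φ (p + w • (q - p))‖) (sphere 0 r) :=
      (hφ.continuousOn.comp (by fun_prop) fun w hw => hrD w (sphere_subset_closedBall hw)).norm
    obtain ⟨δ, hδ, hδφ⟩ : ∃ δ > 0, ∀ w ∈ sphere (0 : ℂ) r, δ < ‖φ (p + w • (q - p))‖ := by
      obtain ⟨w₀, hw₀, hmin⟩ := hS.exists_isMinOn (NormedSpace.sphere_nonempty.2 hr.le) hcφ
      have h0 : 0 < ‖φ (p + w₀ • (q - p))‖ := norm_pos_iff.2 (hrφ w₀ hw₀)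
      exact ⟨_, half_pos h0, fun w hw => (half_lt_self h0).trans_le (hmin hw)⟩
    have e1 : ∀ᶠ x in 𝓝 p, ∀ w ∈ closedBall (0 : ℂ) r, x + w • (q - p) ∈ D :=
      (isCompact_closedBall 0 r).eventually_forall_of_forall_eventually fun w hw =>
        hℓ.continuousAt.eventually (hD.mem_nhds (hrD w hw))
    have e2 : ∀ᶠ x in 𝓝 p, ∀ w ∈ sphere (0 : ℂ) r, x + w • (q - p) ∈ W :=
      hS.eventually_forall_of_forall_eventually fun w hw =>
        hℓ.continuousAt.eventually (mem_nhdsSet_iff_forall.1 hW _ ⟨w, hw, rfl⟩)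
    have e3 : ∀ᶠ x in 𝓝 p, ∀ w ∈ sphere (0 : ℂ) r, δ < ‖φ (x + w • (q - p))‖ := by
      refine hS.eventually_forall_of_forall_eventually fun w hw => ?_
      have hc : ContinuousAt φ (p + w • (q - p)) :=
        hφ.continuousOn.continuousAt (hD.mem_nhds (hrD w (sphere_subset_closedBall hw)))
      have hc2 : ContinuousAt (fun x : E × ℂ => ‖φ (x.1 + x.2 • (q - p))‖) (p, w) :=
        (ContinuousAt.comp (g := φ) (f := fun x : E × ℂ => x.1 + x.2 • (q - p)) hc
          hℓ.continuousAt).norm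
      exact hc2.eventually (lt_mem_nhds (hδφ w hw))
    refine ⟨_, e1.and (e2.and e3), ?_⟩
    rw [Metric.uniformCauchySeqOn_iff]
    intro ε hε
    obtain ⟨N, hN⟩ := Metric.uniformCauchySeqOn_iff.1 hWu.uniformCauchySeqOn (ε / 2 * δ)
      (by positivity)
    refine ⟨N, fun m hm k hk x hx => ?_⟩
    obtain ⟨hx1, hx2, hx3⟩ := hx
    have hd : ∀ j, DifferentiableOn ℂ (fun w : ℂ => f j (x + w • (q - p))) (closedBall 0 r) :=
      fun j => (hf j).comp (by fun_prop) fun w hw => hx1 w hw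
    have hmax := Complex.norm_le_of_forall_mem_frontier_norm_le (U := ball (0 : ℂ) r)
      isBounded_ball (f := fun w => f m (x + w • (q - p)) - f k (x + w • (q - p)))
      (C := ε / 2) (((hd m).sub (hd k)).diffContOnCl_ball subset_rfl) (fun w hw => by
        rw [frontier_ball _ hr.ne'] at hw
        have h1 := hN m hm k hk _ (hx2 w hw)
        rw [dist_eq_norm, ← mul_sub, norm_mul] at h1
        have h2 := hx3 w hw
        by_contra! hcon
        have := mul_lt_mul'' hcon h2 (by positivity) hδ.le
        linarith [mul_comm ‖φ (x + w • (q - p))‖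
          ‖f m (x + w • (q - p)) - f k (x + w • (q - p))‖])
      (subset_closure (mem_ball_self hr))
    simp only [zero_smul, add_zero] at hmax
    rw [dist_eq_norm]
    linarith
  have hlim : ∀ p ∈ D, ∃ y, Tendsto (fun k => f k p) atTop (𝓝 y) := fun p hp => by
    obtain ⟨t, ht, hu⟩ := key p hp
    exact cauchySeq_tendsto_of_complete (hu.cauchySeq (mem_of_mem_nhds ht))
  choose! f₀ hf₀ using hlim
  refine ⟨f₀, differentiableOn_of_tendstoUniformlyOn_nhds (l := atTop) hD hf fun p hp => ?_, fun z hz => ?_⟩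
  · obtain ⟨t, ht, hu⟩ := key p hp
    exact ⟨t ∩ D, inter_mem ht (hD.mem_nhds hp),
      (hu.mono Set.inter_subset_left).tendstoUniformlyOn_of_tendsto fun x hx => hf₀ x hx.2⟩
  · obtain ⟨t, ht, hu⟩ := h z hz
    exact tendsto_nhds_unique (hu.tendsto_at (mem_of_mem_nhds ht)) ((hf₀ z hz).const_mul _)

end

/-! ### Norms, multipliers, and products inside a closed submodule -/

section

variable {n : ℕ}

/-- The squared norm of a power series in `A²_{β,n}`, as an extended nonnegative number. -/
noncomputable def energy (β : Fin n → Set.Ici (-1 : ℝ)) (X : MvPowerSeries (Fin n) ℂ) : ℝ≥0∞ :=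
  ∑' α, ‖MvPowerSeries.coeff α X‖ₑ ^ 2 * ENNReal.ofReal (weight β α)

theorem energy_term (β : Fin n → Set.Ici (-1 : ℝ)) (X : MvPowerSeries (Fin n) ℂ)
    (α : Fin n →₀ ℕ) : ‖MvPowerSeries.coeff α X‖ₑ ^ 2 * ENNReal.ofReal (weight β α) =
      ENNReal.ofReal (‖MvPowerSeries.coeff α X‖ ^ 2 * weight β α) := by
  rw [ENNReal.ofReal_mul (sq_nonneg _), ENNReal.ofReal_pow (norm_nonneg _), ofReal_norm]

theorem mem_space_of_energy_ne_top {β : Fin n → Set.Ici (-1 : ℝ)} {X : MvPowerSeries (Fin n) ℂ}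
    (h : energy β X ≠ ∞) : X ∈ space β := by
  have h0 : ∀ α, 0 ≤ ‖MvPowerSeries.coeff α X‖ ^ 2 * weight β α := fun α =>
    mul_nonneg (sq_nonneg _) (weight_pos β α).le
  simp only [energy, energy_term] at h
  have := ENNReal.summable_toReal h
  exact this.congr fun α => ENNReal.toReal_ofReal (h0 α)

theorem energy_eq (β : Fin n → Set.Ici (-1 : ℝ)) (F : space β) :
    energy β F.1 = ENNReal.ofReal (‖F‖ ^ 2) := by
  rw [norm_sq_eq, ENNReal.ofReal_tsum_of_nonneg
    (fun α => mul_nonneg (sq_nonneg _) (weight_pos β α).le) F.2]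
  exact tsum_congr fun α => energy_term β F.1 α

theorem energy_ne_top (β : Fin n → Set.Ici (-1 : ℝ)) (F : space β) : energy β F.1 ≠ ∞ := by
  rw [energy_eq]; exact ENNReal.ofReal_ne_top

theorem exists_absNorm_le_norm (β : Fin n → Set.Ici (-1 : ℝ)) {r : ℝ≥0} (hr0 : 0 < r)
    (hr : r < 1) : ∃ S : ℝ≥0, ∀ F : space β, absNorm (fun _ => r) F.1 ≤ S * ‖F‖ₑ := by
  obtain ⟨S, hS⟩ := exists_absNorm_sq_le β (r := fun _ => r) (fun _ => hr0) fun _ => hr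
  refine ⟨NNReal.sqrt S, fun F => ?_⟩
  have h1 : absNorm (fun _ => r) F.1 ^ 2 ≤ (NNReal.sqrt S * ‖F‖ₑ) ^ 2 := by
    refine (hS F.1).trans (le_of_eq ?_)
    rw [mul_pow, ← ENNReal.coe_pow, NNReal.sq_sqrt, ← ofReal_norm,
      ← ENNReal.ofReal_pow (norm_nonneg _), ← energy_eq, energy]
  exact (ENNReal.pow_le_pow_left_iff two_ne_zero).1 h1

theorem absNorm_ne_top_of_mem_space {β : Fin n → Set.Ici (-1 : ℝ)} (F : space β) {r : Fin n → ℝ≥0}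
    (hr : ∀ i, r i < 1) : absNorm r F.1 ≠ ∞ := by
  obtain ⟨s, hs, hs'⟩ := exists_between (a₁ := Finset.univ.sup r) (a₂ := (1 : ℝ≥0))
    ((Finset.sup_lt_iff (by simp)).2 fun i _ => hr i)
  obtain ⟨S, hS⟩ := exists_absNorm_le_norm β (zero_le.trans_lt hs) hs'
  refine ne_top_of_le_ne_top (ENNReal.mul_ne_top ENNReal.coe_ne_top ?_)
    ((absNorm_mono (fun i => ((Finset.le_sup (Finset.mem_univ i)).trans_lt hs).le) _).trans (hS F))
  exact enorm_ne_top

/-- Inequalities between the `L²` norms on polycircles give inequalities between the norms in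
`A²_{β,n}`. -/
theorem energy_le_of_lintegral_le (β : Fin n → Set.Ici (-1 : ℝ)) {X Y : MvPowerSeries (Fin n) ℂ}
    (hX : ∀ t : Fin n → ℝ≥0, (∀ i, t i < 1) → absNorm t X ≠ ∞)
    (hY : ∀ t : Fin n → ℝ≥0, (∀ i, t i < 1) → absNorm t Y ≠ ∞) {K : ℝ≥0}
    (h : ∀ t : Fin n → ℝ≥0, (∀ i, t i < 1) →
      ∫⁻ θ, ‖ev X (torusPoint t θ)‖ₑ ^ 2 ∂torusMeasure n ≤
        K * ∫⁻ θ, ‖ev Y (torusPoint t θ)‖ₑ ^ 2 ∂torusMeasure n) :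
    energy β X ≤ K * energy β Y := by
  refine tsum_weight_le β (a := fun α => ‖MvPowerSeries.coeff α X‖₊)
    (b := fun α => ‖MvPowerSeries.coeff α Y‖₊) fun t ht => ?_
  have := h t ht
  rwa [lintegral_enorm_ev_sq (hX t ht), lintegral_enorm_ev_sq (hY t ht)] at this

/-- Series that converge absolutely on the closed polydisk are multipliers. -/
theorem energy_mul_le (β : Fin n → Set.Ici (-1 : ℝ)) {X Y : MvPowerSeries (Fin n) ℂ}
    (hX : absNorm 1 X ≠ ∞) (hY : ∀ t : Fin n → ℝ≥0, (∀ i, t i < 1) → absNorm t Y ≠ ∞) :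
    energy β (X * Y) ≤ absNorm 1 X ^ 2 * energy β Y := by
  have hX' : ∀ t : Fin n → ℝ≥0, (∀ i, t i < 1) → absNorm t X ≠ ∞ := fun t ht =>
    ne_top_of_le_ne_top hX (absNorm_mono (fun i => (ht i).le) X)
  have hK : ((absNorm 1 X ^ 2).toNNReal : ℝ≥0∞) = absNorm 1 X ^ 2 :=
    ENNReal.coe_toNNReal (ENNReal.pow_ne_top hX)
  rw [← hK]
  refine energy_le_of_lintegral_le β (fun t ht => ne_top_of_le_ne_top
    (ENNReal.mul_ne_top (hX' t ht) (hY t ht)) (absNorm_mul_le _ _ _)) hY fun t ht => ?_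
  rw [← lintegral_const_mul' _ _ ENNReal.coe_ne_top, hK]
  refine lintegral_mono fun θ => ?_
  have ht' : (fun i => ‖torusPoint t θ i‖₊) = t := funext fun i => nnnorm_torusPoint t θ i
  have h1 : ev (X * Y) (torusPoint t θ) = ev X (torusPoint t θ) * ev Y (torusPoint t θ) :=
    ev_mul (by rw [ht']; exact hX' t ht) (by rw [ht']; exact hY t ht)
  simp only
  rw [h1, enorm_mul, mul_pow]
  refine mul_le_mul_left (pow_le_pow_left' ((enorm_ev_le _ _).trans ?_) 2) _
  rw [ht']
  exact absNorm_mono (fun i => (ht i).le) X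

theorem absNorm_coe_ne_top (r : Fin n → ℝ≥0) (p : MvPolynomial (Fin n) ℂ) :
    absNorm r (p : MvPowerSeries (Fin n) ℂ) ≠ ∞ := by
  rw [absNorm, tsum_eq_sum (s := p.support) fun α hα => by
    rw [MvPolynomial.coeff_coe, MvPolynomial.notMem_support_iff.1 hα, enorm_zero, zero_mul]]
  exact ENNReal.sum_ne_top.2 fun α _ => ENNReal.mul_ne_top enorm_ne_top (radius_ne_top r α)

theorem mul_mem_space {β : Fin n → Set.Ici (-1 : ℝ)} {X : MvPowerSeries (Fin n) ℂ}
    (hX : absNorm 1 X ≠ ∞) (F : space β) : X * F.1 ∈ space β :=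
  mem_space_of_energy_ne_top (ne_top_of_le_ne_top
    (ENNReal.mul_ne_top (ENNReal.pow_ne_top hX) (energy_ne_top β F))
    (energy_mul_le β hX fun _ ht => absNorm_ne_top_of_mem_space F ht))

theorem norm_le_of_energy_le {β : Fin n → Set.Ici (-1 : ℝ)} {F : space β} {C : ℝ≥0∞}
    (h : energy β F.1 ≤ C ^ 2) : ‖F‖ₑ ≤ C := by
  rw [energy_eq, ENNReal.ofReal_pow (norm_nonneg _), ofReal_norm] at h
  exact (ENNReal.pow_le_pow_left_iff two_ne_zero).1 h

theorem mem_space_of_absNorm_ne_top (β : Fin n → Set.Ici (-1 : ℝ)) {X : MvPowerSeries (Fin n) ℂ}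
    (hX : absNorm 1 X ≠ ∞) : X ∈ space β := by
  have h1 : (1 : MvPowerSeries (Fin n) ℂ) ∈ space β := by
    classical
    refine summable_of_ne_finset_zero (s := {0}) fun α hα => ?_
    rw [MvPowerSeries.coeff_one, if_neg (by simpa using hα)]
    simp
  simpa using mul_mem_space hX ⟨1, h1⟩

theorem generated_isHilbertSubmodule (β : Fin n → Set.Ici (-1 : ℝ)) (𝓕 : Set (space β)) :
    IsHilbertSubmodule β (generated β 𝓕) := by
  constructor
  · rw [generated, Submodule.coe_sInf]
    exact isClosed_biInter fun M hM => hM.1.1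
  · intro p F hF
    -- One witness has to serve all `M` at once: the product with `p`, which lies in the space
    -- because polynomials are multipliers.
    refine ⟨⟨_, mul_mem_space (absNorm_coe_ne_top 1 p) F⟩, ?_, rfl⟩
    refine Submodule.mem_sInf.2 fun M hM => ?_
    obtain ⟨G, hG, hGe⟩ := hM.1.2 p F (Submodule.mem_sInf.1 hF M hM)
    have h : G = ⟨_, mul_mem_space (absNorm_coe_ne_top 1 p) F⟩ := Subtype.ext hGe
    rwa [← h]

theorem subset_generated (β : Fin n → Set.Ici (-1 : ℝ)) (𝓕 : Set (space β)) :
    𝓕 ⊆ generated β 𝓕 := fun _ hF => Submodule.mem_sInf.2 fun _ hM => hM.2 hF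

/-- The truncations of an absolutely convergent power series approximate it. -/
theorem exists_polynomial_absNorm_sub_lt {r : Fin n → ℝ≥0} {X : MvPowerSeries (Fin n) ℂ}
    (hX : absNorm r X ≠ ∞) {ε : ℝ≥0∞} (hε : 0 < ε) :
    ∃ p : MvPolynomial (Fin n) ℂ, absNorm r (X - p) < ε := by
  classical
  obtain ⟨S, hS⟩ := ((ENNReal.tendsto_tsum_compl_atTop_zero hX).eventually (gt_mem_nhds hε)).exists
  refine ⟨∑ α ∈ S, MvPolynomial.monomial α (MvPowerSeries.coeff α X), lt_of_le_of_lt ?_ hS⟩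
  have hc : ∀ α, MvPowerSeries.coeff α (X - ((∑ α ∈ S, MvPolynomial.monomial α
      (MvPowerSeries.coeff α X) : MvPolynomial (Fin n) ℂ) : MvPowerSeries (Fin n) ℂ)) =
      if α ∈ S then 0 else MvPowerSeries.coeff α X := fun α => by
    rw [map_sub, MvPolynomial.coeff_coe, MvPolynomial.coeff_sum]
    simp only [MvPolynomial.coeff_monomial, Finset.sum_ite_eq']
    split_ifs <;> simp
  rw [absNorm]
  simp only [hc]
  refine le_of_eq (Eq.trans (tsum_congr fun α => ?_)
    (tsum_subtype {α | α ∉ S} fun α => ‖MvPowerSeries.coeff α X‖ₑ * radius r α).symm)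
  by_cases hα : α ∈ S <;> simp [hα]

/-- A closed submodule that contains `Φ` contains the products of `Φ` with the series that
converge absolutely on the closed polydisk. -/
theorem mul_mem_of_isHilbertSubmodule {β : Fin n → Set.Ici (-1 : ℝ)} {M : Submodule ℂ (space β)}
    (hM : IsHilbertSubmodule β M) {Φ : space β} (hΦ : Φ ∈ M)
    {X : MvPowerSeries (Fin n) ℂ} (hX : absNorm 1 X ≠ ∞) :
    (⟨X * Φ.1, mul_mem_space hX Φ⟩ : space β) ∈ M := by
  have hcl : (⟨X * Φ.1, mul_mem_space hX Φ⟩ : space β) ∈ closure (M : Set (space β)) := by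
    refine EMetric.mem_closure_iff.2 fun ε hε => ?_
    obtain ⟨δ, hδ, hδε⟩ : ∃ δ : ℝ≥0∞, 0 < δ ∧ δ * ‖Φ‖ₑ < ε := by
      have h1 : Tendsto (fun δ : ℝ≥0∞ => δ * ‖Φ‖ₑ) (𝓝[>] 0) (𝓝 (0 * ‖Φ‖ₑ)) :=
        (ENNReal.Tendsto.mul_const tendsto_id (Or.inr enorm_ne_top)).mono_left nhdsWithin_le_nhds
      rw [zero_mul] at h1
      obtain ⟨δ, h2, h3⟩ := ((h1.eventually (gt_mem_nhds hε)).and self_mem_nhdsWithin).exists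
      exact ⟨δ, h3, h2⟩
    obtain ⟨p, hp⟩ := exists_polynomial_absNorm_sub_lt hX hδ
    obtain ⟨G, hG, hGe⟩ := hM.2 p Φ hΦ
    refine ⟨G, hG, lt_of_le_of_lt ?_ hδε⟩
    rw [edist_eq_enorm_sub]
    refine norm_le_of_energy_le ?_
    have h1 : ((⟨X * Φ.1, mul_mem_space hX Φ⟩ - G : space β) : MvPowerSeries (Fin n) ℂ) =
        (X - p) * Φ.1 := by
      rw [Submodule.coe_sub, hGe, sub_mul]
    rw [h1, mul_pow]
    refine (energy_mul_le β hp.ne_top fun _ ht => absNorm_ne_top_of_mem_space Φ ht).trans ?_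
    rw [energy_eq, ENNReal.ofReal_pow (norm_nonneg _), ofReal_norm]
    gcongr
  rwa [hM.1.closure_eq] at hcl

end

/-! ### Weak limits of the dilated multiples -/

section

variable {n : ℕ}

/-- In `ℓ²`, bounded coordinatewise convergence implies weak convergence. -/
theorem tendsto_inner_of_tendsto_apply {ι κ : Type*} {l : Filter κ}
    {y : κ → lp (fun _ : ι => ℂ) 2} {y₀ : lp (fun _ : ι => ℂ) 2} {C : ℝ}
    (hC : ∀ᶠ k in l, ‖y k‖ ≤ C) (hy : ∀ i, Tendsto (fun k => y k i) l (𝓝 (y₀ i)))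
    (u : lp (fun _ : ι => ℂ) 2) :
    Tendsto (fun k => inner ℂ u (y k)) l (𝓝 (inner ℂ u y₀)) := by
  classical
  have hs : HasSum (fun i => lp.single 2 i (u i)) u := lp.hasSum_single ENNReal.ofNat_ne_top u
  rw [Metric.tendsto_nhds]
  intro ε hε
  set D : ℝ := |C| + ‖y₀‖ + 1 with hD
  have hD0 : 0 < D := by positivity
  obtain ⟨S, hS⟩ := (Metric.tendsto_nhds.1 hs (ε / (2 * D)) (by positivity)).exists
  set v := ∑ i ∈ S, lp.single (E := fun _ : ι => ℂ) 2 i (u i) with hv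
  have hvy : Tendsto (fun k => inner ℂ v (y k)) l (𝓝 (inner ℂ v y₀)) := by
    simp only [hv, sum_inner, lp.inner_single_left]
    exact tendsto_finsetSum _ fun i _ => (tendsto_const_nhds.inner (hy i))
  filter_upwards [hC, Metric.tendsto_nhds.1 hvy (ε / 2) (half_pos hε)] with k hk hk2
  have h1 : inner ℂ u (y k) - inner ℂ u y₀ =
      (inner ℂ v (y k) - inner ℂ v y₀) - inner ℂ (v - u) (y k - y₀) := by
    simp only [inner_sub_left, inner_sub_right]
    ring
  rw [dist_eq_norm] at hS hk2 ⊢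
  rw [h1]
  have h2 : ‖inner ℂ (v - u) (y k - y₀)‖ ≤ ε / (2 * D) * D := by
    refine (norm_inner_le_norm _ _).trans (mul_le_mul hS.le ?_ (norm_nonneg _) (by positivity))
    have := norm_sub_le (y k) y₀
    have := le_abs_self C
    linarith
  have h3 : ε / (2 * D) * D = ε / 2 := by field_simp
  have := norm_sub_le (inner ℂ v (y k) - inner ℂ v y₀) (inner ℂ (v - u) (y k - y₀))
  linarith

theorem isometry_toL2 (β : Fin n → Set.Ici (-1 : ℝ)) : Isometry (toL2 β) :=
  AddMonoidHomClass.isometry_of_norm (toL2 β) fun _ => rfl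

/-- Closed subspaces of `A²_{β,n}` are closed under bounded coefficientwise convergence. -/
theorem mem_of_tendsto_coeff {β : Fin n → Set.Ici (-1 : ℝ)} {M : Submodule ℂ (space β)}
    (hM : IsClosed (M : Set (space β))) {κ : Type*} {l : Filter κ} [l.NeBot] {G : κ → space β}
    {F : space β} {C : ℝ} (hG : ∀ᶠ k in l, G k ∈ M) (hC : ∀ᶠ k in l, ‖G k‖ ≤ C)
    (h : ∀ α, Tendsto (fun k => MvPowerSeries.coeff α (G k).1) l
      (𝓝 (MvPowerSeries.coeff α F.1))) : F ∈ M := by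
  -- In the Hilbert space `ℓ²` the closure is the double orthogonal complement, so membership is
  -- tested by inner products, which pass to the weak limit. The isometry `toL2 β` then pulls the
  -- closure back.
  have hF : toL2 β F ∈ (M.map (toL2 β)).topologicalClosure := by
    rw [← Submodule.orthogonal_orthogonal_eq_closure, Submodule.mem_orthogonal]
    intro u hu
    have h1 : Tendsto (fun k => inner ℂ u (toL2 β (G k))) l (𝓝 (inner ℂ u (toL2 β F))) :=
      tendsto_inner_of_tendsto_apply (C := C) hC (fun α => (h α).const_mul _) u
    refine tendsto_nhds_unique h1 (tendsto_const_nhds.congr' ?_)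
    filter_upwards [hG] with k hk
    exact ((Submodule.mem_orthogonal' _ _).1 hu _ (Submodule.mem_map_of_mem hk)).symm
  have h2 : F ∈ closure (M : Set (space β)) := by
    rw [(isometry_toL2 β).isUniformInducing.isInducing.closure_eq_preimage_closure_image]
    exact hF
  rwa [hM.closure_eq] at h2

theorem coeff_rescale_const (r : ℂ) (X : MvPowerSeries (Fin n) ℂ) (α : Fin n →₀ ℕ) :
    MvPowerSeries.coeff α (MvPowerSeries.rescale (fun _ => r) X) =
      (∏ i, r ^ α i) * MvPowerSeries.coeff α X := by
  rw [MvPowerSeries.coeff_rescale, Finsupp.prod_fintype _ _ fun i => pow_zero _]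

theorem absNorm_rescale (r : ℝ≥0) (t : Fin n → ℝ≥0) (X : MvPowerSeries (Fin n) ℂ) :
    absNorm t (MvPowerSeries.rescale (fun _ => ((r : ℝ) : ℂ)) X) =
      absNorm (fun i => r * t i) X := by
  refine tsum_congr fun α => ?_
  rw [coeff_rescale_const, enorm_mul, enorm_monomial, mul_comm (radius _ α), mul_assoc]
  congr 1
  simp [radius, mul_pow, Finset.prod_mul_distrib]

theorem ev_rescale (r : ℂ) (X : MvPowerSeries (Fin n) ℂ) (z : Fin n → ℂ) :
    ev (MvPowerSeries.rescale (fun _ => r) X) z = ev X fun i => r * z i := by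
  refine tsum_congr fun α => ?_
  rw [coeff_rescale_const, mul_comm (∏ i, r ^ α i), mul_assoc, ← Finset.prod_mul_distrib]
  simp only [mul_pow]

theorem tendsto_coeff_mul_rescale (Φ X : MvPowerSeries (Fin n) ℂ) (α : Fin n →₀ ℕ) :
    Tendsto (fun r : ℝ≥0 => MvPowerSeries.coeff α
      (MvPowerSeries.rescale (fun _ => ((r : ℝ) : ℂ)) X * Φ)) (𝓝[<] 1)
      (𝓝 (MvPowerSeries.coeff α (X * Φ))) := by
  classical
  simp only [MvPowerSeries.coeff_mul, coeff_rescale_const]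
  refine tendsto_finsetSum _ fun p _ => Tendsto.mul_const _ ?_
  have hc : Continuous fun r : ℝ≥0 => (∏ i, ((r : ℝ) : ℂ) ^ p.1 i) *
      MvPowerSeries.coeff p.1 X := by fun_prop
  have := (hc.tendsto 1).mono_left (nhdsWithin_le_nhds (s := Set.Iio 1))
  simpa using this

/-- A submodule generated by a function holomorphic on a neighbourhood of the closed polydisk
contains all its multiples in `A²_{β,n}` by holomorphic functions. -/
theorem mem_of_represents_mul {β : Fin n → Set.Ici (-1 : ℝ)} {φ : (Fin n → ℂ) → ℂ}
    {U : Set (Fin n → ℂ)} (hU : IsOpen U) (hφ : DifferentiableOn ℂ φ U) {R : ℝ} (hR : 1 < R)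
    (hRU : {z | ∀ i, ‖z i‖ ≤ R} ⊆ U) {M : Submodule ℂ (space β)} (hM : IsHilbertSubmodule β M)
    {Φ : space β} (hΦ : Represents Φ.1 φ) (hΦM : Φ ∈ M) {f : (Fin n → ℂ) → ℂ}
    (hf : DifferentiableOn ℂ f (polydisk n)) {F : space β}
    (hF : Represents F.1 fun z => φ z * f z) : F ∈ M := by
  obtain ⟨X, hX⟩ := exists_represents hf
  have hFX : F.1 = X * Φ.1 := hF.eq (by simpa only [mul_comm] using hX.mul hΦ)
  obtain ⟨K, hK⟩ := exists_torus_dilation_le hU hφ hR hRU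
  set Y : ℝ≥0 → MvPowerSeries (Fin n) ℂ := fun r =>
    MvPowerSeries.rescale (fun _ => ((r : ℝ) : ℂ)) X with hY
  have hYt : ∀ r < 1, ∀ t : Fin n → ℝ≥0, (∀ i, t i ≤ 1) → absNorm t (Y r) ≠ ∞ := by
    intro r hr t ht
    rw [hY, absNorm_rescale]
    exact hX.absNorm_ne_top fun i => (mul_le_of_le_one_right' (ht i)).trans_lt hr
  have hY1 : ∀ r < 1, absNorm 1 (Y r) ≠ ∞ := fun r hr => hYt r hr 1 fun _ => le_rfl
  classical
  -- The value `0` for `r ≥ 1` plays no role, since `r` tends to `1` from below.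
  set G : ℝ≥0 → space β := fun r =>
    if hr : r < 1 then ⟨Y r * Φ.1, mul_mem_space (hY1 r hr) Φ⟩ else 0 with hG
  have hGv : ∀ r < 1, (G r).1 = Y r * Φ.1 := fun r hr => by simp only [hG, dif_pos hr]
  have hl : (𝓝[<] (1 : ℝ≥0)).NeBot := nhdsLT_neBot_of_exists_lt ⟨0, one_pos⟩
  -- `K` bounds squared norms, so `√K * ‖F‖` bounds all the `G r`.
  refine mem_of_tendsto_coeff hM.1 (l := 𝓝[<] (1 : ℝ≥0)) (G := G)
    (C := (NNReal.sqrt K * ‖F‖ₑ).toReal) ?_ ?_ fun α => ?_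
  · filter_upwards [self_mem_nhdsWithin] with r hr
    have hr' : r < 1 := hr
    simp only [hG, dif_pos hr']
    exact mul_mem_of_isHilbertSubmodule hM hΦM (hY1 r hr')
  · filter_upwards [self_mem_nhdsWithin] with r hr
    have hr' : r < 1 := hr
    rw [← toReal_enorm]
    refine ENNReal.toReal_mono (ENNReal.mul_ne_top ENNReal.coe_ne_top enorm_ne_top)
      (norm_le_of_energy_le ?_)
    rw [mul_pow, ← ENNReal.coe_pow, NNReal.sq_sqrt, ← ofReal_norm,
      ← ENNReal.ofReal_pow (norm_nonneg _), ← energy_eq, hGv r hr']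
    refine energy_le_of_lintegral_le β (fun t ht => ne_top_of_le_ne_top (ENNReal.mul_ne_top
      (hYt r hr' t fun i => (ht i).le) (hΦ.absNorm_ne_top ht)) (absNorm_mul_le _ _ _))
      (fun t ht => absNorm_ne_top_of_mem_space F ht) fun t ht => ?_
    refine le_trans (le_of_eq ?_) ((hK f hf t r ht hr'.le).trans (le_of_eq ?_))
    · refine lintegral_congr fun θ => ?_
      have ht' : (fun i => ‖torusPoint t θ i‖₊) = t := funext fun i => nnnorm_torusPoint t θ i
      have hz := torusPoint_mem_polydisk ht θ
      have hz' : (fun i => ((r : ℝ) : ℂ) * torusPoint t θ i) ∈ polydisk n := fun i => by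
        rw [norm_mul, Complex.norm_real, NNReal.norm_eq]
        exact (mul_le_of_le_one_left (norm_nonneg _) (by exact_mod_cast hr'.le)).trans_lt (hz i)
      rw [ev_mul (by rw [ht']; exact hYt r hr' t fun i => (ht i).le)
        (by rw [ht']; exact hΦ.absNorm_ne_top ht), hΦ.ev_eq hz, hY, ev_rescale, hX.ev_eq hz',
        mul_comm]
    · congr 1
      refine lintegral_congr fun θ => ?_
      rw [hF.ev_eq (torusPoint_mem_polydisk ht θ)]
  · rw [hFX]
    refine (tendsto_coeff_mul_rescale Φ.1 X α).congr' ?_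
    filter_upwards [self_mem_nhdsWithin] with r hr
    rw [hGv r hr]

end

/-! ### Multiples form a closed submodule, and the two inclusions -/

section

variable {n : ℕ}

/-- The functions in `A²_{β,n}` that are the product of `φ` and a holomorphic function. -/
def multiples (β : Fin n → Set.Ici (-1 : ℝ)) (φ : (Fin n → ℂ) → ℂ) : Submodule ℂ (space β) where
  carrier := {F | ∃ f : (Fin n → ℂ) → ℂ, DifferentiableOn ℂ f (polydisk n) ∧
    Represents F.1 fun z => φ z * f z}
  zero_mem' := ⟨0, differentiableOn_const 0, fun z _ => by simp⟩
  add_mem' := by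
    rintro F G ⟨f, hf, hF⟩ ⟨g, hg, hG⟩
    refine ⟨fun z => f z + g z, hf.add hg, fun z hz => ?_⟩
    simp only [mul_add]
    exact ((hF z hz).add (hG z hz)).congr_fun fun α => by
      rw [Submodule.coe_add, map_add, add_mul]
  smul_mem' := by
    rintro a F ⟨f, hf, hF⟩
    refine ⟨fun z => a * f z, hf.const_mul a, fun z hz => ?_⟩
    simp only [mul_left_comm _ a]
    exact ((hF z hz).mul_left a).congr_fun fun α => by
      rw [Submodule.coe_smul, MvPowerSeries.coeff_smul, mul_assoc]

theorem tendstoUniformlyOn_ev {β : Fin n → Set.Ici (-1 : ℝ)} {F : ℕ → space β} {G : space β}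
    (h : Tendsto F atTop (𝓝 G)) {r : ℝ≥0} (hr0 : 0 < r) (hr : r < 1) :
    TendstoUniformlyOn (fun k => ev (F k).1) (ev G.1) atTop {z | ∀ i, ‖z i‖₊ < r} := by
  obtain ⟨S, hS⟩ := exists_absNorm_le_norm β hr0 hr
  rw [EMetric.tendstoUniformlyOn_iff]
  intro ε hε
  have h1 : Tendsto (fun k => (S : ℝ≥0∞) * ‖G - F k‖ₑ) atTop (𝓝 0) := by
    have h2 : Tendsto (fun k => ‖G - F k‖ₑ) atTop (𝓝 0) := by
      have := (tendsto_const_nhds (x := G)).edist h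
      simpa only [edist_self, edist_eq_enorm_sub] using this
    simpa using ENNReal.Tendsto.const_mul h2 (Or.inr (ENNReal.coe_ne_top (r := S)))
  filter_upwards [h1.eventually (gt_mem_nhds hε)] with k hk z hz
  have hz1 : ∀ i, ‖z i‖₊ < 1 := fun i => (hz i).trans hr
  rw [edist_eq_enorm_sub, ← ev_sub (absNorm_ne_top_of_mem_space G hz1)
    (absNorm_ne_top_of_mem_space (F k) hz1)]
  exact (((enorm_ev_le _ _).trans (absNorm_mono (fun i => (hz i).le) _)).trans
    (hS (G - F k))).trans_lt hk

/-- Norm limits are locally uniform limits of functions `φ f_k`, and division by `φ` passes to the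
limit when `φ` is not identically zero on the polydisk. If it is, all multiples vanish there and the
quotient `0` serves. -/
theorem isHilbertSubmodule_multiples (β : Fin n → Set.Ici (-1 : ℝ)) {φ : (Fin n → ℂ) → ℂ}
    (hφ : DifferentiableOn ℂ φ (polydisk n)) : IsHilbertSubmodule β (multiples β φ) := by
  constructor
  · refine IsSeqClosed.isClosed fun F G hF hFG => ?_
    choose f hf hrep using hF
    have hloc : ∀ z ∈ polydisk n, ∃ t ∈ 𝓝 z, t ⊆ polydisk n ∧
        TendstoUniformlyOn (fun k => ev (F k).1) (ev G.1) atTop t := by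
      intro z hz
      obtain ⟨r, hr0, hr, hzr⟩ := exists_le_norm_of_mem_polydisk hz
      refine ⟨{z | ∀ i, ‖z i‖₊ < r}, ?_, fun w hw i => ?_, tendstoUniformlyOn_ev hFG hr0 hr⟩
      · refine IsOpen.mem_nhds ?_ hzr
        rw [Set.ofPred_forall]
        exact isOpen_iInter_of_finite fun i => isOpen_lt (by fun_prop) continuous_const
      · exact (hw i).trans hr
    by_cases h0 : ∃ q ∈ polydisk n, φ q ≠ 0
    · obtain ⟨q, hq, hφq⟩ := h0
      obtain ⟨f₀, hf₀, hG⟩ := exists_eq_mul_of_tendstoUniformlyOn (isOpen_polydisk n)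
        (convex_polydisk n) hφ hq hφq hf (g := ev G.1) fun z hz => by
          obtain ⟨t, ht, htD, hu⟩ := hloc z hz
          exact ⟨t, ht, hu.congr (.of_forall fun k w hw => (hrep k).ev_eq (htD hw))⟩
      exact ⟨f₀, hf₀, represents_iff.2 ⟨fun _ hr => absNorm_ne_top_of_mem_space G hr, hG⟩⟩
    · push Not at h0
      refine ⟨0, differentiableOn_const 0, represents_iff.2
        ⟨fun _ hr => absNorm_ne_top_of_mem_space G hr, fun z hz => ?_⟩⟩
      obtain ⟨t, ht, -, hu⟩ := hloc z hz
      have h1 := hu.tendsto_at (mem_of_mem_nhds ht)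
      have h2 : ∀ k, ev (F k).1 z = 0 := fun k => by
        rw [(hrep k).ev_eq hz, h0 z hz, zero_mul]
      simp only [h2] at h1
      rw [Pi.zero_apply, mul_zero]
      exact (tendsto_nhds_unique h1 tendsto_const_nhds)
  · rintro p F ⟨f, hf, hF⟩
    have hp : Represents (p : MvPowerSeries (Fin n) ℂ) (ev (p : MvPowerSeries (Fin n) ℂ)) :=
      represents_iff.2 ⟨fun r _ => absNorm_coe_ne_top r p, fun _ _ => rfl⟩
    refine ⟨⟨_, mul_mem_space (absNorm_coe_ne_top 1 p) F⟩,
      ⟨fun z => ev (p : MvPowerSeries (Fin n) ℂ) z * f z, hp.differentiableOn.mul hf, ?_⟩, rfl⟩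
    simpa only [mul_left_comm] using hp.mul hF

theorem exists_one_lt_subset {U : Set (Fin n → ℂ)} (hU : IsOpen U) (hUD : closedPolydisk n ⊆ U) :
    ∃ R : ℝ, 1 < R ∧ {z | ∀ i, ‖z i‖ ≤ R} ⊆ U := by
  have hc : IsCompact (closedPolydisk n) := by
    have : closedPolydisk n = Set.univ.pi fun _ => closedBall 0 1 := by
      ext z; simp [closedPolydisk]
    rw [this]
    exact isCompact_univ_pi fun _ => isCompact_closedBall 0 1
  obtain ⟨δ, hδ, hδU⟩ := hc.exists_cthickening_subset_open hU hUD
  have hδ1 : 0 < 1 + δ := by positivity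
  refine ⟨1 + δ, by linarith, fun z hz => hδU ?_⟩
  -- Shrinking `z` by `1 / (1 + δ)` moves each coordinate by at most `δ` and lands in the closed
  -- unit polydisk.
  refine mem_cthickening_of_dist_le z (fun i => ((1 + δ : ℝ) : ℂ)⁻¹ * z i) δ _ (fun i => ?_) ?_
  · rw [norm_mul, norm_inv, Complex.norm_real, Real.norm_of_nonneg hδ1.le, inv_mul_le_one₀ hδ1]
    exact hz i
  · rw [dist_pi_le_iff hδ.le]
    intro i
    have h1 : z i - ((1 + δ : ℝ) : ℂ)⁻¹ * z i = ((δ / (1 + δ) : ℝ) : ℂ) * z i := by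
      have : ((1 + δ : ℝ) : ℂ) ≠ 0 := by exact_mod_cast hδ1.ne'
      push_cast at this ⊢
      field_simp
      ring
    rw [dist_eq_norm, h1, norm_mul, Complex.norm_real, Real.norm_of_nonneg (by positivity),
      div_mul_eq_mul_div, div_le_iff₀ hδ1]
    exact mul_le_mul_of_nonneg_left (hz i) hδ.le

/-- A function holomorphic on a neighbourhood of the closed polydisk belongs to `A²_{β,n}`. -/
theorem exists_space_represents (β : Fin n → Set.Ici (-1 : ℝ)) {U : Set (Fin n → ℂ)}
    (hU : IsOpen U) (hUD : closedPolydisk n ⊆ U) {φ : (Fin n → ℂ) → ℂ}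
    (hφ : DifferentiableOn ℂ φ U) : ∃ Φ : space β, Represents Φ.1 φ := by
  obtain ⟨R, hR, hRU⟩ := exists_one_lt_subset hU hUD
  have hR0 : 0 < R := one_pos.trans hR
  obtain ⟨X, M, hX, hXe⟩ := exists_powerSeries_of_differentiableOn hR0 hRU hφ
  refine ⟨⟨X, mem_space_of_absNorm_ne_top β
    (absNorm_ne_top_of_coeff_le hR0 hX fun _ => by simpa using hR)⟩, represents_iff.2
    ⟨fun r hr => absNorm_ne_top_of_coeff_le hR0 hX fun i => ?_,
      fun z hz => hXe z fun i => (hz i).trans hR⟩⟩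
  exact lt_trans (by exact_mod_cast hr i) hR

theorem generated_singleton_eq_multiples {β : Fin n → Set.Ici (-1 : ℝ)} {U : Set (Fin n → ℂ)}
    (hU : IsOpen U) (hUD : closedPolydisk n ⊆ U) {φ : (Fin n → ℂ) → ℂ}
    (hφ : DifferentiableOn ℂ φ U) {Φ : space β} (hΦ : Represents Φ.1 φ) :
    generated β {Φ} = multiples β φ := by
  obtain ⟨R, hR, hRU⟩ := exists_one_lt_subset hU hUD
  refine le_antisymm (sInf_le ⟨isHilbertSubmodule_multiples β
    (hφ.mono fun z hz => hUD fun i => (hz i).le), Set.singleton_subset_iff.2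
    ⟨1, differentiableOn_const 1, by simpa using hΦ⟩⟩) ?_
  rintro F ⟨f, hf, hF⟩
  exact mem_of_represents_mul hU hφ hR hRU (generated_isHilbertSubmodule β {Φ}) hΦ
    (subset_generated β {Φ} rfl) hf hF

end

end WeightedBergman

theorem theorem2p1 (n : ℕ) (β : Fin n → Set.Ici (-1 : ℝ))
    (U : Set (Fin n → ℂ)) (hU : IsOpen U) (hUD : WeightedBergman.closedPolydisk n ⊆ U)
    (φ : (Fin n → ℂ) → ℂ) (hφ : DifferentiableOn ℂ φ U) :
    (∃ Φ : WeightedBergman.space β, WeightedBergman.Represents Φ.1 φ) ∧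
    ∀ Φ : WeightedBergman.space β, WeightedBergman.Represents Φ.1 φ →
      (WeightedBergman.generated β {Φ} : Set (WeightedBergman.space β)) =
        {F | ∃ f : (Fin n → ℂ) → ℂ, DifferentiableOn ℂ f (WeightedBergman.polydisk n) ∧
          WeightedBergman.Represents F.1 (fun z => φ z * f z)} := by
  exact ⟨WeightedBergman.exists_space_represents β hU hUD hφ, fun Φ hΦ =>
    congrArg (fun M : Submodule ℂ (WeightedBergman.space β) => (M : Set (WeightedBergman.space β)))
      (WeightedBergman.generated_singleton_eq_multiples hU hUD hφ hΦ)⟩
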